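/- Write $\mathbf x=(x_1,\mathbf x_\perp)\in\mathbb R\times\mathbb R^2$ for points of $\mathbb R^3$. Let $V:\mathbb R^3\to\mathbb R$ be measurable with $$\sup_{\mathbf x\in\mathbb R^3}\int_{|\mathbf x-\mathbf y|\le 1}|V(\mathbf y)|^2\,d\mathbf y<\infty ,\qquad \lim_{R\to\infty}\ \sup_{|\mathbf x_\perp|\ge R}\int_{|\mathbf x-\mathbf y|\le 1}|V(\mathbf y)|^2\,d\mathbf y=0 ,$$ and let $H$ be the closure in $L^2(\mathbb R^3)$ of $-\Delta+V$ defined on $C_0^\infty(\mathbb R^3)$. Let $\sigma_0\subset\sigma(H)\cap\mathbb R$ be an isolated part of the spectrum, that is, at positive distance from $\sigma(H)\setminus\sigma_0$, with $\sup\sigma_0=-E_+<0$. Let $\Gamma$ be a positively oriented contour of finite length in $\mathbb C\setminus\sigma(H)$ enclosing $\sigma_0$ (finitely many closed rectifiable curves with total winding number $1$ about each point of $\sigma_0$ and $0$ about each point of $\sigma(H)\setminus\sigma_0$), and put $$P_0=\frac{i}{2\pi}\int_\Gamma (H-z)^{-1}\,dz,\qquad \mathcal K=\operatorname{Ran}P_0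 .$$ Let $X_\parallel$ be multiplication by $x_1$ on its maximal domain $\mathcal D(X_\parallel)\subset L^2(\mathbb R^3)$, and let $\hat X_\parallel=P_0X_\parallel P_0$ be the operator in $\mathcal K$ with domain $\mathcal D(X_\parallel)\cap\mathcal K$. For $a\in\mathbb R$ let $g_a(\mathbf x)=\sqrt{(x_1-a)^2+1}$, and let $\mathbf P=-i\nabla$. Call $\alpha_\parallel>0$ *admissible* if there is $b<1$ such that for all $z\in\Gamma$ and all $a\in\mathbb R$ $$\big\|\alpha_\parallel\big(i\mathbf P\cdot\nabla g_a+i\nabla g_a\cdot\mathbf P-\alpha_\parallel|\nabla g_a|^2\big)(H-z)^{-1}\big\|\le b .$$ Then: (i) $\mathcal K$ is a Hilbert space (a closed subspace of $L^2(\mathbb R^3)$), and $\hat X_\parallel$ is self-adjoint in $\mathcal K$ on $\mathcal D(X_\parallel)\cap\mathcal K$. (ii) $\hat X_\parallel$ has purely discrete spectrum: every point of $G:=\sigma(\hat X_\parallel)$ is an isolated point of $G$ and an eigenvalue of finite multiplicity. (iii) Admissible exponents exist. For every admissible $\alpha_\parallel$ and every $0<\alpha_\perp<\sqrt{E_+}$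 there is $M_1<\infty$ such that for all $\beta\in[0,1]$, all $g\in G$, every orthonormal basis $\{W_{g,j}\}_{1\le j\le m_g}$ of the eigenspace of $\hat X_\parallel$ for the eigenvalue $g$, and all $j$, $$\int_{\mathbb R^3}e^{2(1-\beta)\alpha_\parallel|x_1-g|}\,e^{2\beta\alpha_\perp|\mathbf x_\perp|}\,|W_{g,j}(\mathbf x)|^2\,d\mathbf x\le M_1 .$$ (iv) For $a\in\mathbb R$ and $L\ge 1$ let $N(a,L)$ be the total multiplicity of the spectrum of $\hat X_\parallel$ contained in $[a-L,a+L]$. There is $M_2<\infty$ such that $N(a,L)\le M_2\cdot L$ for all $a\in\mathbb R$ and all $L\ge1$. -/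

import Mathlib

open MeasureTheory Set Filter Topology
open scoped NNReal ContDiff Laplacian

noncomputable section

namespace BandPosition

/-! ### Unbounded operators: resolvent, spectrum, eigenspaces -/

section Unbounded

/-- The bounded operator `R` is the (two-sided) inverse of `T - z : D(T) → E`. -/
def IsResolventAt {E : Type*} [NormedAddCommGroup E] [NormedSpace ℂ E]
    (T : E →ₗ.[ℂ] E) (z : ℂ) (R : E →L[ℂ] E) : Prop :=
  (∀ f : E, ∃ h : R f ∈ T.domain, T ⟨R f, h⟩ - z • R f = f) ∧
    ∀ x : T.domain, R (T x - z • (x : E)) = x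

/-- The spectrum of `T`: the points `z` at which `T - z` has no bounded inverse. -/
def spec {E : Type*} [NormedAddCommGroup E] [NormedSpace ℂ E] (T : E →ₗ.[ℂ] E) : Set ℂ :=
  {z | ¬ ∃ R : E →L[ℂ] E, IsResolventAt T z R}

open Classical in
/-- The resolvent `(T - z)⁻¹` for `z` outside the spectrum (and `0` on the spectrum). -/
def resolventOp {E : Type*} [NormedAddCommGroup E] [NormedSpace ℂ E]
    (T : E →ₗ.[ℂ] E) (z : ℂ) : E →L[ℂ] E :=
  if h : ∃ R : E →L[ℂ] E, IsResolventAt T z R then h.choose else 0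

/-- The eigenspace `{x ∈ D(T) : T x = z x}`. -/
def eigenspaceOf {E : Type*} [NormedAddCommGroup E] [NormedSpace ℂ E]
    (T : E →ₗ.[ℂ] E) (z : ℂ) : Submodule ℂ E where
  carrier := {x | ∃ h : x ∈ T.domain, T ⟨x, h⟩ = z • x}
  zero_mem' := ⟨T.domain.zero_mem, by
    have h : (⟨0, T.domain.zero_mem⟩ : T.domain) = 0 := rfl
    rw [h, T.map_zero, smul_zero]⟩
  add_mem' := by
    rintro x y ⟨hx, hx'⟩ ⟨hy, hy'⟩
    refine ⟨T.domain.add_mem hx hy, ?_⟩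
    have h : (⟨x + y, T.domain.add_mem hx hy⟩ : T.domain) = ⟨x, hx⟩ + ⟨y, hy⟩ := rfl
    rw [h, T.map_add, hx', hy', smul_add]
  smul_mem' := by
    rintro c x ⟨hx, hx'⟩
    refine ⟨T.domain.smul_mem c hx, ?_⟩
    have h : (⟨c • x, T.domain.smul_mem c hx⟩ : T.domain) = c • ⟨x, hx⟩ := rfl
    rw [h, T.map_smul, hx', smul_comm]

/-- Purely discrete spectrum (of a self-adjoint operator): every point of the spectrum is an
isolated point of the spectrum and an eigenvalue of finite multiplicity. -/
def HasPurelyDiscreteSpectrum {E : Type*} [NormedAddCommGroup E] [NormedSpace ℂ E]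
    (T : E →ₗ.[ℂ] E) : Prop :=
  ∀ z ∈ spec T,
    (∃ ε > 0, ∀ w ∈ spec T, w ≠ z → ε ≤ dist w z) ∧
      eigenspaceOf T z ≠ ⊥ ∧ FiniteDimensional ℂ (eigenspaceOf T z)

/-- The total multiplicity of the part of the spectrum of `T` contained in the real interval
`[c, d]`: the sum over its points of the dimensions of the eigenspaces. -/
def totalMultiplicity {E : Type*} [NormedAddCommGroup E] [NormedSpace ℂ E]
    (T : E →ₗ.[ℂ] E) (c d : ℝ) : ENNReal :=
  ∑' g : {g : ℝ // g ∈ Icc c d ∧ (g : ℂ) ∈ spec T},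
    ((Cardinal.toENat (Module.rank ℂ (eigenspaceOf T ((g : ℝ) : ℂ))) : ℕ∞) : ENNReal)

end Unbounded

/-! ### Contours and Riesz operators -/

/-- A positively oriented contour of finite length enclosing `S` inside the complement of `A`,
where `S ⊆ A`: finitely many closed rectifiable curves, in Lipschitz parametrization, which avoid
`A` and have total winding number `1` around every point of `S` and `0` around every point of
`A \ S`. -/
structure EnclosingContour (A S : Set ℂ) where
  /-- the number of closed curves -/
  n : ℕ
  /-- the curves, parametrized by `[0, 1]` -/
  curve : Fin n → ℝ → ℂ
  lipschitz : ∀ k, ∃ C : ℝ≥0, LipschitzOnWith C (curve k) (Icc 0 1)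
  closed : ∀ k, curve k 0 = curve k 1
  avoids : ∀ k, ∀ t ∈ Icc (0 : ℝ) 1, curve k t ∉ A
  winding_one : ∀ w ∈ S,
    (2 * Real.pi * Complex.I)⁻¹ *
      ∑ k, ∫ t in (0 : ℝ)..1, deriv (curve k) t / (curve k t - w) = 1
  winding_zero : ∀ w ∈ A \ S,
    (2 * Real.pi * Complex.I)⁻¹ *
      ∑ k, ∫ t in (0 : ℝ)..1, deriv (curve k) t / (curve k t - w) = 0

/-- The trace of a contour. -/
def EnclosingContour.trace {A S : Set ℂ} (Γ : EnclosingContour A S) : Set ℂ :=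
  {z | ∃ k, ∃ t ∈ Icc (0 : ℝ) 1, z = Γ.curve k t}

/-- The Riesz operator `(i / 2π) ∫_Γ (T - z)⁻¹ dz`. -/
def rieszProjection {E : Type*} [NormedAddCommGroup E] [NormedSpace ℂ E]
    (T : E →ₗ.[ℂ] E) {S : Set ℂ} (Γ : EnclosingContour (spec T) S) : E →L[ℂ] E :=
  (Complex.I / (2 * Real.pi)) •
    ∑ k, ∫ t in (0 : ℝ)..1, deriv (Γ.curve k) t • resolventOp T (Γ.curve k t)

/-! ### The Schrödinger operator -/

/-- Three-dimensional Euclidean space; the coordinates `x₁, x₂, x₃` are `x 0, x 1, x 2`. -/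
abbrev R3 : Type := EuclideanSpace ℝ (Fin 3)

/-- The Hilbert space `L²(ℝ³; ℂ)`. -/
abbrev L2 : Type := Lp ℂ 2 (volume : Measure R3)

/-- `|x_⊥|`, the distance of `x` from the `x₁`-axis. -/
def perpNorm (x : R3) : ℝ := Real.sqrt (x 1 ^ 2 + x 2 ^ 2)

/-- `∫_{|x - y| ≤ 1} |V(y)|² dy`. -/
def localMass (V : R3 → ℝ) (x : R3) : ENNReal :=
  ∫⁻ y in Metric.closedBall x 1, ENNReal.ofReal (|V y| ^ 2)

/-- The supremum of `∫_{|x - y| ≤ 1} |V(y)|² dy` over all `x`. -/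
def uniformMass (V : R3 → ℝ) : ENNReal := ⨆ x : R3, localMass V x

/-- `I_V(R)`: the supremum of `∫_{|x - y| ≤ 1} |V(y)|² dy` over all `x` with `|x_⊥| ≥ R`. -/
def outerMass (V : R3 → ℝ) (R : ℝ) : ENNReal :=
  ⨆ x : {x : R3 // R ≤ perpNorm x}, localMass V x

/-- The differential expression `-Δφ + Vφ`. -/
def schrodingerExpr (V : R3 → ℝ) (φ : R3 → ℂ) (x : R3) : ℂ :=
  -(Δ φ) x + (V x : ℂ) * φ x

/-- Smooth compactly supported functions. -/
def IsTest (φ : R3 → ℂ) : Prop := ContDiff ℝ ∞ φ ∧ HasCompactSupport φ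

theorem two_le_smooth : (2 : WithTop ℕ∞) ≤ ∞ :=
  WithTop.coe_le_coe.2 (le_top : (2 : ℕ∞) ≤ ⊤)

theorem IsTest.schrodingerExpr_add {φ ψ : R3 → ℂ} (V : R3 → ℝ) (hφ : IsTest φ) (hψ : IsTest ψ) :
    schrodingerExpr V (φ + ψ) = schrodingerExpr V φ + schrodingerExpr V ψ := by
  funext x
  have h : (Δ (φ + ψ)) x = (Δ φ) x + (Δ ψ) x :=
    ContDiffAt.laplacian_add (hφ.1.of_le two_le_smooth).contDiffAt
      (hψ.1.of_le two_le_smooth).contDiffAt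
  simp only [schrodingerExpr, Pi.add_apply, h]
  ring

theorem IsTest.schrodingerExpr_smul {φ : R3 → ℂ} (V : R3 → ℝ) (hφ : IsTest φ) (c : ℂ) :
    schrodingerExpr V (c • φ) = c • schrodingerExpr V φ := by
  funext x
  have h : (Δ (c • φ)) x = c • (Δ φ) x :=
    InnerProductSpace.laplacian_smul c (hφ.1.of_le two_le_smooth).contDiffAt
  simp only [schrodingerExpr, Pi.smul_apply, h, smul_eq_mul]
  ring

/-- The graph of `-Δ + V` on the smooth compactly supported functions (those `φ` with
`-Δφ + Vφ ∈ L²`, which is automatic for locally square integrable `V`). -/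
def minimalGraph (V : R3 → ℝ) : Submodule ℂ (L2 × L2) where
  carrier := {p | ∃ φ : R3 → ℂ, IsTest φ ∧
    (p.1 : R3 → ℂ) =ᵐ[volume] φ ∧ (p.2 : R3 → ℂ) =ᵐ[volume] schrodingerExpr V φ}
  zero_mem' := by
    refine ⟨0, ⟨contDiff_const, HasCompactSupport.zero⟩, Lp.coeFn_zero _ _ _, ?_⟩
    have h : schrodingerExpr V 0 = 0 := by
      have h0 : IsTest (0 : R3 → ℂ) := ⟨contDiff_const, HasCompactSupport.zero⟩
      simpa using h0.schrodingerExpr_smul V 0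
    rw [h]
    exact Lp.coeFn_zero _ _ _
  add_mem' := by
    rintro p q ⟨φ, hφ, h1, h2⟩ ⟨ψ, hψ, h3, h4⟩
    refine ⟨φ + ψ, ⟨hφ.1.add hψ.1, hφ.2.add hψ.2⟩,
      (Lp.coeFn_add p.1 q.1).trans (h1.add h3), ?_⟩
    rw [hφ.schrodingerExpr_add V hψ]
    exact (Lp.coeFn_add p.2 q.2).trans (h2.add h4)
  smul_mem' := by
    rintro c p ⟨φ, hφ, h1, h2⟩
    refine ⟨c • φ, ⟨hφ.1.const_smul c, ?_⟩,
      (Lp.coeFn_smul c p.1).trans (h1.const_smul c), ?_⟩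
    · exact hφ.2.mono (Function.support_const_smul_subset c φ)
    · rw [hφ.schrodingerExpr_smul V c]
      exact (Lp.coeFn_smul c p.2).trans (h2.const_smul c)

/-- `minimalGraph V` is the graph of an operator, so that `Submodule.toLinearPMap` is meaningful. -/
theorem minimalGraph_functional (V : R3 → ℝ) :
    ∀ p ∈ minimalGraph V, p.1 = 0 → p.2 = 0 := by
  rintro p ⟨φ, hφ, h1, h2⟩ h0
  have hφ0 : φ =ᵐ[volume] (0 : R3 → ℂ) := by
    rw [h0] at h1
    exact h1.symm.trans (Lp.coeFn_zero _ _ _)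
  have hz : φ = 0 := (Continuous.ae_eq_iff_eq volume hφ.1.continuous continuous_zero).1 hφ0
  have h : schrodingerExpr V φ = 0 := by
    have := hφ.schrodingerExpr_smul V 0
    simpa [hz] using this
  rw [h] at h2
  exact (Lp.eq_zero_iff_ae_eq_zero).2 h2

/-- The Hamiltonian `H = -Δ + V`: the closure of `-Δ + V` on `C_c^∞(ℝ³)`. -/
def hamiltonian (V : R3 → ℝ) : L2 →ₗ.[ℂ] L2 := (minimalGraph V).toLinearPMap.closure

/-! ### The band position operator -/

theorem coord_mul_add_ae (f g : L2) :
    (fun x : R3 => (x 0 : ℂ) * (f + g : L2) x) =ᵐ[volume]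
      (fun x : R3 => (x 0 : ℂ) * f x) + fun x : R3 => (x 0 : ℂ) * g x := by
  filter_upwards [Lp.coeFn_add f g] with x hx
  rw [hx, Pi.add_apply, Pi.add_apply, mul_add]

theorem coord_mul_smul_ae (c : ℂ) (f : L2) :
    (fun x : R3 => (x 0 : ℂ) * (c • f : L2) x) =ᵐ[volume]
      c • fun x : R3 => (x 0 : ℂ) * f x := by
  filter_upwards [Lp.coeFn_smul c f] with x hx
  rw [hx, Pi.smul_apply, Pi.smul_apply, smul_eq_mul, smul_eq_mul, mul_left_comm]

/-- The maximal domain `{f ∈ L² : x₁ f ∈ L²}` of multiplication by `x₁`. -/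
def positionDomain : Submodule ℂ L2 where
  carrier := {f | MemLp (fun x : R3 => (x 0 : ℂ) * f x) 2 volume}
  zero_mem' := by
    have h : (fun x : R3 => (x 0 : ℂ) * (0 : L2) x) =ᵐ[volume] fun _ => (0 : ℂ) := by
      filter_upwards [Lp.coeFn_zero ℂ 2 (volume : Measure R3)] with x hx
      rw [hx, Pi.zero_apply, mul_zero]
    exact (memLp_congr_ae h).2 MemLp.zero'
  add_mem' := fun {f g} hf hg =>
    (memLp_congr_ae (coord_mul_add_ae f g)).2 (MemLp.add hf hg)
  smul_mem' := fun c f hf =>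
    (memLp_congr_ae (coord_mul_smul_ae c f)).2 (MemLp.const_smul hf c)

/-- The class of `x₁ f` for `f` in the maximal domain. -/
def coordMul (f : positionDomain) : L2 :=
  MemLp.toLp (fun x : R3 => (x 0 : ℂ) * (f : L2) x) f.2

theorem coordMul_ae (f : positionDomain) :
    (coordMul f : R3 → ℂ) =ᵐ[volume] fun x : R3 => (x 0 : ℂ) * (f : L2) x :=
  MemLp.coeFn_toLp f.2

theorem coordMul_add (f g : positionDomain) : coordMul (f + g) = coordMul f + coordMul g := by
  apply Lp.ext
  refine (coordMul_ae (f + g)).trans ((coord_mul_add_ae f g).trans ?_)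
  exact ((coordMul_ae f).symm.add (coordMul_ae g).symm).trans (Lp.coeFn_add _ _).symm

theorem coordMul_smul (c : ℂ) (f : positionDomain) : coordMul (c • f) = c • coordMul f := by
  apply Lp.ext
  refine (coordMul_ae (c • f)).trans ((coord_mul_smul_ae c f).trans ?_)
  exact ((coordMul_ae f).symm.const_smul c).trans (Lp.coeFn_smul _ _).symm

/-- Multiplication by `x₁` on its maximal domain in `L²(ℝ³)`. -/
def positionOp : L2 →ₗ.[ℂ] L2 where
  domain := positionDomain
  toFun :=
    { toFun := coordMul
      map_add' := coordMul_add
      map_smul' := coordMul_smul }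

/-- The range of a bounded operator on `L²(ℝ³)`, as a subspace. -/
abbrev ran (P : L2 →L[ℂ] L2) : Submodule ℂ L2 := LinearMap.range (P : L2 →ₗ[ℂ] L2)

/-- The band position operator `P X₁ P` in `Ran P`, with domain `D(X₁) ∩ Ran P`. For a projection
`P` one has `P ψ = ψ` on `Ran P`, so that the value at `ψ` is `P (X₁ ψ)`. -/
def bandPosition (P : L2 →L[ℂ] L2) : ran P →ₗ.[ℂ] ran P where
  domain := positionOp.domain.comap (ran P).subtype
  toFun :=
    { toFun := fun ψ => ⟨P (positionOp ⟨((ψ : ran P) : L2), ψ.2⟩), ⟨_, rfl⟩⟩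
      map_add' := by
        intro ψ χ
        apply Subtype.ext
        change P (positionOp (⟨_, ψ.2⟩ + ⟨_, χ.2⟩)) = _
        rw [LinearPMap.map_add, map_add]
        rfl
      map_smul' := by
        intro c ψ
        apply Subtype.ext
        change P (positionOp (c • ⟨_, ψ.2⟩)) = _
        rw [LinearPMap.map_smul, map_smul]
        rfl }

/-! ### The parallel decay exponents -/

/-- The weight `g_a(x) = √((x₁ - a)² + 1)`. -/
def parWeight (a : ℝ) (x : R3) : ℝ := Real.sqrt ((x 0 - a) ^ 2 + 1)

/-- The partial derivative `∂_j f`. -/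
def partialDeriv {F : Type*} [NormedAddCommGroup F] [NormedSpace ℝ F]
    (j : Fin 3) (f : R3 → F) (x : R3) : F :=
  fderiv ℝ f x (EuclideanSpace.single j 1)

/-- The expression `α (i P·∇h + i ∇h·P - α |∇h|²) φ`, with `P = -i∇`, that is
`α (∇·(φ ∇h) + ∇h·∇φ - α |∇h|² φ)`; it is `e^{αh} H e^{-αh} φ - H φ`. -/
def conjugationTerm (α : ℝ) (h : R3 → ℝ) (φ : R3 → ℂ) (x : R3) : ℂ :=
  (α : ℂ) * ∑ j : Fin 3,
    (partialDeriv j (fun y => ((partialDeriv j h y : ℝ) : ℂ) * φ y) x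
      + ((partialDeriv j h x : ℝ) : ℂ) * partialDeriv j φ x
      - (α : ℂ) * ((partialDeriv j h x : ℝ) : ℂ) ^ 2 * φ x)

/-- `α > 0` is an admissible parallel exponent for the contour trace `Z`: for some `b < 1`,
`‖α (i P·∇g_a + i ∇g_a·P - α |∇g_a|²) (H - z)⁻¹‖ ≤ b` for all `z ∈ Z` and all `a`.
The bound is written on `C_c^∞(ℝ³)`, which is a core of `H`. -/
def IsParallelExponent (V : R3 → ℝ) (Z : Set ℂ) (α : ℝ) : Prop :=
  0 < α ∧ ∃ b : ℝ≥0, b < 1 ∧ ∀ z ∈ Z, ∀ a : ℝ, ∀ φ : R3 → ℂ, IsTest φ →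
    eLpNorm (conjugationTerm α (parWeight a) φ) 2 volume
      ≤ b * eLpNorm (fun x => schrodingerExpr V φ x - z * φ x) 2 volume

end BandPosition

end

/-! The main tool is conjugation of the spectral projection P by a function f of x₁. Formally f⁻¹Hf
− H = −2p∂₁ − q with p = f'/f and q = f''/f. This is a first order operator, bounded relative to H
because |V| is form small with respect to −Δ (`IsAdmissible.exists_form_bound`,
`IsAdmissible.exists_gradNormSq_le`). When (f⁻¹Hf − H)(H − z)⁻¹ has norm at most θ < 1 on the
contour, f⁻¹(H − z)⁻¹f is bounded there, hence so is f⁻¹Pf (`RelBound.P_mul_op`), and f⁻¹Pf depends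
in a Lipschitz way on p and q (`exists_norm_proj_sub_le`).

Position itself is treated as such a weight. Put s = (x₁ − a)/b, σ = ±1 and f = 1/(s + iσ exp(−s²)).
This f is bounded, and its p and q are O(1/b) uniformly in a, so for large b the projection Q =
f⁻¹Pf is within 1/2 of P. Writing u = fw with w in Ran Q gives (X − a + iσb exp(−s²))u = bw, so the
equation for u in Ran P becomes the inversion of P from Ran Q to Ran P, which is possible since ‖Q −
P‖ < 1 (`exists_shift_solution`). Thus PXP plus or minus i times a bounded symmetric operator is
onto, and PXP is self-adjoint (`isMaximalSymmetric_of_surjective`).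

For an eigenvector the same equation reads w = (Q − P)w + iP exp(−s²)u. Its source decays faster
than any exponential. Conjugating once more by exp(−α√((x₁ − g)² + 1)), which admissibility of α
permits, keeps the contraction constant at 1/2, and uniqueness of the solution forces w, hence u, to
decay exponentially (`exists_parallel_decay`).

Transverse decay is an energy argument. On Ran P the form of H is at most −E₊, while with a weight M
= exp(α|x_⊥|), suitably truncated, the form of H is at least −(α² + ε)‖Mu‖² − C‖u‖², because V is
negligible far from the axis. Since α² < E₊, a near-maximizer of ‖Mu‖ bounds M on Ran P
independently of the truncation (`norm_mul_sq_le_of_form_bounds`, `exists_perp_decay`). The weight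
with exponents (1 − β, β) is at most the sum of the two extreme ones.

Discreteness and counting are one statement. If u in Ran P satisfies ‖(PXP − a)u‖ ≤ L‖u‖, then most
of its mass lies in a tube piece of length O(L) and fixed radius, and u has a bounded H¹ norm. If
moreover its averages over O(L) small balls vanish, a Poincaré inequality gives u = 0
(`exists_separating`). Hence O(L) linear functionals separate the spectral subspace for [a − L, a +
L], and off their common kernel only finitely many dimensions remain
(`IsMaximalSymmetric.not_mem_spec`, `Separates.totalMultiplicity_le`). -/

noncomputable section

namespace BandPosition

/-! ### Calculus of test functions -/

/-- The space of test functions. -/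
def testSpace : Submodule ℂ (R3 → ℂ) where
  carrier := {φ | IsTest φ}
  zero_mem' := ⟨contDiff_const, HasCompactSupport.zero⟩
  add_mem' := fun hφ hψ => ⟨hφ.1.add hψ.1, hφ.2.add hψ.2⟩
  smul_mem' := fun c φ hφ =>
    ⟨hφ.1.const_smul c, hφ.2.mono (Function.support_const_smul_subset c φ)⟩

/-- The type of test functions. -/
abbrev TestFun : Type := testSpace

theorem TestFun.isTest (φ : TestFun) : IsTest (φ : R3 → ℂ) := φ.2

theorem TestFun.contDiff (φ : TestFun) : ContDiff ℝ ∞ (φ : R3 → ℂ) := φ.2.1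

theorem TestFun.differentiable (φ : TestFun) : Differentiable ℝ (φ : R3 → ℂ) :=
  φ.contDiff.differentiable (by simp)

theorem TestFun.continuous (φ : TestFun) : Continuous (φ : R3 → ℂ) := φ.contDiff.continuous

theorem TestFun.hasCompactSupport (φ : TestFun) : HasCompactSupport (φ : R3 → ℂ) := φ.2.2

theorem TestFun.memLp (φ : TestFun) (p : ENNReal) : MemLp (φ : R3 → ℂ) p volume :=
  φ.continuous.memLp_of_hasCompactSupport φ.hasCompactSupport

theorem contDiff_partialDeriv {F : Type*} [NormedAddCommGroup F] [NormedSpace ℝ F] {f : R3 → F}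
    (hf : ContDiff ℝ ∞ f) (j : Fin 3) : ContDiff ℝ ∞ (partialDeriv j f) :=
  (hf.fderiv_right (m := ∞) (by simp)).clm_apply contDiff_const

theorem IsTest.partialDeriv {φ : R3 → ℂ} (hφ : IsTest φ) (j : Fin 3) :
    IsTest (partialDeriv j φ) :=
  ⟨contDiff_partialDeriv hφ.1 j, hφ.2.fderiv_apply ℝ _⟩

theorem partialDeriv_mul {f g : R3 → ℂ} (hf : Differentiable ℝ f) (hg : Differentiable ℝ g)
    (j : Fin 3) (x : R3) :
    partialDeriv j (f * g) x = partialDeriv j f x * g x + f x * partialDeriv j g x := by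
  simp only [partialDeriv, fderiv_mul (hf x) (hg x)]
  simp
  ring

/-- Differentiation of test functions. -/
def testDeriv (j : Fin 3) : TestFun →ₗ[ℂ] TestFun where
  toFun φ := ⟨partialDeriv j φ, φ.isTest.partialDeriv j⟩
  map_add' φ ψ := by
    ext x
    simp [partialDeriv, fderiv_add (φ.differentiable x) (ψ.differentiable x)]
  map_smul' c φ := by
    ext x
    simp [partialDeriv, fderiv_const_smul (φ.differentiable x) c]

/-- Multiplication of test functions by a smooth function. -/
def testMul (f : R3 → ℂ) (hf : ContDiff ℝ ∞ f) : TestFun →ₗ[ℂ] TestFun where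
  toFun φ := ⟨f * φ, hf.mul φ.contDiff, φ.hasCompactSupport.mul_left⟩
  map_add' φ ψ := by ext x; simp [mul_add]
  map_smul' c φ := by ext x; simp; ring

@[simp] theorem coe_testDeriv (j : Fin 3) (φ : TestFun) :
    (testDeriv j φ : R3 → ℂ) = partialDeriv j φ := rfl

@[simp] theorem coe_testMul (f : R3 → ℂ) (hf : ContDiff ℝ ∞ f) (φ : TestFun) :
    (testMul f hf φ : R3 → ℂ) = f * φ := rfl

theorem laplacian_eq_sum_partialDeriv {f : R3 → ℂ} (hf : ContDiff ℝ ∞ f) (x : R3) :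
    (Δ f) x = ∑ j, partialDeriv j (partialDeriv j f) x := by
  rw [InnerProductSpace.laplacian_eq_iteratedFDeriv_orthonormalBasis f
    (EuclideanSpace.basisFun (Fin 3) ℝ)]
  refine Finset.sum_congr rfl fun j _ => ?_
  rw [iteratedFDeriv_two_apply]
  unfold partialDeriv
  have h : DifferentiableAt ℝ (fderiv ℝ f) x :=
    ((hf.fderiv_right (m := ∞) (by simp)).differentiable (by simp)) x
  rw [fderiv_clm_apply h (differentiableAt_const _)]
  simp

/-- The Laplacian on test functions. -/
def testLap : TestFun →ₗ[ℂ] TestFun := ∑ j, testDeriv j ∘ₗ testDeriv j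

theorem coe_testLap (φ : TestFun) : (testLap φ : R3 → ℂ) = Δ (φ : R3 → ℂ) := by
  ext x
  rw [laplacian_eq_sum_partialDeriv φ.contDiff]
  simp [testLap]

/-- The class of a test function in `L²`. -/
def testToL2 : TestFun →ₗ[ℂ] L2 where
  toFun φ := (φ.memLp 2).toLp _
  map_add' _ _ := MemLp.toLp_add _ _
  map_smul' _ _ := MemLp.toLp_const_smul _ _

theorem testToL2_ae (φ : TestFun) : (testToL2 φ : R3 → ℂ) =ᵐ[volume] φ :=
  MemLp.coeFn_toLp (φ.memLp 2)

theorem TestFun.integrable_mul (φ ψ : TestFun) : Integrable (fun x => φ.1 x * ψ.1 x) :=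
  (φ.continuous.mul ψ.continuous).integrable_of_hasCompactSupport φ.hasCompactSupport.mul_right

/-- Complex conjugation of test functions. -/
def testConj (φ : TestFun) : TestFun :=
  ⟨fun x => starRingEnd ℂ (φ.1 x), by
    have h : (fun x => starRingEnd ℂ (φ.1 x)) = Complex.conjCLE ∘ φ.1 := rfl
    refine ⟨?_, ?_⟩
    · rw [h]; exact Complex.conjCLE.contDiff.comp φ.contDiff
    · exact φ.hasCompactSupport.comp_left (by simp)⟩

@[simp] theorem testConj_apply (φ : TestFun) (x : R3) :
    (testConj φ).1 x = starRingEnd ℂ (φ.1 x) := rfl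

theorem partialDeriv_conj (φ : TestFun) (j : Fin 3) (x : R3) :
    partialDeriv j (testConj φ) x = starRingEnd ℂ (partialDeriv j φ x) := by
  have h : (testConj φ : R3 → ℂ) = Complex.conjCLE ∘ φ.1 := rfl
  have h2 : HasFDerivAt (Complex.conjCLE ∘ φ.1)
      ((Complex.conjCLE : ℂ →L[ℝ] ℂ).comp (fderiv ℝ φ.1 x)) x :=
    (Complex.conjCLE : ℂ →L[ℝ] ℂ).hasFDerivAt.comp x (φ.differentiable x).hasFDerivAt
  rw [partialDeriv, h, h2.fderiv]
  rfl

theorem inner_testToL2 (φ ψ : TestFun) :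
    inner ℂ (testToL2 φ) (testToL2 ψ) = ∫ x, starRingEnd ℂ (φ.1 x) * ψ.1 x := by
  rw [L2.inner_def]
  refine integral_congr_ae ?_
  filter_upwards [testToL2_ae φ, testToL2_ae ψ] with x h1 h2
  rw [h1, h2, RCLike.inner_apply, mul_comm]

theorem inner_testDeriv_right (φ ψ : TestFun) (j : Fin 3) :
    inner ℂ (testToL2 φ) (testToL2 (testDeriv j ψ))
      = - inner ℂ (testToL2 (testDeriv j φ)) (testToL2 ψ) := by
  rw [inner_testToL2, inner_testToL2]
  have h := integral_mul_fderiv_eq_neg_fderiv_mul_of_integrable (μ := (volume : Measure R3))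
    (f := (testConj φ).1) (g := ψ.1) (v := EuclideanSpace.single j 1)
    ((testDeriv j (testConj φ)).integrable_mul ψ) ((testConj φ).integrable_mul (testDeriv j ψ))
    ((testConj φ).integrable_mul ψ) (fun x _ => (testConj φ).differentiable x)
    (fun x _ => ψ.differentiable x)
  refine h.trans ?_
  congr 1
  refine integral_congr_ae (ae_of_all _ fun x => ?_)
  have := partialDeriv_conj φ j x
  simp only [partialDeriv] at this
  simp [this, partialDeriv]

theorem inner_testLap (φ ψ : TestFun) :
    inner ℂ (testToL2 φ) (testToL2 (testLap ψ))
      = - ∑ j, inner ℂ (testToL2 (testDeriv j φ)) (testToL2 (testDeriv j ψ)) := by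
  simp only [testLap, LinearMap.sum_apply, map_sum, inner_sum, LinearMap.comp_apply,
    inner_testDeriv_right φ, Finset.sum_neg_distrib]

theorem inner_testLap_left (φ ψ : TestFun) :
    inner ℂ (testToL2 (testLap φ)) (testToL2 ψ) = inner ℂ (testToL2 φ) (testToL2 (testLap ψ)) := by
  rw [← inner_conj_symm, inner_testLap, inner_testLap]
  simp [inner_conj_symm]

theorem norm_sq_testToL2 (φ : TestFun) : ‖testToL2 φ‖ ^ 2 = ∫ x, ‖φ.1 x‖ ^ 2 := by
  have h := inner_testToL2 φ φ
  rw [inner_self_eq_norm_sq_to_K] at h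
  have h2 : ∀ x, starRingEnd ℂ (φ.1 x) * φ.1 x = ((‖φ.1 x‖ ^ 2 : ℝ) : ℂ) := fun x => by
    rw [mul_comm, Complex.mul_conj']; simp
  simp only [h2] at h
  rw [integral_complex_ofReal] at h
  exact Complex.ofReal_injective (by simpa using h)

theorem testLap_testMul (f : R3 → ℂ) (hf : ContDiff ℝ ∞ f) (φ : TestFun) (x : R3) :
    (testLap (testMul f hf φ)).1 x = f x * (testLap φ).1 x
      + 2 * ∑ j, partialDeriv j f x * partialDeriv j φ x
      + (∑ j, partialDeriv j (partialDeriv j f) x) * φ.1 x := by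
  have hfd : Differentiable ℝ f := hf.differentiable (by simp)
  have h1 : ∀ j, partialDeriv j (f * φ.1) = partialDeriv j f * φ.1 + f * partialDeriv j φ.1 := by
    intro j; ext y; exact partialDeriv_mul hfd φ.differentiable j y
  have h2 : ∀ j, partialDeriv j (partialDeriv j f * φ.1 + f * partialDeriv j φ.1) x
      = partialDeriv j (partialDeriv j f) x * φ.1 x + 2 * (partialDeriv j f x * partialDeriv j φ.1 x)
        + f x * partialDeriv j (partialDeriv j φ.1) x := by
    intro j
    have d1 : Differentiable ℝ (partialDeriv j f) :=
      (contDiff_partialDeriv hf j).differentiable (by simp)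
    have d2 : Differentiable ℝ (partialDeriv j φ.1) := (testDeriv j φ).differentiable
    have : partialDeriv j (partialDeriv j f * φ.1 + f * partialDeriv j φ.1) x
        = partialDeriv j (partialDeriv j f * φ.1) x + partialDeriv j (f * partialDeriv j φ.1) x := by
      simp only [partialDeriv]
      rw [fderiv_add ((d1.mul φ.differentiable) x) ((hfd.mul d2) x)]
      rfl
    rw [this, partialDeriv_mul d1 φ.differentiable, partialDeriv_mul hfd d2]
    ring
  simp only [testLap, LinearMap.sum_apply, LinearMap.comp_apply, Submodule.coe_sum, coe_testDeriv,
    coe_testMul, Finset.sum_apply, h1, h2, Finset.sum_add_distrib, Finset.mul_sum, Finset.sum_mul]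
  ring

/-! ### Form bounds for the potential -/

/-- `∫ |u|²`. -/
def massSq (u : R3 → ℂ) : ENNReal := ∫⁻ x, ‖u x‖ₑ ^ 2

/-- The density `|∇u|²`. -/
def gradSq (u : R3 → ℂ) (x : R3) : ENNReal := ∑ j, ‖partialDeriv j u x‖ₑ ^ 2

theorem measurable_gradSq (u : TestFun) : Measurable (gradSq u) := by
  unfold gradSq
  exact Finset.measurable_sum _ fun j _ =>
    ((testDeriv j u).continuous.measurable.enorm).pow_const 2

theorem enorm_fderiv_sq_le (u : R3 → ℂ) (x : R3) : ‖fderiv ℝ u x‖ₑ ^ 2 ≤ gradSq u x := by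
  set S : ℝ := ∑ j, ‖partialDeriv j u x‖ ^ 2 with hS
  have hS0 : 0 ≤ S := Finset.sum_nonneg fun _ _ => by positivity
  have h1 : ‖fderiv ℝ u x‖ ≤ Real.sqrt S := by
    refine ContinuousLinearMap.opNorm_le_bound _ (Real.sqrt_nonneg _) fun v => ?_
    have hv : v = ∑ j, v j • EuclideanSpace.single j (1 : ℝ) := by
      ext i
      simp [Finset.sum_apply, Pi.single_apply]
    have h2 : fderiv ℝ u x v = ∑ j, v j • partialDeriv j u x := by
      conv_lhs => rw [hv]
      simp [partialDeriv]
    rw [h2]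
    calc ‖∑ j, v j • partialDeriv j u x‖ ≤ ∑ j, ‖partialDeriv j u x‖ * ‖v j‖ := by
          refine (norm_sum_le _ _).trans (Finset.sum_le_sum fun j _ => ?_)
          rw [norm_smul, mul_comm]
      _ ≤ Real.sqrt S * Real.sqrt (∑ j, ‖v j‖ ^ 2) := Real.sum_mul_le_sqrt_mul_sqrt _ _ _
      _ = Real.sqrt S * ‖v‖ := by rw [EuclideanSpace.norm_eq]
  have h2 : ‖fderiv ℝ u x‖ ^ 2 ≤ S := by
    have := pow_le_pow_left₀ (norm_nonneg _) h1 2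
    rwa [Real.sq_sqrt hS0] at this
  have h3 : gradSq u x = ENNReal.ofReal S := by
    rw [hS, ENNReal.ofReal_sum_of_nonneg fun _ _ => by positivity]
    refine Finset.sum_congr rfl fun j _ => ?_
    rw [ENNReal.ofReal_pow (norm_nonneg _), ofReal_norm]
  rw [h3, ← ofReal_norm, ← ENNReal.ofReal_pow (norm_nonneg _)]
  exact ENNReal.ofReal_le_ofReal h2

theorem massSq_lt_top (u : TestFun) : massSq u < ⊤ := by
  have h := (u.memLp 2).2
  rw [eLpNorm_lt_top_iff_lintegral_rpow_enorm_lt_top (by simp) (by simp)] at h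
  simpa [massSq] using h

theorem lintegral_gradSq (u : TestFun) : ∫⁻ x, gradSq u x = ∑ j, massSq (testDeriv j u) := by
  unfold gradSq massSq
  rw [lintegral_finsetSum]
  · rfl
  · exact fun j _ => ((testDeriv j u).continuous.measurable.enorm).pow_const 2

theorem lintegral_gradSq_lt_top (u : TestFun) : ∫⁻ x, gradSq u x < ⊤ := by
  rw [lintegral_gradSq]
  exact ENNReal.sum_lt_top.2 fun j _ => massSq_lt_top _

/-- A substitute for Young's inequality: one of the two squares alone dominates, according to
whether a ≤ δ²b or not. -/
theorem mul_cube_le_sq {a b δ : ℝ} (ha : 0 ≤ a) (hb : 0 ≤ b) (hδ : 0 < δ) :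
    a * b ^ 3 ≤ (δ * b ^ 2 + (1 / δ ^ 3) * a ^ 2) ^ 2 := by
  rcases le_total a (δ ^ 2 * b) with h | h
  · have h1 : a * b ^ 3 ≤ (δ * b ^ 2) ^ 2 := by
      have := mul_le_mul_of_nonneg_right h (pow_nonneg hb 3)
      nlinarith
    refine h1.trans (pow_le_pow_left₀ (by positivity) ?_ 2)
    have : 0 ≤ 1 / δ ^ 3 * a ^ 2 := by positivity
    linarith
  · have hb' : b ≤ a / δ ^ 2 := by rw [le_div_iff₀ (by positivity)]; linarith
    have h1 : a * b ^ 3 ≤ ((1 / δ ^ 3) * a ^ 2) ^ 2 := by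
      have := mul_le_mul_of_nonneg_left (pow_le_pow_left₀ hb hb' 3) ha
      refine this.trans (le_of_eq ?_)
      field_simp
    refine h1.trans (pow_le_pow_left₀ (by positivity) ?_ 2)
    have : 0 ≤ δ * b ^ 2 := by positivity
    linarith

theorem exists_sobolev_six : ∃ C : ℝ≥0, ∀ u : TestFun,
    ∫⁻ x, ‖u.1 x‖ₑ ^ 6 ≤ C * (∫⁻ x, gradSq u x) ^ 3 := by
  refine ⟨SNormLESNormFDerivOfEqConst ℂ (volume : Measure R3) 2 ^ 6, fun u => ?_⟩
  have h := eLpNorm_le_eLpNorm_fderiv_of_eq (volume : Measure R3) (u := u.1) (p := 2) (p' := 6)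
    (u.contDiff.of_le (by simp)) u.hasCompactSupport (by norm_num) (by simp)
    (by simp; norm_num)
  have h6 := pow_le_pow_left₀ zero_le h 6
  rw [mul_pow] at h6
  have e6 : eLpNorm u.1 ((6 : ℝ≥0) : ENNReal) volume ^ 6 = ∫⁻ x, ‖u.1 x‖ₑ ^ 6 := by
    rw [eLpNorm_eq_lintegral_rpow_enorm_toReal (by simp) (by simp), ← ENNReal.rpow_natCast,
      ← ENNReal.rpow_mul]
    norm_num
  have e2 : eLpNorm (fderiv ℝ u.1) ((2 : ℝ≥0) : ENNReal) volume ^ 6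
      ≤ (∫⁻ x, gradSq u x) ^ 3 := by
    rw [eLpNorm_eq_lintegral_rpow_enorm_toReal (by simp) (by simp), ← ENNReal.rpow_natCast,
      ← ENNReal.rpow_mul]
    norm_num
    gcongr
    exact enorm_fderiv_sq_le _ _
  rw [← e6, ENNReal.coe_pow]
  exact h6.trans (mul_le_mul_right e2 _)

theorem lintegral_mul_sq_le {f g : R3 → ENNReal} (hf : AEMeasurable f) (hg : AEMeasurable g) :
    (∫⁻ x, f x * g x) ^ 2 ≤ (∫⁻ x, f x ^ 2) * ∫⁻ x, g x ^ 2 := by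
  have h := ENNReal.lintegral_mul_le_Lp_mul_Lq volume Real.HolderConjugate.two_two hf hg
  have h2 := pow_le_pow_left₀ zero_le h 2
  rw [mul_pow, ← ENNReal.rpow_natCast (_ ^ (1 / (2 : ℝ))), ← ENNReal.rpow_natCast (_ ^ (1 / (2 : ℝ))),
    ← ENNReal.rpow_mul, ← ENNReal.rpow_mul] at h2
  simpa using h2

/-- Cauchy–Schwarz gives ∫|u|⁴ ≤ (∫|u|²)^(1/2) (∫|u|⁶)^(1/2), and the Sobolev inequality bounds the
last factor by the cube of the gradient norm. `mul_cube_le_sq` then trades a small share of the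
gradient for a large share of the mass. -/
theorem exists_interpolation (δ : ℝ≥0) (hδ : 0 < δ) : ∃ C : ℝ≥0, ∀ u : TestFun,
    ∫⁻ x, ‖u.1 x‖ₑ ^ 4 ≤ (δ * (∫⁻ x, gradSq u x) + C * massSq u) ^ 2 := by
  obtain ⟨C, hC⟩ := exists_sobolev_six
  -- `mul_cube_le_sq` will be used with b² = (C + 1)G, so this choice turns t·b² into δG. Using C +
  -- 1 instead of C avoids division by zero and satisfies C ≤ (C + 1)³.
  set t : ℝ := δ / (C + 1) with ht
  have ht0 : 0 < t := by positivity
  refine ⟨Real.toNNReal (1 / t ^ 3 * 1) , fun u => ?_⟩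
  have hm : AEMeasurable (fun x => ‖u.1 x‖ₑ) := u.continuous.measurable.enorm.aemeasurable
  have h1 := lintegral_mul_sq_le hm (hm.pow_const 3)
  have e1 : ∀ x, ‖u.1 x‖ₑ * ‖u.1 x‖ₑ ^ 3 = ‖u.1 x‖ₑ ^ 4 := fun x => by ring
  have e2 : ∀ x, (‖u.1 x‖ₑ ^ 3) ^ 2 = ‖u.1 x‖ₑ ^ 6 := fun x => by ring
  simp only [e1, e2] at h1
  generalize (∫⁻ x, ‖u.1 x‖ₑ ^ 4) = A at *
  have h2 : A ^ 2 ≤ massSq u * (C * (∫⁻ x, gradSq u x) ^ 3) :=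
    h1.trans (mul_le_mul_right (hC u) _)
  have hG := (lintegral_gradSq_lt_top u).ne
  have hN := (massSq_lt_top u).ne
  generalize (∫⁻ x, gradSq u x) = G at *
  generalize massSq u = N at *
  lift G to ℝ≥0 using hG
  lift N to ℝ≥0 using hN
  have hA : A ≠ ⊤ := by
    intro h
    rw [h] at h2
    have : ((N : ENNReal) * (C * (G : ENNReal) ^ 3)) < ⊤ := by finiteness
    simp at h2
    exact this.ne h2
  lift A to ℝ≥0 using hA
  norm_cast at h2 ⊢
  have h3 : (A : ℝ) ^ 2 ≤ N * (C * G ^ 3) := by exact_mod_cast h2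
  have ha : (0:ℝ) ≤ N := N.2
  have hb : (0:ℝ) ≤ G := G.2
  have hc : (0:ℝ) ≤ C := C.2
  have key : (A : ℝ) ≤ (δ * G + (1 / t ^ 3 * 1) * N) ^ 2 := by
    have h4 := mul_cube_le_sq (Real.sqrt_nonneg (N : ℝ)) (Real.sqrt_nonneg ((C + 1) * G : ℝ)) ht0
    rw [Real.sq_sqrt ha, Real.sq_sqrt (by positivity)] at h4
    have h5 : (A : ℝ) ≤ Real.sqrt N * Real.sqrt ((C + 1) * G) ^ 3 := by
      refine abs_le_of_sq_le_sq' ?_ (by positivity) |>.2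
      rw [mul_pow, ← pow_mul, mul_comm 3 2, pow_mul, Real.sq_sqrt ha, Real.sq_sqrt (by positivity)]
      refine h3.trans ?_
      have : (C : ℝ) ≤ (C + 1) ^ 3 := by nlinarith [sq_nonneg (C : ℝ), pow_nonneg hc 3]
      rw [mul_pow]
      gcongr
    refine h5.trans (h4.trans (le_of_eq ?_))
    rw [ht]
    field_simp
  rw [← NNReal.coe_le_coe]
  push_cast
  rw [Real.coe_toNNReal _ (by positivity)]
  exact key

/-- Tonelli: each x lies in exactly the balls whose centres form a ball around x. Averaging over all
centres replaces a countable cover with overlap counting. -/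
theorem lintegral_lintegral_closedBall {F : R3 → ENNReal} (hF : AEMeasurable F) (r : ℝ) :
    ∫⁻ y, ∫⁻ x in Metric.closedBall y r, F x
      = volume (Metric.closedBall (0 : R3) r) * ∫⁻ x, F x := by
  have h1 : ∀ y, ∫⁻ x in Metric.closedBall y r, F x
      = ∫⁻ x, (Metric.closedBall (0 : R3) r).indicator 1 (x - y) * F x := by
    intro y
    rw [← lintegral_indicator Metric.isClosed_closedBall.measurableSet]
    refine lintegral_congr fun x => ?_
    by_cases hx : x ∈ Metric.closedBall y r
    · have : x - y ∈ Metric.closedBall (0 : R3) r := by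
        simpa [dist_eq_norm] using hx
      simp [indicator_of_mem hx, indicator_of_mem this]
    · have : x - y ∉ Metric.closedBall (0 : R3) r := by
        simpa [dist_eq_norm] using hx
      simp [indicator_of_notMem hx, indicator_of_notMem this]
  simp only [h1]
  have hm : Measurable (fun z : R3 => (Metric.closedBall (0 : R3) r).indicator
      (1 : R3 → ENNReal) z) :=
    measurable_one.indicator Metric.isClosed_closedBall.measurableSet
  rw [lintegral_lintegral_swap]
  · have h2 : ∀ x : R3, ∫⁻ y, (Metric.closedBall (0 : R3) r).indicator 1 (x - y) * F x
        = volume (Metric.closedBall (0 : R3) r) * F x := by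
      intro x
      have hm' : Measurable fun y : R3 =>
          (Metric.closedBall (0 : R3) r).indicator (1 : R3 → ENNReal) (x - y) :=
        hm.comp (measurable_const.sub measurable_id)
      rw [lintegral_mul_const _ hm']
      congr 1
      rw [lintegral_sub_left_eq_self (fun z => (Metric.closedBall (0 : R3) r).indicator
        (1 : R3 → ENNReal) z) x, lintegral_indicator_one Metric.isClosed_closedBall.measurableSet]
    simp only [h2]
    rw [lintegral_const_mul' _ _ measure_closedBall_lt_top.ne]
  · exact ((hm.comp (measurable_snd.sub measurable_fst)).aemeasurable).mul hF.comp_snd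

/-- A smooth cutoff equal to `1` on the unit ball and supported in the ball of radius `2`. -/
def bump : ContDiffBump (0 : R3) := ⟨1, 2, one_pos, one_lt_two⟩

/-- The cutoff around `y`. -/
def cutoff (y x : R3) : ℂ := (bump (x - y) : ℝ)

theorem contDiff_cutoff (y : R3) : ContDiff ℝ ∞ (cutoff y) :=
  Complex.ofRealCLM.contDiff.comp (bump.contDiff.comp (contDiff_id.sub contDiff_const))

theorem cutoff_eq_one {y x : R3} (h : x ∈ Metric.closedBall y 1) : cutoff y x = 1 := by
  have : bump (x - y) = 1 := bump.one_of_mem_closedBall (by simpa [bump, dist_eq_norm] using h)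
  simp [cutoff, this]

theorem cutoff_eq_zero {y x : R3} (h : x ∉ Metric.closedBall y 2) : cutoff y x = 0 := by
  have : bump (x - y) = 0 := bump.zero_of_le_dist (by
    simp only [Metric.mem_closedBall, not_le, dist_eq_norm] at h
    simpa [bump] using h.le)
  simp [cutoff, this]

theorem enorm_cutoff_le (y x : R3) : ‖cutoff y x‖ₑ ≤ 1 := by
  have h : ‖cutoff y x‖ ≤ 1 := by
    rw [cutoff, Complex.norm_real, Real.norm_eq_abs, abs_of_nonneg bump.nonneg]
    exact bump.le_one
  rw [← ofReal_norm]
  exact ENNReal.ofReal_le_one.2 h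

theorem partialDeriv_cutoff (y x : R3) (j : Fin 3) :
    partialDeriv j (cutoff y) x = partialDeriv j (cutoff 0) (x - y) := by
  have : cutoff y = fun x => cutoff 0 (x - y) := by ext x; simp [cutoff]
  rw [this]
  simp only [partialDeriv]
  rw [fderiv_comp_sub (f := cutoff 0)]

theorem exists_partialDeriv_cutoff_le : ∃ C : ℝ≥0, ∀ (j : Fin 3) (y x : R3),
    ‖partialDeriv j (cutoff y) x‖ₑ ≤ C := by
  have hc : HasCompactSupport (cutoff 0) := by
    refine HasCompactSupport.intro (isCompact_closedBall (0 : R3) 2) fun x hx => cutoff_eq_zero hx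
  have h1 : ∀ j, ∃ C : ℝ, ∀ x, ‖partialDeriv j (cutoff 0) x‖ ≤ C := fun j =>
    (contDiff_partialDeriv (contDiff_cutoff 0) j).continuous.bounded_above_of_compact_support
      (hc.fderiv_apply ℝ _)
  choose C hC using h1
  refine ⟨∑ j, Real.toNNReal (C j), fun j y x => ?_⟩
  rw [partialDeriv_cutoff, ← ofReal_norm]
  refine (ENNReal.ofReal_le_ofReal (hC j _)).trans ?_
  rw [ENNReal.ofReal, ENNReal.coe_le_coe]
  exact Finset.single_le_sum (f := fun j => Real.toNNReal (C j)) (fun _ _ => zero_le) (Finset.mem_univ j)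

theorem partialDeriv_cutoff_eq_zero {y x : R3} (h : x ∉ Metric.closedBall y 2) (j : Fin 3) :
    partialDeriv j (cutoff y) x = 0 := by
  have : cutoff y =ᶠ[𝓝 x] fun _ => 0 := by
    filter_upwards [Metric.isClosed_closedBall.isOpen_compl.mem_nhds h] with z hz
    exact cutoff_eq_zero hz
  simp [partialDeriv, this.fderiv_eq]

theorem enorm_add_sq_le (a b : ℂ) : ‖a + b‖ₑ ^ 2 ≤ 2 * ‖a‖ₑ ^ 2 + 2 * ‖b‖ₑ ^ 2 := by
  have h : ‖a + b‖ ^ 2 ≤ 2 * ‖a‖ ^ 2 + 2 * ‖b‖ ^ 2 := by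
    have := norm_add_le a b
    nlinarith [sq_nonneg (‖a‖ - ‖b‖), norm_nonneg (a + b), norm_nonneg a, norm_nonneg b]
  have := ENNReal.ofReal_le_ofReal h
  rw [ENNReal.ofReal_add (by positivity) (by positivity), ENNReal.ofReal_mul (by norm_num),
    ENNReal.ofReal_mul (by norm_num)] at this
  simpa [ENNReal.ofReal_pow] using this

/-- The constant does not depend on the centre, since all cutoffs are translates of one bump; this
makes the local form bounds uniform. -/
theorem exists_gradSq_cutoff_le : ∃ C : ℝ≥0, ∀ (y : R3) (u : TestFun) (x : R3),
    gradSq (cutoff y * u.1) x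
      ≤ (Metric.closedBall y 2).indicator (fun x => 2 * gradSq u x + C * ‖u.1 x‖ₑ ^ 2) x := by
  obtain ⟨C, hC⟩ := exists_partialDeriv_cutoff_le
  refine ⟨6 * C ^ 2, fun y u x => ?_⟩
  have hd : ∀ j, partialDeriv j (cutoff y * u.1) x
      = cutoff y x * partialDeriv j u.1 x + partialDeriv j (cutoff y) x * u.1 x := fun j => by
    rw [partialDeriv_mul ((contDiff_cutoff y).differentiable (by simp)) u.differentiable, add_comm]
  by_cases hx : x ∈ Metric.closedBall y 2
  · rw [indicator_of_mem hx]
    simp only [gradSq, hd]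
    have : ∀ j, ‖cutoff y x * partialDeriv j u.1 x + partialDeriv j (cutoff y) x * u.1 x‖ₑ ^ 2
        ≤ 2 * ‖partialDeriv j u.1 x‖ₑ ^ 2 + 2 * (C ^ 2 * ‖u.1 x‖ₑ ^ 2) := fun j => by
      refine (enorm_add_sq_le _ _).trans ?_
      rw [enorm_mul, enorm_mul, mul_pow, mul_pow]
      gcongr
      · calc ‖cutoff y x‖ₑ ^ 2 * ‖partialDeriv j u.1 x‖ₑ ^ 2
            ≤ 1 ^ 2 * ‖partialDeriv j u.1 x‖ₑ ^ 2 := by gcongr; exact enorm_cutoff_le y x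
          _ = _ := by simp
      · exact hC j y x
    refine (Finset.sum_le_sum fun j _ => this j).trans (le_of_eq ?_)
    rw [Finset.sum_add_distrib, ← Finset.mul_sum]
    simp only [Finset.sum_const, Finset.card_univ, Fintype.card_fin, nsmul_eq_mul]
    push_cast
    ring
  · rw [indicator_of_notMem hx]
    simp [gradSq, hd, cutoff_eq_zero hx, partialDeriv_cutoff_eq_zero hx]

theorem massSq_cutoff_le (y : R3) (u : TestFun) :
    massSq (cutoff y * u.1) ≤ ∫⁻ x in Metric.closedBall y 2, ‖u.1 x‖ₑ ^ 2 := by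
  rw [← lintegral_indicator Metric.isClosed_closedBall.measurableSet]
  refine lintegral_mono fun x => ?_
  by_cases hx : x ∈ Metric.closedBall y 2
  · rw [indicator_of_mem hx]
    simp only [Pi.mul_apply, enorm_mul, mul_pow]
    calc _ ≤ 1 ^ 2 * ‖u.1 x‖ₑ ^ 2 := by gcongr; exact enorm_cutoff_le y x
      _ = _ := by simp
  · simp [cutoff_eq_zero hx]

theorem localMass_eq (V : R3 → ℝ) (y : R3) :
    localMass V y = ∫⁻ x in Metric.closedBall y 1, ‖V x‖ₑ ^ 2 := by
  unfold localMass
  refine lintegral_congr fun x => ?_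
  rw [ENNReal.ofReal_pow (abs_nonneg _), ← Real.norm_eq_abs, ofReal_norm]

/-- Local form bound on the unit ball around `y`. -/
theorem exists_local_form_bound (δ : ℝ≥0) (hδ : 0 < δ) : ∃ C : ℝ≥0, ∀ (V : R3 → ℝ)
    (_ : AEStronglyMeasurable V volume) (y : R3) (u : TestFun) (m : ℝ≥0) (_ : localMass V y ≤ m ^ 2),
    ∫⁻ x in Metric.closedBall y 1, ‖V x‖ₑ * ‖u.1 x‖ₑ ^ 2
      ≤ m * ∫⁻ x in Metric.closedBall y 2, (δ * gradSq u x + C * ‖u.1 x‖ₑ ^ 2) := by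
  -- Half of δ, because the cutoff costs a factor 2 in front of the gradient. The estimate is
  -- Cauchy–Schwarz between |V| on the ball and |w|², with the fourth power of the localized
  -- function w interpolated.
  obtain ⟨C₁, hC₁⟩ := exists_interpolation (δ / 2) (by positivity)
  obtain ⟨C₂, hC₂⟩ := exists_gradSq_cutoff_le
  refine ⟨δ / 2 * C₂ + C₁, fun V hV y u m hm => ?_⟩
  set w : TestFun := testMul (cutoff y) (contDiff_cutoff y) u with hw
  have hwm : Measurable (fun x => ‖w.1 x‖ₑ) := w.continuous.measurable.enorm
  set B := Metric.closedBall y 1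
  have hB : MeasurableSet B := Metric.isClosed_closedBall.measurableSet
  have hB2 : MeasurableSet (Metric.closedBall y 2) := Metric.isClosed_closedBall.measurableSet
  have hVm : AEMeasurable (fun x => ‖V x‖ₑ) volume := hV.enorm
  have h1 : ∫⁻ x in B, ‖V x‖ₑ * ‖u.1 x‖ₑ ^ 2 = ∫⁻ x, B.indicator (fun x => ‖V x‖ₑ) x * ‖w.1 x‖ₑ ^ 2 := by
    rw [← lintegral_indicator hB]
    refine lintegral_congr fun x => ?_
    by_cases hx : x ∈ B
    · simp [hx, hw, cutoff_eq_one hx]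
    · simp [hx]
  have h2 := lintegral_mul_sq_le (hVm.indicator hB) (hwm.aemeasurable.pow_const 2)
  have h3 : ∫⁻ x, (B.indicator (fun x => ‖V x‖ₑ) x) ^ 2 = localMass V y := by
    rw [localMass_eq, ← lintegral_indicator hB]
    refine lintegral_congr fun x => ?_
    by_cases hx : x ∈ B
    · simp [hx]
    · simp [hx]
  have h4 : ∫⁻ x, (‖w.1 x‖ₑ ^ 2) ^ 2 = ∫⁻ x, ‖w.1 x‖ₑ ^ 4 := by
    refine lintegral_congr fun x => by ring
  have h5 : ((δ / 2 : ℝ≥0) : ENNReal) * (∫⁻ x, gradSq w x) + C₁ * massSq w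
      ≤ ∫⁻ x in Metric.closedBall y 2, (δ * gradSq u x + (δ / 2 * C₂ + C₁ : ℝ≥0) * ‖u.1 x‖ₑ ^ 2) := by
    have hg : Measurable (fun x => gradSq u x) := measurable_gradSq u
    have hu : Measurable (fun x => ‖u.1 x‖ₑ ^ 2) := u.continuous.measurable.enorm.pow_const 2
    have a1 : ∫⁻ x, gradSq w x
        ≤ ∫⁻ x in Metric.closedBall y 2, (2 * gradSq u x + C₂ * ‖u.1 x‖ₑ ^ 2) := by
      rw [← lintegral_indicator hB2]
      exact lintegral_mono fun x => hC₂ y u x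
    have a2 : massSq w ≤ _ := massSq_cutoff_le y u
    calc _ ≤ ((δ / 2 : ℝ≥0) : ENNReal) *
          (∫⁻ x in Metric.closedBall y 2, (2 * gradSq u x + C₂ * ‖u.1 x‖ₑ ^ 2))
          + C₁ * ∫⁻ x in Metric.closedBall y 2, ‖u.1 x‖ₑ ^ 2 := by
          gcongr
      _ = _ := by
          rw [← lintegral_const_mul _ (by fun_prop), ← lintegral_const_mul _ hu,
            ← lintegral_add_left (by fun_prop)]
          refine lintegral_congr fun x => ?_
          have : (δ : ENNReal) = ((δ / 2 : ℝ≥0) : ENNReal) * 2 := by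
            rw [← ENNReal.coe_ofNat, ← ENNReal.coe_mul]
            congr 1
            field_simp
          rw [this]
          push_cast
          ring
  rw [h1]
  rw [h3, h4] at h2
  refine le_trans ?_ (mul_le_mul_right h5 _)
  have h6 := h2.trans (mul_le_mul' hm (hC₁ w))
  rw [← mul_pow] at h6
  exact (ENNReal.pow_le_pow_left_iff two_ne_zero).1 h6

theorem continuous_perpNorm : Continuous perpNorm := by
  unfold perpNorm
  fun_prop

theorem perpNorm_sub_le (x y : R3) : perpNorm x ≤ perpNorm y + ‖x - y‖ := by
  have key : ∀ z : R3, perpNorm z = ‖(!₂[z 1, z 2] : EuclideanSpace ℝ (Fin 2))‖ := fun z => by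
    rw [EuclideanSpace.norm_eq]
    simp [perpNorm, Fin.sum_univ_two]
  have h1 : (!₂[x 1, x 2] : EuclideanSpace ℝ (Fin 2))
      = !₂[y 1, y 2] + !₂[(x - y) 1, (x - y) 2] := by
    ext i
    fin_cases i <;> simp
  have h2 : perpNorm (x - y) ≤ ‖x - y‖ := by
    rw [EuclideanSpace.norm_eq, perpNorm]
    apply Real.sqrt_le_sqrt
    rw [Fin.sum_univ_three]
    simp only [Real.norm_eq_abs, sq_abs]
    nlinarith [sq_nonneg ((x - y) 0)]
  rw [key x, h1]
  refine (norm_add_le _ _).trans ?_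
  rw [← key y, ← key (x - y)]
  linarith

/-- The hypotheses on the potential. -/
structure IsAdmissible (V : R3 → ℝ) : Prop where
  meas : AEStronglyMeasurable V volume
  loc : uniformMass V < ⊤
  decay : Tendsto (outerMass V) atTop (𝓝 0)

theorem IsAdmissible.exists_uniform {V : R3 → ℝ} (hV : IsAdmissible V) :
    ∃ m : ℝ≥0, ∀ y, localMass V y ≤ (m : ENNReal) ^ 2 := by
  obtain ⟨M, hM⟩ : ∃ M : ℝ≥0, (M : ENNReal) = uniformMass V :=
    ⟨_, ENNReal.coe_toNNReal hV.loc.ne⟩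
  refine ⟨M + 1, fun y => (le_iSup (localMass V) y).trans ?_⟩
  change uniformMass V ≤ _
  rw [← hM]
  norm_cast
  have := M.2
  rw [← NNReal.coe_le_coe]
  push_cast
  nlinarith [NNReal.coe_nonneg M]

theorem IsAdmissible.exists_outer {V : R3 → ℝ} (hV : IsAdmissible V) (ε : ℝ≥0) (hε : 0 < ε) :
    ∃ R : ℝ, ∀ y, R ≤ perpNorm y → localMass V y ≤ (ε : ENNReal) ^ 2 := by
  have h := hV.decay.eventually_lt_const (u := (ε : ENNReal) ^ 2) (by positivity)
  obtain ⟨R, hR⟩ := h.exists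
  exact ⟨R, fun y hy => (le_iSup (fun x : {x : R3 // R ≤ perpNorm x} => localMass V x)
    ⟨y, hy⟩).trans hR.le⟩

/-- Form bound: `|V|` is form small up to a term living near the first axis. -/
theorem IsAdmissible.exists_form_bound {V : R3 → ℝ} (hV : IsAdmissible V) (ε : ℝ≥0) (hε : 0 < ε) :
    ∃ (C : ℝ≥0) (R : ℝ), ∀ u : TestFun, ∫⁻ x, ‖V x‖ₑ * ‖u.1 x‖ₑ ^ 2
      ≤ ε * ((∫⁻ x, gradSq u x) + massSq u) + C * ∫⁻ x in {x | perpNorm x ≤ R}, ‖u.1 x‖ₑ ^ 2 := by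
  obtain ⟨m, hm⟩ := hV.exists_uniform
  set b₁ : ℝ≥0 := (volume (Metric.closedBall (0 : R3) 1)).toNNReal with hb₁
  set b₂ : ℝ≥0 := (volume (Metric.closedBall (0 : R3) 2)).toNNReal with hb₂
  have eb₁ : volume (Metric.closedBall (0 : R3) 1) = b₁ :=
    (ENNReal.coe_toNNReal measure_closedBall_lt_top.ne).symm
  have eb₂ : volume (Metric.closedBall (0 : R3) 2) = b₂ :=
    (ENNReal.coe_toNNReal measure_closedBall_lt_top.ne).symm
  have hb₁0 : 0 < b₁ := by
    have := Metric.measure_closedBall_pos (volume : Measure R3) 0 one_pos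
    rw [eb₁] at this
    exact_mod_cast this
  have hb₂0 : 0 < b₂ := by
    have := Metric.measure_closedBall_pos (volume : Measure R3) 0 two_pos
    rw [eb₂] at this
    exact_mod_cast this
  -- Integrating the local bounds over all centres produces the volume of the unit ball on the left
  -- and that of the ball of radius 2 on the right; t compensates the quotient.
  set t : ℝ≥0 := ε * b₁ / b₂ with ht
  have ht0 : 0 < t := by positivity
  -- Two regimes. Far from the axis the local mass of V is itself small, so δ = 1 suffices. Near the
  -- axis only the uniform bound m is known, so δ must be small, and the large constant C₂ is
  -- confined to a tube.
  obtain ⟨C₁, hC₁⟩ := exists_local_form_bound 1 one_pos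
  obtain ⟨C₂, hC₂⟩ := exists_local_form_bound (t / (m + 1)) (by positivity)
  obtain ⟨R, hR⟩ := hV.exists_outer (t / (C₁ + 1)) (by positivity)
  -- Balls of radius 2 centred at distance less than R from the axis stay within distance R + 2.
  refine ⟨m * C₂ * b₂ / b₁, R + 2, fun u => ?_⟩
  have hgm : Measurable (fun x => gradSq u x) := measurable_gradSq u
  have hum : Measurable (fun x => ‖u.1 x‖ₑ ^ 2) := u.continuous.measurable.enorm.pow_const 2
  set S : Set R3 := {x | perpNorm x ≤ R + 2} with hS
  have hSm : MeasurableSet S := (isClosed_le continuous_perpNorm continuous_const).measurableSet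
  set Φ : R3 → ENNReal := fun x => t * (gradSq u x + ‖u.1 x‖ₑ ^ 2)
    + S.indicator (fun x => (m * C₂ : ℝ≥0) * ‖u.1 x‖ₑ ^ 2) x with hΦ
  have hΦm : Measurable Φ := by
    have := (hum.const_mul ((m * C₂ : ℝ≥0) : ENNReal)).indicator hSm
    fun_prop
  have hloc : ∀ y, ∫⁻ x in Metric.closedBall y 1, ‖V x‖ₑ * ‖u.1 x‖ₑ ^ 2
      ≤ ∫⁻ x in Metric.closedBall y 2, Φ x := by
    intro y
    by_cases hy : R ≤ perpNorm y
    · refine (hC₁ V hV.meas y u _ (hR y hy)).trans ?_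
      rw [← lintegral_const_mul _ (by fun_prop)]
      refine lintegral_mono fun x => le_trans ?_ le_self_add
      rw [mul_add, mul_add, ← mul_assoc, ← mul_assoc, ← ENNReal.coe_mul, ← ENNReal.coe_mul]
      gcongr
      · rw [mul_one]
        exact div_le_self zero_le (by simp)
      · rw [div_mul_eq_mul_div]
        exact div_le_of_le_mul₀ zero_le zero_le (by gcongr; simp)
    · refine (hC₂ V hV.meas y u m (hm y)).trans ?_
      rw [← lintegral_const_mul _ (by fun_prop)]
      refine setLIntegral_mono hΦm fun x hx => ?_
      have hxS : x ∈ S := by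
        have := perpNorm_sub_le x y
        rw [Metric.mem_closedBall, dist_eq_norm] at hx
        simp only [hS, mem_ofPred_eq]
        linarith
      simp only [hΦ, indicator_of_mem hxS]
      rw [mul_add, mul_add, ← mul_assoc, ← mul_assoc, ← ENNReal.coe_mul, ← ENNReal.coe_mul]
      gcongr
      refine le_trans ?_ le_self_add
      gcongr
      rw [mul_div_assoc']
      exact div_le_of_le_mul₀ zero_le zero_le (by rw [mul_comm]; gcongr; simp)
  have hF : AEMeasurable (fun x => ‖V x‖ₑ * ‖u.1 x‖ₑ ^ 2) volume :=
    hV.meas.enorm.mul hum.aemeasurable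
  have h1 := lintegral_mono (μ := volume) hloc
  rw [lintegral_lintegral_closedBall hF, lintegral_lintegral_closedBall hΦm.aemeasurable,
    eb₁, eb₂] at h1
  have h2 : ∫⁻ x, Φ x = t * ((∫⁻ x, gradSq u x) + massSq u)
      + (m * C₂ : ℝ≥0) * ∫⁻ x in S, ‖u.1 x‖ₑ ^ 2 := by
    rw [hΦ, lintegral_add_left (by fun_prop), lintegral_const_mul _ (by fun_prop),
      lintegral_add_left hgm, lintegral_indicator hSm, lintegral_const_mul _ hum]
    rfl
  rw [h2, mul_comm, ← ENNReal.le_div_iff_mul_le (by simp [hb₁0.ne']) (by simp)] at h1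
  refine h1.trans (le_of_eq ?_)
  rw [ENNReal.div_eq_inv_mul, ← ENNReal.coe_inv hb₁0.ne', mul_add, mul_add]
  simp only [← mul_assoc, ← ENNReal.coe_mul]
  congr 3
  · rw [ht]; field_simp
  · field_simp

/-- `Vφ ∈ L²` for test functions `φ`. -/
theorem IsAdmissible.memLp_mul {V : R3 → ℝ} (hV : IsAdmissible V) (φ : TestFun) :
    MemLp (fun x => (V x : ℂ) * φ.1 x) 2 volume := by
  have hVc : AEStronglyMeasurable (fun x => (V x : ℂ)) volume :=
    Complex.continuous_ofReal.comp_aestronglyMeasurable hV.meas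
  have hloc : LocallyIntegrable (fun x => ‖V x‖ ^ 2) volume := by
    intro x
    refine ⟨Metric.closedBall x 1, Metric.closedBall_mem_nhds x one_pos,
      (hV.meas.norm.pow 2).restrict, ?_⟩
    have h := (le_iSup (localMass V) x).trans_lt hV.loc
    rw [localMass_eq] at h
    rw [HasFiniteIntegral]
    simpa [enorm_pow] using h
  refine (memLp_two_iff_integrable_sq_norm (hVc.mul φ.continuous.aestronglyMeasurable)).2 ?_
  have := hloc.integrable_smul_right_of_hasCompactSupport (g := fun x => ‖φ.1 x‖ ^ 2)
    (by have := φ.continuous; fun_prop)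
    (φ.hasCompactSupport.comp_left (g := fun z : ℂ => ‖z‖ ^ 2) (by simp))
  refine this.congr (ae_of_all _ fun x => ?_)
  simp [mul_pow]

/-! ### The Hamiltonian on test functions -/

theorem massSq_eq (u : TestFun) : massSq u = ENNReal.ofReal (‖testToL2 u‖ ^ 2) := by
  rw [norm_sq_testToL2, ofReal_integral_eq_lintegral_ofReal
    ((memLp_two_iff_integrable_sq_norm u.continuous.aestronglyMeasurable).1 (u.memLp 2))
    (ae_of_all _ fun x => by positivity)]
  refine lintegral_congr fun x => ?_
  rw [ENNReal.ofReal_pow (norm_nonneg _), ofReal_norm]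

/-- The squared norm of the gradient of a test function. -/
def gradNormSq (u : TestFun) : ℝ := ∑ j, ‖testToL2 (testDeriv j u)‖ ^ 2

theorem gradNormSq_nonneg (u : TestFun) : 0 ≤ gradNormSq u :=
  Finset.sum_nonneg fun _ _ => by positivity

theorem lintegral_gradSq_eq (u : TestFun) : ∫⁻ x, gradSq u x = ENNReal.ofReal (gradNormSq u) := by
  rw [lintegral_gradSq, gradNormSq, ENNReal.ofReal_sum_of_nonneg fun _ _ => by positivity]
  exact Finset.sum_congr rfl fun j _ => massSq_eq _

variable {V : R3 → ℝ}

/-- Multiplication of test functions by the potential. -/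
def potMul (hV : IsAdmissible V) : TestFun →ₗ[ℂ] L2 where
  toFun φ := (hV.memLp_mul φ).toLp _
  map_add' φ ψ := by
    rw [← MemLp.toLp_add]
    congr 1
    ext x
    simp [mul_add]
  map_smul' c φ := by
    rw [RingHom.id_apply, ← MemLp.toLp_const_smul]
    congr 1
    ext x
    simp
    ring

theorem potMul_ae (hV : IsAdmissible V) (φ : TestFun) :
    (potMul hV φ : R3 → ℂ) =ᵐ[volume] fun x => (V x : ℂ) * φ.1 x :=
  MemLp.coeFn_toLp (hV.memLp_mul φ)

/-- `-Δ + V` on test functions. -/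
def testHam (hV : IsAdmissible V) : TestFun →ₗ[ℂ] L2 := potMul hV - testToL2 ∘ₗ testLap

theorem testHam_apply (hV : IsAdmissible V) (φ : TestFun) :
    testHam hV φ = potMul hV φ - testToL2 (testLap φ) := rfl

theorem testHam_ae (hV : IsAdmissible V) (φ : TestFun) :
    (testHam hV φ : R3 → ℂ) =ᵐ[volume] schrodingerExpr V φ := by
  rw [testHam_apply]
  filter_upwards [Lp.coeFn_sub (potMul hV φ) (testToL2 (testLap φ)), potMul_ae hV φ,
    testToL2_ae (testLap φ)] with x h1 h2 h3
  rw [h1, Pi.sub_apply, h2, h3, coe_testLap, schrodingerExpr]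
  ring

theorem inner_potMul (hV : IsAdmissible V) (φ ψ : TestFun) :
    inner ℂ (testToL2 φ) (potMul hV ψ) = ∫ x, (V x : ℂ) * (starRingEnd ℂ (φ.1 x) * ψ.1 x) := by
  rw [L2.inner_def]
  refine integral_congr_ae ?_
  filter_upwards [testToL2_ae φ, potMul_ae hV ψ] with x h1 h2
  rw [h1, h2, RCLike.inner_apply]
  ring

theorem inner_potMul_left (hV : IsAdmissible V) (φ ψ : TestFun) :
    inner ℂ (potMul hV φ) (testToL2 ψ) = inner ℂ (testToL2 φ) (potMul hV ψ) := by
  rw [← inner_conj_symm, inner_potMul, inner_potMul, ← integral_conj]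
  refine integral_congr_ae (ae_of_all _ fun x => ?_)
  simp
  left
  ring

theorem inner_testHam_left (hV : IsAdmissible V) (φ ψ : TestFun) :
    inner ℂ (testHam hV φ) (testToL2 ψ) = inner ℂ (testToL2 φ) (testHam hV ψ) := by
  rw [testHam_apply, testHam_apply, inner_sub_left, inner_sub_right, inner_potMul_left,
    inner_testLap_left]

/-- Multiplication of test functions by a real smooth function. -/
def testMulReal (η : R3 → ℝ) (hη : ContDiff ℝ ∞ η) : TestFun →ₗ[ℂ] TestFun :=
  testMul (fun x => (η x : ℂ)) (Complex.ofRealCLM.contDiff.comp hη)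

theorem testMulReal_apply (η : R3 → ℝ) (hη : ContDiff ℝ ∞ η) (φ : TestFun) (x : R3) :
    (testMulReal η hη φ).1 x = η x * φ.1 x := rfl

theorem inner_testMulReal_left (η : R3 → ℝ) (hη : ContDiff ℝ ∞ η) (φ ψ : TestFun) :
    inner ℂ (testToL2 (testMulReal η hη φ)) (testToL2 ψ)
      = inner ℂ (testToL2 φ) (testToL2 (testMulReal η hη ψ)) := by
  rw [inner_testToL2, inner_testToL2]
  refine integral_congr_ae (ae_of_all _ fun x => ?_)
  simp [testMulReal_apply]
  ring

theorem partialDeriv_ofReal {η : R3 → ℝ} (hη : Differentiable ℝ η) (j : Fin 3) (x : R3) :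
    partialDeriv j (fun x => (η x : ℂ)) x = ((partialDeriv j η x : ℝ) : ℂ) := by
  have h : HasFDerivAt (fun x => (η x : ℂ)) (Complex.ofRealCLM.comp (fderiv ℝ η x)) x :=
    Complex.ofRealCLM.hasFDerivAt.comp x (hη x).hasFDerivAt
  rw [partialDeriv, h.fderiv]
  rfl

theorem testDeriv_testMulReal (η : R3 → ℝ) (hη : ContDiff ℝ ∞ η) (φ : TestFun) (j : Fin 3) :
    testDeriv j (testMulReal η hη φ)
      = testMulReal (partialDeriv j η) (contDiff_partialDeriv hη j) φ
        + testMulReal η hη (testDeriv j φ) := by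
  ext x
  have hd : Differentiable ℝ η := hη.differentiable (by simp)
  have hd' : Differentiable ℝ (fun x => (η x : ℂ)) :=
    (Complex.ofRealCLM.contDiff.comp hη).differentiable (by simp : (∞ : WithTop ℕ∞) ≠ 0)
  have := partialDeriv_mul hd' φ.differentiable j x
  rw [partialDeriv_ofReal hd] at this
  exact this

/-- The kinetic part of the localization formula. -/
theorem re_inner_testMulReal_sq_testLap (η : R3 → ℝ) (hη : ContDiff ℝ ∞ η) (φ : TestFun) :
    (inner ℂ (testToL2 (testMulReal η hη (testMulReal η hη φ))) (testToL2 (testLap φ))).re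
      = ∑ j, ‖testToL2 (testMulReal (partialDeriv j η) (contDiff_partialDeriv hη j) φ)‖ ^ 2
        - gradNormSq (testMulReal η hη φ) := by
  rw [inner_testLap, Complex.neg_re, Complex.re_sum, gradNormSq, ← Finset.sum_sub_distrib,
    ← Finset.sum_neg_distrib]
  refine Finset.sum_congr rfl fun j _ => ?_
  set A := testDeriv j (testMulReal η hη φ) with hA
  set B := testMulReal (partialDeriv j η) (contDiff_partialDeriv hη j) φ with hB
  have h1 : testMulReal η hη (testDeriv j φ) = A - B := by
    rw [hA, testDeriv_testMulReal, add_sub_cancel_left]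
  have h2 : testDeriv j (testMulReal η hη (testMulReal η hη φ)) = testMulReal η hη (B + A) := by
    rw [testDeriv_testMulReal, ← hA, map_add]
    congr 1
    ext x
    simp [hB, testMulReal_apply]
    ring
  -- With A = ∂ⱼ(ηφ) and B = (∂ⱼη)φ the pairing becomes ⟨B + A, A − B⟩; its real part is ‖A‖² − ‖B‖²
  -- because the cross terms are complex conjugates.
  rw [h2, inner_testMulReal_left, h1]
  simp only [map_add, map_sub, inner_add_left, inner_sub_right]
  have h3 : (inner ℂ (testToL2 A) (testToL2 B)).re = (inner ℂ (testToL2 B) (testToL2 A)).re :=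
    inner_re_symm (𝕜 := ℂ) _ _
  have h4 : ∀ u : L2, (inner ℂ u u).re = ‖u‖ ^ 2 := fun u =>
    inner_self_eq_norm_sq (𝕜 := ℂ) u
  simp only [Complex.add_re, Complex.sub_re, h3, h4]
  ring

/-- Lower bound for `Re ⟨η²φ, Hφ⟩`, for real smooth `η`. -/
theorem IsAdmissible.exists_le_re_inner (hV : IsAdmissible V) (ε : ℝ≥0) (hε : 0 < ε) :
    ∃ (C : ℝ≥0) (R : ℝ), ∀ (η : R3 → ℝ) (hη : ContDiff ℝ ∞ η) (c : ℝ≥0)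
      (_ : ∀ x, perpNorm x ≤ R → |η x| ≤ c) (φ : TestFun),
      (1 - ε) * gradNormSq (testMulReal η hη φ) - ε * ‖testToL2 (testMulReal η hη φ)‖ ^ 2
        - C * c ^ 2 * ‖testToL2 φ‖ ^ 2
        - ∑ j, ‖testToL2 (testMulReal (partialDeriv j η) (contDiff_partialDeriv hη j) φ)‖ ^ 2
      ≤ (inner ℂ (testToL2 (testMulReal η hη (testMulReal η hη φ))) (testHam hV φ)).re := by
  -- The form bound is applied to ηφ. Its non-small remainder sees only the tube of radius R, so η
  -- may be arbitrarily large outside the tube without affecting the constant.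
  obtain ⟨C, R, h⟩ := hV.exists_form_bound ε hε
  refine ⟨C, R, fun η hη c hc φ => ?_⟩
  set w := testMulReal η hη φ with hw
  have h1 : ‖inner ℂ (testToL2 (testMulReal η hη w)) (potMul hV φ)‖ₑ
      ≤ ENNReal.ofReal (ε * (gradNormSq w + ‖testToL2 w‖ ^ 2) + C * (c ^ 2 * ‖testToL2 φ‖ ^ 2)) := by
    rw [inner_potMul]
    refine (enorm_integral_le_lintegral_enorm _).trans ?_
    have e1 : ∀ x, ‖(V x : ℂ) * (starRingEnd ℂ ((testMulReal η hη w).1 x) * φ.1 x)‖ₑ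
        = ‖V x‖ₑ * ‖w.1 x‖ₑ ^ 2 := by
      intro x
      have : starRingEnd ℂ ((testMulReal η hη w).1 x) * φ.1 x
          = starRingEnd ℂ (w.1 x) * w.1 x := by
        simp [hw, testMulReal_apply]
        ring
      rw [this, enorm_mul, enorm_mul, RCLike.enorm_conj, sq]
      congr 1
      rw [← ofReal_norm, ← ofReal_norm, Complex.norm_real]
    simp only [e1]
    refine (h w).trans ?_
    have hG := gradNormSq_nonneg w
    rw [lintegral_gradSq_eq, massSq_eq, ← ENNReal.ofReal_add hG (by positivity),
      ENNReal.ofReal_add (p := ε * _) (by positivity) (by positivity),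
      ENNReal.ofReal_mul (p := ε) (by positivity), ENNReal.ofReal_mul (p := C) (by positivity),
      ENNReal.ofReal_coe_nnreal, ENNReal.ofReal_coe_nnreal]
    gcongr
    rw [ENNReal.ofReal_mul (by positivity), ← massSq_eq, massSq,
      ← lintegral_const_mul _ (φ.continuous.measurable.enorm.pow_const 2)]
    calc ∫⁻ x in {x | perpNorm x ≤ R}, ‖w.1 x‖ₑ ^ 2
        ≤ ∫⁻ x in {x | perpNorm x ≤ R}, ENNReal.ofReal (c ^ 2) * ‖φ.1 x‖ₑ ^ 2 := by
          refine setLIntegral_mono ?_ fun x hx => ?_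
          · exact (φ.continuous.measurable.enorm.pow_const 2).const_mul _
          · rw [hw, testMulReal_apply, enorm_mul, mul_pow, ENNReal.ofReal_pow (by positivity)]
            gcongr
            rw [← ofReal_norm, Complex.norm_real]
            exact ENNReal.ofReal_le_ofReal (hc x hx)
      _ ≤ _ := setLIntegral_le_lintegral _ _
  have h2 : ‖inner ℂ (testToL2 (testMulReal η hη w)) (potMul hV φ)‖
      ≤ ε * (gradNormSq w + ‖testToL2 w‖ ^ 2) + C * (c ^ 2 * ‖testToL2 φ‖ ^ 2) := by
    rw [← ofReal_norm] at h1
    have hG := gradNormSq_nonneg w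
    exact (ENNReal.ofReal_le_ofReal_iff (by positivity)).1 h1
  have h3 := (abs_le.1 (Complex.abs_re_le_norm _ |>.trans h2)).1
  rw [testHam_apply, inner_sub_right, Complex.sub_re, re_inner_testMulReal_sq_testLap]
  linarith

/-- The lower bound with η = 1 and ε = 1/2 leaves half of the kinetic energy, which Cauchy–Schwarz
for ⟨φ, Hφ⟩ controls by the graph norm. -/
theorem IsAdmissible.exists_gradNormSq_le (hV : IsAdmissible V) :
    ∃ C : ℝ, 0 ≤ C ∧ ∀ φ, gradNormSq φ ≤ C * (‖testToL2 φ‖ ^ 2 + ‖testHam hV φ‖ ^ 2) := by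
  obtain ⟨C, R, h⟩ := hV.exists_le_re_inner (1 / 2) (by positivity)
  refine ⟨2 * (C + 2), by positivity, fun φ => ?_⟩
  have h1 := h (fun _ => 1) contDiff_const 1 (by simp) φ
  have e1 : testMulReal (fun _ => 1) contDiff_const φ = φ := by ext x; simp [testMulReal_apply]
  have e2 : ∀ j, testMulReal (partialDeriv j fun _ => (1 : ℝ))
      (contDiff_partialDeriv contDiff_const j) φ = 0 := by
    intro j; ext x; simp [testMulReal_apply, partialDeriv]
  simp only [e1, e2] at h1
  have h2 : (inner ℂ (testToL2 φ) (testHam hV φ)).re ≤ ‖testToL2 φ‖ * ‖testHam hV φ‖ :=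
    (Complex.re_le_norm _).trans (norm_inner_le_norm _ _)
  have h3 : ‖testToL2 φ‖ * ‖testHam hV φ‖ ≤ ‖testToL2 φ‖ ^ 2 + ‖testHam hV φ‖ ^ 2 := by
    nlinarith [sq_nonneg (‖testToL2 φ‖ - ‖testHam hV φ‖), sq_nonneg ‖testToL2 φ‖,
      sq_nonneg ‖testHam hV φ‖]
  push_cast at h1
  have h4 : 0 ≤ (C : ℝ) * ‖testHam hV φ‖ ^ 2 := by positivity
  simp at h1
  nlinarith [sq_nonneg ‖testToL2 φ‖, sq_nonneg ‖testHam hV φ‖]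

theorem denseRange_testToL2 : DenseRange testToL2 := by
  have h := Lp.dense_hasCompactSupport_contDiff (E := R3) (F := ℂ) (μ := volume) (p := 2) (by simp)
  refine h.mono ?_
  rintro f ⟨g, hg, hg1, hg2⟩
  refine ⟨⟨g, hg2, hg1⟩, Lp.ext ?_⟩
  exact (testToL2_ae _).trans hg.symm

/-! ### Resolvents -/

section Resolvent

variable {E : Type*} [NormedAddCommGroup E] [NormedSpace ℂ E] {T : E →ₗ.[ℂ] E}

theorem isResolventAt_resolventOp {z : ℂ} (hz : z ∉ spec T) :
    IsResolventAt T z (resolventOp T z) := by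
  have h : ∃ R : E →L[ℂ] E, IsResolventAt T z R := not_not.1 hz
  rw [resolventOp, dif_pos h]
  exact h.choose_spec

theorem resolvent_identity {z w : ℂ} (hz : z ∉ spec T) (hw : w ∉ spec T) :
    resolventOp T z = resolventOp T w + (z - w) • (resolventOp T w * resolventOp T z) := by
  ext f
  obtain ⟨h1, h2⟩ := (isResolventAt_resolventOp hz).1 f
  have h3 := (isResolventAt_resolventOp hw).2 ⟨resolventOp T z f, h1⟩
  have h4 : T ⟨resolventOp T z f, h1⟩ - w • resolventOp T z f = f + (z - w) • resolventOp T z f := by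
    rw [sub_smul]
    nth_rw 3 [← h2]
    abel
  simp only [h4, map_add, map_smul] at h3
  exact h3.symm

theorem one_sub_smul_mul_resolventOp {z w : ℂ} (hz : z ∉ spec T) (hw : w ∉ spec T) :
    (1 - (z - w) • resolventOp T w) * (1 + (z - w) • resolventOp T z) = 1 := by
  have h := resolvent_identity hz hw
  rw [sub_mul, one_mul, smul_mul_assoc, mul_add, mul_one, mul_smul_comm]
  nth_rw 1 [h]
  rw [sub_eq_iff_eq_add]

theorem one_add_mul_one_sub {z w : ℂ} (hz : z ∉ spec T) (hw : w ∉ spec T) :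
    (1 + (z - w) • resolventOp T z) * (1 - (z - w) • resolventOp T w) = 1 := by
  have := one_sub_smul_mul_resolventOp hw hz
  rw [← neg_sub z w, neg_smul, neg_smul, sub_neg_eq_add, ← sub_eq_add_neg] at this
  exact this

end Resolvent

/-! ### The closure of the minimal operator -/

variable {V : R3 → ℝ}

theorem mem_minimalGraph_iff (hV : IsAdmissible V) (p : L2 × L2) :
    p ∈ minimalGraph V ↔ ∃ φ : TestFun, p = (testToL2 φ, testHam hV φ) := by
  constructor
  · rintro ⟨φ, hφ, h1, h2⟩
    exact ⟨⟨φ, hφ⟩, Prod.ext (Lp.ext (h1.trans (testToL2_ae ⟨φ, hφ⟩).symm))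
      (Lp.ext (h2.trans (testHam_ae hV ⟨φ, hφ⟩).symm))⟩
  · rintro ⟨φ, rfl⟩
    exact ⟨φ, φ.2, testToL2_ae φ, testHam_ae hV φ⟩

theorem minimalGraph_toLinearPMap_graph (V : R3 → ℝ) :
    (minimalGraph V).toLinearPMap.graph = minimalGraph V :=
  Submodule.toLinearPMap_graph_eq _ fun p hp h => minimalGraph_functional V p hp h

theorem inner_eq_of_mem_closure_minimalGraph (hV : IsAdmissible V) {p : L2 × L2}
    (hp : p ∈ (minimalGraph V).topologicalClosure) (ψ : TestFun) :
    inner ℂ (testToL2 ψ) p.2 = inner ℂ (testHam hV ψ) p.1 := by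
  have hcl : IsClosed {p : L2 × L2 | inner ℂ (testToL2 ψ) p.2 = inner ℂ (testHam hV ψ) p.1} :=
    isClosed_eq (by fun_prop) (by fun_prop)
  refine closure_minimal (fun q hq => ?_) hcl hp
  obtain ⟨φ, rfl⟩ := (mem_minimalGraph_iff hV q).1 hq
  exact (inner_testHam_left hV ψ φ).symm

/-- A symmetric, densely defined operator is closable: a limit point (0, y) of the graph has y
orthogonal to all test functions. -/
theorem isClosable_minimal (hV : IsAdmissible V) : (minimalGraph V).toLinearPMap.IsClosable := by
  refine ⟨(minimalGraph V).topologicalClosure.toLinearPMap, ?_⟩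
  rw [minimalGraph_toLinearPMap_graph, Submodule.toLinearPMap_graph_eq]
  intro p hp h0
  have h1 : ∀ ψ : TestFun, inner ℂ (testToL2 ψ) p.2 = 0 := fun ψ => by
    rw [inner_eq_of_mem_closure_minimalGraph hV hp, h0, inner_zero_right]
  have h2 : ∀ u : L2, inner ℂ u p.2 = 0 := fun u =>
    denseRange_testToL2.induction_on (p := fun u => inner ℂ u p.2 = 0) u
      (isClosed_eq (by fun_prop) (by fun_prop)) h1
  exact inner_self_eq_zero.1 (h2 p.2)

theorem hamiltonian_graph (hV : IsAdmissible V) :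
    (hamiltonian V).graph = (minimalGraph V).topologicalClosure := by
  rw [hamiltonian, ← (isClosable_minimal hV).graph_closure_eq_closure_graph,
    minimalGraph_toLinearPMap_graph]

theorem hamiltonian_test (hV : IsAdmissible V) (φ : TestFun) :
    ∃ h : testToL2 φ ∈ (hamiltonian V).domain, hamiltonian V ⟨testToL2 φ, h⟩ = testHam hV φ := by
  have h1 : (testToL2 φ, testHam hV φ) ∈ (hamiltonian V).graph := by
    rw [hamiltonian_graph hV]
    exact subset_closure ((mem_minimalGraph_iff hV _).2 ⟨φ, rfl⟩)
  obtain ⟨y, hy1, hy2⟩ := (LinearPMap.mem_graph_iff _).1 h1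
  obtain ⟨y, hy⟩ := y
  obtain rfl : y = testToL2 φ := hy1
  exact ⟨hy, hy2⟩

/-- `H - z` on test functions. -/
def testHamSub (hV : IsAdmissible V) (z : ℂ) : TestFun →ₗ[ℂ] L2 := testHam hV - z • testToL2

theorem testHamSub_apply (hV : IsAdmissible V) (z : ℂ) (φ : TestFun) :
    testHamSub hV z φ = testHam hV φ - z • testToL2 φ := rfl

theorem resolventOp_testHamSub (hV : IsAdmissible V) {z : ℂ} (hz : z ∉ spec (hamiltonian V))
    (φ : TestFun) : resolventOp (hamiltonian V) z (testHamSub hV z φ) = testToL2 φ := by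
  obtain ⟨h1, h2⟩ := hamiltonian_test hV φ
  have := (isResolventAt_resolventOp hz).2 ⟨_, h1⟩
  rwa [h2] at this

/-- Test functions approximate the domain of the closure in graph norm, and H − z is onto.
Identities and bounds for operators involving the resolvent can therefore be checked on vectors (H −
z)φ. -/
theorem denseRange_testHamSub (hV : IsAdmissible V) {z : ℂ} (hz : z ∉ spec (hamiltonian V)) :
    DenseRange (testHamSub hV z) := by
  intro f
  obtain ⟨h1, h2⟩ := (isResolventAt_resolventOp hz).1 f
  have h3 : (resolventOp (hamiltonian V) z f, hamiltonian V ⟨_, h1⟩)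
      ∈ (minimalGraph V).topologicalClosure := by
    rw [← hamiltonian_graph hV]
    exact (hamiltonian V).mem_graph ⟨_, h1⟩
  have hc : Continuous (fun p : L2 × L2 => p.2 - z • p.1) := by fun_prop
  have h4 := hc.continuousAt.continuousWithinAt.mem_closure_image h3
  simp only [h2] at h4
  refine closure_mono ?_ h4
  rintro _ ⟨p, hp, rfl⟩
  obtain ⟨φ, rfl⟩ := (mem_minimalGraph_iff hV p).1 hp
  exact ⟨φ, rfl⟩

/-- Symmetry on test functions and density are enough. Self-adjointness of H is not presupposed; one
real point of the resolvent set replaces it. -/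
theorem isSelfAdjoint_resolventOp (hV : IsAdmissible V) {x : ℝ}
    (hx : (x : ℂ) ∉ spec (hamiltonian V)) : IsSelfAdjoint (resolventOp (hamiltonian V) (x : ℂ)) := by
  rw [ContinuousLinearMap.isSelfAdjoint_iff_isSymmetric]
  set R := resolventOp (hamiltonian V) (x : ℂ)
  intro f g
  refine (denseRange_testHamSub hV hx).induction_on₂ (p := fun f g => inner ℂ (R f) g = inner ℂ f (R g))
    (isClosed_eq (by fun_prop) (by fun_prop)) (fun φ ψ => ?_) f g
  rw [resolventOp_testHamSub hV hx, resolventOp_testHamSub hV hx, testHamSub_apply,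
    testHamSub_apply, inner_sub_left, inner_sub_right, inner_testHam_left, inner_smul_left,
    inner_smul_right, Complex.conj_ofReal]

/-- A real point of the resolvent set just above an isolated part of the spectrum. -/
theorem exists_real_not_mem_spec {A : Set ℂ} {σ₀ : Set ℝ} {s : ℝ}
    (hiso : ∃ δ > 0, ∀ E ∈ σ₀, ∀ w ∈ A, w ∉ Complex.ofReal '' σ₀ → δ ≤ dist (E : ℂ) w)
    (hs : IsLUB σ₀ s) : ∃ x : ℝ, s < x ∧ (x : ℂ) ∉ A := by
  obtain ⟨δ, hδ, h⟩ := hiso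
  -- The point E + δ/2 exceeds the supremum, so it is not in σ₀, and it is closer than δ to E, so it
  -- is not in the rest of the spectrum either.
  obtain ⟨E, hE, hE1⟩ := (lt_isLUB_iff hs).1 (show s - δ / 2 < s by linarith)
  refine ⟨E + δ / 2, by linarith, fun hA => ?_⟩
  have h1 := h E hE _ hA (by
    rintro ⟨y, hy, hyE⟩
    have := hs.1 hy
    rw [Complex.ofReal_injective hyE] at this
    linarith)
  rw [Complex.dist_eq] at h1
  have : (E : ℂ) - ((E + δ / 2 : ℝ) : ℂ) = ((-(δ / 2) : ℝ) : ℂ) := by push_cast; ring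
  rw [this, Complex.norm_real, Real.norm_eq_abs, abs_neg, abs_of_pos (by linarith)] at h1
  linarith

/-! ### Contour integrals -/

section Contour

variable {A S : Set ℂ} (Γ : EnclosingContour A S)
variable {F : Type*} [NormedAddCommGroup F] [NormedSpace ℂ F]

/-- The integral of a vector valued function over a contour. -/
def EnclosingContour.integral (g : ℂ → F) : F :=
  ∑ k, ∫ t in (0 : ℝ)..1, deriv (Γ.curve k) t • g (Γ.curve k t)

theorem EnclosingContour.trace_subset : Γ.trace ⊆ Aᶜ := by
  rintro z ⟨k, t, ht, rfl⟩
  exact Γ.avoids k t ht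

theorem EnclosingContour.continuousOn_curve (k : Fin Γ.n) :
    ContinuousOn (Γ.curve k) (Icc 0 1) := by
  obtain ⟨C, hC⟩ := Γ.lipschitz k
  exact hC.continuousOn

theorem EnclosingContour.isCompact_trace : IsCompact Γ.trace := by
  have : Γ.trace = ⋃ k, Γ.curve k '' Icc 0 1 := by
    ext z
    simp only [EnclosingContour.trace, mem_iUnion, mem_image]
    exact ⟨fun ⟨k, t, ht, h⟩ => ⟨k, t, ht, h.symm⟩, fun ⟨k, t, ht, h⟩ => ⟨k, t, ht, h.symm⟩⟩
  rw [this]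
  exact isCompact_iUnion fun k => isCompact_Icc.image_of_continuousOn (Γ.continuousOn_curve k)

theorem EnclosingContour.curve_mem_trace (k : Fin Γ.n) {t : ℝ} (ht : t ∈ Icc (0 : ℝ) 1) :
    Γ.curve k t ∈ Γ.trace := ⟨k, t, ht, rfl⟩

theorem EnclosingContour.exists_deriv_le :
    ∃ C : ℝ, 0 ≤ C ∧ ∀ k, ∀ t ∈ Ioo (0 : ℝ) 1, ‖deriv (Γ.curve k) t‖ ≤ C := by
  choose C hC using Γ.lipschitz
  refine ⟨∑ k, (C k : ℝ), by positivity, fun k t ht => ?_⟩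
  refine (norm_deriv_le_of_lipschitzOn (Icc_mem_nhds ht.1 ht.2) (hC k)).trans ?_
  exact Finset.single_le_sum (f := fun k => (C k : ℝ)) (fun _ _ => NNReal.coe_nonneg _)
    (Finset.mem_univ k)

theorem EnclosingContour.intervalIntegrable {g : ℂ → F} (hg : ContinuousOn g Γ.trace)
    (k : Fin Γ.n) :
    IntervalIntegrable (fun t => deriv (Γ.curve k) t • g (Γ.curve k t)) volume 0 1 := by
  obtain ⟨C, hC0, hC⟩ := Γ.exists_deriv_le
  have h1 : ContinuousOn (fun t => g (Γ.curve k t)) (Icc 0 1) :=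
    hg.comp (Γ.continuousOn_curve k) fun t ht => Γ.curve_mem_trace k ht
  have h2 : IntervalIntegrable (fun t => g (Γ.curve k t)) volume 0 1 :=
    ContinuousOn.intervalIntegrable (by rwa [uIcc_of_le zero_le_one])
  rw [intervalIntegrable_iff_integrableOn_Ioo_of_le zero_le_one] at h2 ⊢
  refine h2.bdd_smul C (measurable_deriv _).aestronglyMeasurable ?_
  filter_upwards [self_mem_ae_restrict measurableSet_Ioo] with t ht
  exact hC k t ht

theorem EnclosingContour.exists_norm_integral_le :
    ∃ ℓ : ℝ, 0 ≤ ℓ ∧ ∀ {F : Type} [NormedAddCommGroup F] [NormedSpace ℂ F] (g : ℂ → F) (M : ℝ),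
      (∀ z ∈ Γ.trace, ‖g z‖ ≤ M) → 0 ≤ M → ‖Γ.integral g‖ ≤ ℓ * M := by
  obtain ⟨C, hC0, hC⟩ := Γ.exists_deriv_le
  refine ⟨Γ.n * C, by positivity, fun g M hM hM0 => ?_⟩
  have h1 : ∀ k, ‖∫ t in (0 : ℝ)..1, deriv (Γ.curve k) t • g (Γ.curve k t)‖ ≤ C * M := by
    intro k
    have h2 : ∀ᵐ t : ℝ, t ∈ uIoc (0 : ℝ) 1 → ‖deriv (Γ.curve k) t • g (Γ.curve k t)‖ ≤ C * M := by
      -- The Lipschitz bound on [0, 1] controls the two-sided derivative only at interior points;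
      -- the endpoint is a null set.
      have h3 : ∀ᵐ t : ℝ, t ≠ 1 := by simp [ae_iff]
      filter_upwards [h3] with t ht1 ht
      rw [uIoc_of_le zero_le_one] at ht
      rw [norm_smul]
      have := hC k t ⟨ht.1, lt_of_le_of_ne ht.2 ht1⟩
      have := hM _ (Γ.curve_mem_trace k ⟨ht.1.le, ht.2⟩)
      gcongr
    simpa using intervalIntegral.norm_integral_le_of_norm_le_const_ae h2
  refine (norm_sum_le _ _).trans ((Finset.sum_le_sum fun k _ => h1 k).trans ?_)
  simp [mul_assoc]

theorem EnclosingContour.integral_congr {g g' : ℂ → F} (h : ∀ z ∈ Γ.trace, g z = g' z) :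
    Γ.integral g = Γ.integral g' := by
  refine Finset.sum_congr rfl fun k _ => intervalIntegral.integral_congr fun t ht => ?_
  rw [uIcc_of_le zero_le_one] at ht
  simp only [h _ (Γ.curve_mem_trace k ht)]

theorem EnclosingContour.integral_clm {F' : Type*} [NormedAddCommGroup F'] [NormedSpace ℂ F']
    [CompleteSpace F] [CompleteSpace F'] (L : F →L[ℂ] F') {g : ℂ → F}
    (hg : ContinuousOn g Γ.trace) :
    L (Γ.integral g) = Γ.integral fun z => L (g z) := by
  simp only [EnclosingContour.integral, map_sum]
  refine Finset.sum_congr rfl fun k _ => ?_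
  rw [← L.intervalIntegral_comp_comm (Γ.intervalIntegrable hg k)]
  simp only [map_smul]

theorem EnclosingContour.integral_sub {g g' : ℂ → F} (hg : ContinuousOn g Γ.trace)
    (hg' : ContinuousOn g' Γ.trace) :
    Γ.integral (fun z => g z - g' z) = Γ.integral g - Γ.integral g' := by
  simp only [EnclosingContour.integral, smul_sub, ← Finset.sum_sub_distrib]
  refine Finset.sum_congr rfl fun k _ => ?_
  exact intervalIntegral.integral_sub (Γ.intervalIntegrable hg k) (Γ.intervalIntegrable hg' k)

end Contour

/-! ### The Riesz projection of an operator with self-adjoint resolvent -/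

section Riesz

variable {E : Type*} [NormedAddCommGroup E] [InnerProductSpace ℂ E] {T : E →ₗ.[ℂ] E}

/-- Expressing the resolvent through inversion in the Banach algebra gives its continuity in z, and
later identifies it inside the functional calculus of a single resolvent. -/
theorem resolventOp_eq_mul_inverse {z w : ℂ} (hz : z ∉ spec T) (hw : w ∉ spec T) :
    resolventOp T z = resolventOp T w * Ring.inverse (1 - (z - w) • resolventOp T w) := by
  have h1 : Ring.inverse (1 - (z - w) • resolventOp T w) = 1 + (z - w) • resolventOp T z :=
    Ring.inverse_unit ⟨_, _, one_sub_smul_mul_resolventOp hz hw, one_add_mul_one_sub hz hw⟩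
  rw [h1, mul_add, mul_one, mul_smul_comm]
  exact resolvent_identity hz hw

/-- Half of the spectral mapping theorem for μ = 1/(e − w): if e = w + μ⁻¹ were a resolvent point, 1
− μ⁻¹(T − w)⁻¹ would be invertible with inverse 1 + μ⁻¹(T − e)⁻¹. -/
theorem mem_spec_of_mem_spectrum {w μ : ℂ} (hw : w ∉ spec T)
    (hμ : μ ∈ spectrum ℂ (resolventOp T w)) (hμ0 : μ ≠ 0) : w + μ⁻¹ ∈ spec T := by
  by_contra h
  have h1 := one_sub_smul_mul_resolventOp h hw
  have h2 := one_add_mul_one_sub h hw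
  rw [add_sub_cancel_left] at h1 h2
  have h3 : IsUnit (1 - μ⁻¹ • resolventOp T w) := ⟨⟨_, _, h1, h2⟩, rfl⟩
  refine (spectrum.mem_iff.1 hμ) ?_
  have h4 : algebraMap ℂ (E →L[ℂ] E) μ - resolventOp T w
      = (Units.mk0 μ hμ0) • (1 - μ⁻¹ • resolventOp T w) := by
    rw [Units.smul_def, Units.val_mk0, smul_sub, smul_smul, mul_inv_cancel₀ hμ0, one_smul,
      Algebra.algebraMap_eq_smul_one]
  rw [h4]
  exact h3.smul _

variable [CompleteSpace E]

theorem continuousOn_resolventOp : ContinuousOn (resolventOp T) (spec T)ᶜ := by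
  intro z hz
  have h1 : ContinuousAt (fun w => resolventOp T z *
      Ring.inverse (1 - (w - z) • resolventOp T z)) z := by
    refine continuousAt_const.mul ?_
    refine ContinuousAt.comp (g := Ring.inverse) ?_ (by fun_prop)
    have : (1 - (z - z) • resolventOp T z) = ((1 : (E →L[ℂ] E)ˣ) : E →L[ℂ] E) := by simp
    rw [this]
    exact NormedRing.inverse_continuousAt 1
  refine h1.continuousWithinAt.congr (fun w hw => resolventOp_eq_mul_inverse hw hz)
    (resolventOp_eq_mul_inverse hz hz)

/-- The properties of the Riesz projection that are used below. -/
theorem rieszProjection_properties {σ₀ : Set ℝ} {s x₀ : ℝ} (hs : ∀ e ∈ σ₀, e ≤ s)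
    (hx₀ : (x₀ : ℂ) ∉ spec T) (hsa : IsSelfAdjoint (resolventOp T (x₀ : ℂ)))
    (Γ : EnclosingContour (spec T) (Complex.ofReal '' σ₀)) :
    IsSelfAdjoint (rieszProjection T Γ) ∧ IsIdempotentElem (rieszProjection T Γ) ∧
      ∃ G : E →L[ℂ] E, rieszProjection T Γ = resolventOp T (x₀ : ℂ) * G ∧
        rieszProjection T Γ * G = G ∧ G * rieszProjection T Γ = G ∧
        ∀ u, (inner ℂ u (G u)).re ≤ (s - x₀) * ‖rieszProjection T Γ u‖ ^ 2 := by
  -- All operators are computed in the continuous functional calculus of the self-adjoint a. The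
  -- variable μ stands for 1/(e − x₀) with e in the spectrum of T, and (T − z)⁻¹ corresponds to μ/(1
  -- − (z − x₀)μ).
  set a := resolventOp T (x₀ : ℂ) with ha
  have hn : IsStarNormal a := hsa.isStarNormal
  set Φ := cfcHom (R := ℂ) hn with hΦ
  set L := cfcL (R := ℂ) hn
  set X : C(spectrum ℂ a, ℂ) := ContinuousMap.restrict (spectrum ℂ a) (ContinuousMap.id ℂ) with hX
  have hΦX : Φ X = a := cfcHom_id hn
  have hXv : ∀ μ, X μ = μ := fun μ => rfl
  have hunit : ∀ z ∈ Γ.trace, ∀ μ : spectrum ℂ a, 1 - (z - x₀) * (μ : ℂ) ≠ 0 := by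
    intro z hz μ h
    have hμ0 : (μ : ℂ) ≠ 0 := by rintro h0; simp [h0] at h
    refine Γ.trace_subset hz ?_
    have : z = x₀ + (μ : ℂ)⁻¹ := by
      field_simp
      linear_combination -h
    rw [this]
    exact mem_spec_of_mem_spectrum hx₀ μ.2 hμ0
  set N : ℂ → C(spectrum ℂ a, ℂ) := fun z => Ring.inverse (1 - (z - x₀) • X) with hN
  have hU : ∀ z ∈ Γ.trace, IsUnit (1 - (z - x₀) • X) := by
    intro z hz
    rw [ContinuousMap.isUnit_iff_forall_ne_zero]
    exact hunit z hz
  have hNm : ∀ z ∈ Γ.trace, (1 - (z - x₀) • X) * N z = 1 := fun z hz =>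
    Ring.mul_inverse_cancel _ (hU z hz)
  have hNc : ContinuousOn N Γ.trace := by
    intro z hz
    obtain ⟨v, hv⟩ := hU z hz
    have h1 : ContinuousAt N z := by
      refine ContinuousAt.comp (g := Ring.inverse) ?_ (by fun_prop)
      rw [← hv]
      exact NormedRing.inverse_continuousAt v
    exact h1.continuousWithinAt
  have hNv : ∀ z ∈ Γ.trace, ∀ μ : spectrum ℂ a, N z μ = (1 - (z - x₀) * (μ : ℂ))⁻¹ := by
    intro z hz μ
    have := congrArg (fun f : C(spectrum ℂ a, ℂ) => f μ) (hNm z hz)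
    exact eq_inv_of_mul_eq_one_right this
  have hXNc : ContinuousOn (fun z => X * N z) Γ.trace := continuousOn_const.mul hNc
  have hres : ∀ z ∈ Γ.trace, Φ (X * N z) = resolventOp T z := by
    intro z hz
    have hz' := Γ.trace_subset hz
    have h1 : Φ (1 - (z - x₀) • X) = 1 - (z - x₀) • a := by
      rw [map_sub, map_one, map_smul, hΦX]
    have h2 : (1 - (z - x₀) • a) * Φ (N z) = 1 := by
      rw [← h1, ← map_mul, hNm z hz, map_one]
    have h3 : Φ (N z) = 1 + (z - x₀) • resolventOp T z := by
      calc Φ (N z) = ((1 + (z - x₀) • resolventOp T z) * (1 - (z - x₀) • a)) * Φ (N z) := by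
            rw [one_add_mul_one_sub hz' hx₀, one_mul]
        _ = _ := by rw [mul_assoc, h2, mul_one]
    rw [map_mul, hΦX, h3, mul_add, mul_one, mul_smul_comm]
    exact (resolvent_identity hz' hx₀).symm
  set κ : ℂ := Complex.I / (2 * Real.pi)
  set Q : C(spectrum ℂ a, ℂ) := κ • Γ.integral N
  set J : C(spectrum ℂ a, ℂ) := X * Q with hJ
  have hP : rieszProjection T Γ = Φ J := by
    have h1 : J = κ • Γ.integral (fun z => X * N z) := by
      rw [hJ, mul_smul_comm]
      congr 1
      exact Γ.integral_clm (ContinuousLinearMap.mul ℂ _ X) hNc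
    rw [h1, map_smul]
    change κ • Γ.integral (resolventOp T) = κ • L (Γ.integral (fun z => X * N z))
    rw [Γ.integral_clm L hXNc]
    congr 1
    exact Γ.integral_congr fun z hz => (hres z hz).symm
  -- J(μ) is the winding number of the contour about x₀ + μ⁻¹, a point of the spectrum of T, so it
  -- is 1 or 0. At μ = 0, the point at infinity, it vanishes through the factor X.
  have hJv : ∀ μ : spectrum ℂ a, (J μ = 0) ∨ (J μ = 1 ∧ ∃ e ∈ σ₀, (μ : ℂ)⁻¹ = ((e - x₀ : ℝ) : ℂ)) := by
    intro μ
    rcases eq_or_ne (μ : ℂ) 0 with h0 | h0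
    · left
      rw [hJ, ContinuousMap.mul_apply, hXv, h0, zero_mul]
    have hE := mem_spec_of_mem_spectrum hx₀ μ.2 h0
    set e := (x₀ : ℂ) + (μ : ℂ)⁻¹ with he
    have h1 : J μ = (2 * Real.pi * Complex.I)⁻¹ *
        ∑ k, ∫ t in (0 : ℝ)..1, deriv (Γ.curve k) t / (Γ.curve k t - e) := by
      have h2 : J μ = κ * ((μ : ℂ) * Γ.integral (fun z => N z μ)) := by
        have := Γ.integral_clm (ContinuousMap.evalCLM ℂ μ : C(spectrum ℂ a, ℂ) →L[ℂ] ℂ) hNc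
        simp only [ContinuousMap.evalCLM_apply] at this
        rw [← this, hJ, ContinuousMap.mul_apply, hXv]
        change (μ : ℂ) * (κ * _) = _
        ring
      have h3 : (μ : ℂ) * Γ.integral (fun z => N z μ)
          = - Γ.integral (fun z => (z - e)⁻¹) := by
        have e1 := Γ.integral_clm (ContinuousLinearMap.mul ℂ ℂ (-(μ : ℂ))) (g := fun z => N z μ)
          ((ContinuousMap.evalCLM ℂ μ : C(spectrum ℂ a, ℂ) →L[ℂ] ℂ).continuous.comp_continuousOn hNc)
        simp only [ContinuousLinearMap.mul_apply'] at e1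
        rw [← neg_inj, ← neg_mul, e1, neg_neg]
        refine Γ.integral_congr fun z hz => ?_
        have hz1 := hunit z hz μ
        have hz2 : z - e ≠ 0 := by
          intro h
          apply Γ.trace_subset hz
          rw [sub_eq_zero.1 h]
          exact hE
        rw [hNv z hz]
        rw [he] at hz2 ⊢
        have hz3 : z - (x₀ + (μ : ℂ)⁻¹) = -(1 - (z - x₀) * μ) * (μ : ℂ)⁻¹ := by
          field_simp
          ring
        rw [hz3, mul_inv, inv_inv, inv_neg]
        ring
      rw [h2, h3]
      -- The prefactor i/(2π) equals −1/(2πi); this sign cancels the one from writing the resolvent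
      -- as (e − z)⁻¹.
      have h4 : (2 * Real.pi * Complex.I)⁻¹ = -κ := by
        have hpi : (Real.pi : ℂ) ≠ 0 := by exact_mod_cast Real.pi_ne_zero
        have hI := Complex.I_ne_zero
        simp only [κ]
        field_simp
        rw [Complex.I_sq, neg_neg]
      rw [h4, EnclosingContour.integral]
      simp only [smul_eq_mul, div_eq_mul_inv]
      ring
    by_cases heS : e ∈ Complex.ofReal '' σ₀
    · right
      refine ⟨h1.trans (Γ.winding_one e heS), ?_⟩
      obtain ⟨r, hr, hre⟩ := heS
      refine ⟨r, hr, ?_⟩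
      rw [Complex.ofReal_sub, hre, he]
      ring
    · left
      exact h1.trans (Γ.winding_zero e ⟨hE, heS⟩)
  have hJJ : J * J = J := by
    ext μ
    rw [ContinuousMap.mul_apply]
    rcases hJv μ with h | ⟨h, -⟩ <;> simp [h]
  have hJs : star J = J := by
    ext μ
    rw [ContinuousMap.star_apply]
    rcases hJv μ with h | ⟨h, -⟩ <;> simp [h]
  -- Since XQ = J, the function Q equals 1/μ = e − x₀ where J = 1. Thus G represents the bounded
  -- operator (T − x₀)P.
  set G := J * Q with hG
  have hGv : ∀ μ : spectrum ℂ a, (J μ = 0 ∧ G μ = 0) ∨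
      (J μ = 1 ∧ ∃ e ∈ σ₀, G μ = ((e - x₀ : ℝ) : ℂ)) := by
    intro μ
    rcases hJv μ with h | ⟨h, e, he, h1⟩
    · exact Or.inl ⟨h, by rw [hG, ContinuousMap.mul_apply, h, zero_mul]⟩
    · refine Or.inr ⟨h, e, he, ?_⟩
      have hμ0 : (μ : ℂ) ≠ 0 := by
        intro h0
        rw [hJ, ContinuousMap.mul_apply, hXv, h0, zero_mul] at h
        exact zero_ne_one h
      rw [hG, ContinuousMap.mul_apply, h, one_mul, ← h1]
      exact eq_inv_of_mul_eq_one_right h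
  have hPs : IsSelfAdjoint (rieszProjection T Γ) := by
    rw [hP, isSelfAdjoint_iff, ← map_star, hJs]
  have hPi : IsIdempotentElem (rieszProjection T Γ) := by
    rw [hP, IsIdempotentElem, ← map_mul, hJJ]
  refine ⟨hPs, hPi, Φ G, ?_, ?_, ?_, fun u => ?_⟩
  · have h1 : X * G = J := by rw [hG, mul_left_comm, ← hJ, hJJ]
    rw [hP, ← h1, map_mul, hΦX]
  · rw [hP, ← map_mul, hG, ← mul_assoc, hJJ]
  · rw [hP, ← map_mul, hG, mul_right_comm, hJJ]
  -- The form bound is positivity of (s − x₀)J − G. This function is s − e ≥ 0 or 0, hence the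
  -- square of a real continuous function, and the square of a self-adjoint operator has a
  -- nonnegative form.
  · set h : C(spectrum ℂ a, ℂ) :=
      ⟨fun μ => ((Real.sqrt (((s - x₀ : ℂ) * J μ - G μ).re) : ℝ) : ℂ), by fun_prop⟩ with hh
    have hhs : star h = h := by
      ext μ
      simp [hh, ContinuousMap.star_apply]
    have hhh : h * h = (s - x₀ : ℂ) • J - G := by
      ext μ
      rw [ContinuousMap.mul_apply, ContinuousMap.sub_apply, ContinuousMap.smul_apply, smul_eq_mul]
      change ((Real.sqrt _ : ℝ) : ℂ) * ((Real.sqrt _ : ℝ) : ℂ) = _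
      rw [← Complex.ofReal_mul]
      rcases hGv μ with ⟨h1, h2⟩ | ⟨h1, e, he, h2⟩
      · simp [h1, h2]
      · have h3 : (s - x₀ : ℂ) * J μ - G μ = ((s - e : ℝ) : ℂ) := by
          rw [h1, h2]; push_cast; ring
        rw [h3, Complex.ofReal_re, Real.mul_self_sqrt (by linarith [hs e he])]
    have h1 : Φ h * Φ h = (s - x₀ : ℂ) • rieszProjection T Γ - Φ G := by
      rw [← map_mul, hhh, map_sub, map_smul, hP]
    have h2 : IsSelfAdjoint (Φ h) := by rw [isSelfAdjoint_iff, ← map_star, hhs]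
    have h3 : inner ℂ u ((Φ h * Φ h) u) = ((‖Φ h u‖ ^ 2 : ℝ) : ℂ) := by
      rw [mul_apply_eq_comp, ← ContinuousLinearMap.adjoint_inner_left,
        ← ContinuousLinearMap.star_eq_adjoint, h2.star_eq, inner_self_eq_norm_sq_to_K]
      simp
    have h4 : inner ℂ u (rieszProjection T Γ u) = ((‖rieszProjection T Γ u‖ ^ 2 : ℝ) : ℂ) := by
      nth_rw 1 [← hPi.eq]
      rw [mul_apply_eq_comp, ← ContinuousLinearMap.adjoint_inner_left,
        ← ContinuousLinearMap.star_eq_adjoint, hPs.star_eq, inner_self_eq_norm_sq_to_K]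
      simp
    rw [h1, sub_apply, smul_apply, inner_sub_right,
      inner_smul_right, h4] at h3
    have h5 := congrArg Complex.re h3
    rw [Complex.sub_re, ← Complex.ofReal_sub, ← Complex.ofReal_mul, Complex.ofReal_re,
      Complex.ofReal_re] at h5
    nlinarith [sq_nonneg ‖Φ h u‖]

end Riesz

/-! ### Multiplication operators on `L²` -/

/-- Bounded continuous functions on `ℝ³`. -/
structure BddCont (f : R3 → ℂ) : Prop where
  cont : Continuous f
  bdd : ∃ C : ℝ, ∀ x, ‖f x‖ ≤ C

theorem BddCont.memLp {f : R3 → ℂ} (hf : BddCont f) (u : L2) :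
    MemLp (fun x => f x * u x) 2 volume := by
  obtain ⟨C, hC⟩ := hf.bdd
  refine (Lp.memLp u).of_le_mul (c := C) (hf.cont.aestronglyMeasurable.mul
    (Lp.aestronglyMeasurable u)) (ae_of_all _ fun x => ?_)
  rw [norm_mul]
  exact mul_le_mul_of_nonneg_right (hC x) (norm_nonneg _)

theorem norm_toLp_mul_le {f : R3 → ℂ} (hf : BddCont f) {C : ℝ} (hC : ∀ x, ‖f x‖ ≤ C) (u : L2) :
    ‖(hf.memLp u).toLp _‖ ≤ C * ‖u‖ := by
  refine Lp.norm_le_mul_norm_of_ae_le_mul ?_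
  filter_upwards [(hf.memLp u).coeFn_toLp] with x hx
  rw [hx, norm_mul]
  exact mul_le_mul_of_nonneg_right (hC x) (norm_nonneg _)

/-- Multiplication by a bounded continuous function. -/
def mulOp (f : R3 → ℂ) (hf : BddCont f) : L2 →L[ℂ] L2 :=
  LinearMap.mkContinuousOfExistsBound
    { toFun := fun u => (hf.memLp u).toLp _
      map_add' := fun u v => by
        rw [← MemLp.toLp_add, MemLp.toLp_eq_toLp_iff]
        filter_upwards [Lp.coeFn_add u v] with x hx
        rw [hx, Pi.add_apply, Pi.add_apply, mul_add]
      map_smul' := fun c u => by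
        rw [RingHom.id_apply, ← MemLp.toLp_const_smul, MemLp.toLp_eq_toLp_iff]
        filter_upwards [Lp.coeFn_smul c u] with x hx
        rw [hx, Pi.smul_apply, Pi.smul_apply, smul_eq_mul, smul_eq_mul, mul_left_comm] }
    (by
      obtain ⟨C, hC⟩ := hf.bdd
      exact ⟨C, fun u => norm_toLp_mul_le hf hC u⟩)

theorem mulOp_ae {f : R3 → ℂ} (hf : BddCont f) (u : L2) :
    (mulOp f hf u : R3 → ℂ) =ᵐ[volume] fun x => f x * u x := (hf.memLp u).coeFn_toLp

theorem norm_mulOp_le {f : R3 → ℂ} (hf : BddCont f) {C : ℝ} (hC : ∀ x, ‖f x‖ ≤ C) :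
    ‖mulOp f hf‖ ≤ C :=
  ContinuousLinearMap.opNorm_le_bound _ ((norm_nonneg _).trans (hC 0)) (norm_toLp_mul_le hf hC)

theorem mulOp_testToL2 {f : R3 → ℂ} (hf : BddCont f) (hs : ContDiff ℝ ∞ f) (φ : TestFun) :
    mulOp f hf (testToL2 φ) = testToL2 (testMul f hs φ) := by
  refine Lp.ext ?_
  filter_upwards [mulOp_ae hf (testToL2 φ), testToL2_ae φ, testToL2_ae (testMul f hs φ)]
    with x h1 h2 h3
  rw [h1, h2, h3, coe_testMul, Pi.mul_apply]

theorem BddCont.mul {f g : R3 → ℂ} (hf : BddCont f) (hg : BddCont g) :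
    BddCont (fun x => f x * g x) := by
  obtain ⟨C, hC⟩ := hf.bdd
  obtain ⟨D, hD⟩ := hg.bdd
  refine ⟨hf.cont.mul hg.cont, C * D, fun x => ?_⟩
  rw [norm_mul]
  exact mul_le_mul (hC x) (hD x) (norm_nonneg _) ((norm_nonneg _).trans (hC x))

theorem mulOp_mul {f g : R3 → ℂ} (hf : BddCont f) (hg : BddCont g) :
    mulOp (fun x => f x * g x) (hf.mul hg) = mulOp f hf * mulOp g hg := by
  ext1 u
  refine Lp.ext ?_
  filter_upwards [mulOp_ae (hf.mul hg) u, mulOp_ae hf (mulOp g hg u), mulOp_ae hg u] with x h1 h2 h3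
  rw [h1, mul_apply_eq_comp, h2, h3, mul_assoc]

theorem mulOp_injective {f : R3 → ℂ} (hf : BddCont f) (h0 : ∀ x, f x ≠ 0) :
    Function.Injective (mulOp f hf) := by
  intro u v huv
  refine Lp.ext ?_
  filter_upwards [mulOp_ae hf u, mulOp_ae hf v] with x h1 h2
  rw [huv] at h1
  exact mul_left_cancel₀ (h0 x) (h1.symm.trans h2)

theorem mulOp_sub {f g : R3 → ℂ} (hf : BddCont f) (hg : BddCont g)
    (hfg : BddCont (fun x => f x - g x)) : mulOp (fun x => f x - g x) hfg = mulOp f hf - mulOp g hg := by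
  ext1 u
  refine Lp.ext ?_
  filter_upwards [mulOp_ae hfg u, mulOp_ae hf u, mulOp_ae hg u,
    Lp.coeFn_sub (mulOp f hf u) (mulOp g hg u)] with x h1 h2 h3 h4
  rw [h1, sub_apply, h4, Pi.sub_apply, h2, h3, sub_mul]

/-! ### Weights depending on the first coordinate -/

/-- A smooth bounded nonvanishing function `f` on the line with bounded logarithmic derivative `p`,
whose derivative `p'` is bounded as well. -/
structure Weight where
  f : ℝ → ℂ
  p : ℝ → ℂ
  p' : ℝ → ℂ
  smooth : ContDiff ℝ ∞ f
  ne_zero : ∀ t, f t ≠ 0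
  deriv_f : ∀ t, HasDerivAt f (p t * f t) t
  deriv_p : ∀ t, HasDerivAt p (p' t) t
  cont_p' : Continuous p'
  bdd_f : ∃ C : ℝ, ∀ t, ‖f t‖ ≤ C
  bdd_p : ∃ C : ℝ, ∀ t, ‖p t‖ ≤ C
  bdd_p' : ∃ C : ℝ, ∀ t, ‖p' t‖ ≤ C

namespace Weight

/-- `f'' / f`. -/
def q (w : Weight) (t : ℝ) : ℂ := w.p' t + w.p t ^ 2

theorem cont_p (w : Weight) : Continuous w.p :=
  continuous_iff_continuousAt.2 fun t => (w.deriv_p t).continuousAt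

theorem continuous_coord : Continuous (fun x : R3 => x 0) := by fun_prop

theorem bddCont_f (w : Weight) : BddCont (fun x => w.f (x 0)) :=
  ⟨w.smooth.continuous.comp continuous_coord, w.bdd_f.imp fun _ h _ => h _⟩

theorem bddCont_p (w : Weight) : BddCont (fun x => w.p (x 0)) :=
  ⟨w.cont_p.comp continuous_coord, w.bdd_p.imp fun _ h _ => h _⟩

theorem bddCont_q (w : Weight) : BddCont (fun x => w.q (x 0)) := by
  refine ⟨?_, ?_⟩
  · have h1 := w.cont_p
    have h2 := w.cont_p'
    have : Continuous w.q := h2.add (h1.pow 2)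
    exact this.comp continuous_coord
  · obtain ⟨C, hC⟩ := w.bdd_p
    obtain ⟨D, hD⟩ := w.bdd_p'
    refine ⟨D + C ^ 2, fun x => (norm_add_le _ _).trans (add_le_add (hD _) ?_)⟩
    rw [norm_pow]
    exact pow_le_pow_left₀ (norm_nonneg _) (hC _) 2

/-- Multiplication by the weight. -/
def op (w : Weight) : L2 →L[ℂ] L2 := mulOp _ w.bddCont_f

theorem smooth_coord (w : Weight) : ContDiff ℝ ∞ (fun x : R3 => w.f (x 0)) := by
  refine w.smooth.comp ?_
  exact (EuclideanSpace.proj (0 : Fin 3) : R3 →L[ℝ] ℝ).contDiff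

theorem _root_.BandPosition.partialDeriv_comp_coord {F : Type*} [NormedAddCommGroup F]
    [NormedSpace ℝ F] {g : ℝ → F} {g' : F} {x : R3}
    (hg : HasDerivAt g g' (x 0)) (j : Fin 3) :
    partialDeriv j (fun y : R3 => g (y 0)) x = if j = 0 then g' else 0 := by
  have h1 : HasFDerivAt (fun y : R3 => y 0) (EuclideanSpace.proj (0 : Fin 3) : R3 →L[ℝ] ℝ) x :=
    (EuclideanSpace.proj (0 : Fin 3) : R3 →L[ℝ] ℝ).hasFDerivAt
  have h2 : HasFDerivAt (fun y : R3 => g (y 0)) _ x := hg.hasFDerivAt.comp x h1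
  rw [partialDeriv, h2.fderiv]
  by_cases hj : j = 0
  · subst hj
    simp
  · simp [hj, Ne.symm hj]

theorem partialDeriv_f (w : Weight) (j : Fin 3) :
    partialDeriv j (fun y : R3 => w.f (y 0)) = fun x => if j = 0 then w.p (x 0) * w.f (x 0) else 0 := by
  ext x
  exact partialDeriv_comp_coord (w.deriv_f (x 0)) j

theorem sum_partialDeriv_partialDeriv_f (w : Weight) (x : R3) :
    ∑ j, partialDeriv j (partialDeriv j (fun y : R3 => w.f (y 0))) x = w.q (x 0) * w.f (x 0) := by
  have h1 : HasDerivAt (fun t => w.p t * w.f t) _ (x 0) := (w.deriv_p (x 0)).mul (w.deriv_f (x 0))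
  rw [Fin.sum_univ_three]
  rw [partialDeriv_f, partialDeriv_f, partialDeriv_f]
  have h2 : (fun x : R3 => if (0 : Fin 3) = 0 then w.p (x 0) * w.f (x 0) else 0)
      = fun x : R3 => (fun t => w.p t * w.f t) (x 0) := by simp
  rw [h2, partialDeriv_comp_coord h1]
  simp [partialDeriv, q]
  ring

/-- The product of two weights. -/
def mul (v w : Weight) : Weight where
  f t := v.f t * w.f t
  p t := v.p t + w.p t
  p' t := v.p' t + w.p' t
  smooth := v.smooth.mul w.smooth
  ne_zero t := mul_ne_zero (v.ne_zero t) (w.ne_zero t)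
  deriv_f t := by
    convert! (v.deriv_f t).mul (w.deriv_f t) using 1
    ring
  deriv_p t := (v.deriv_p t).add (w.deriv_p t)
  cont_p' := v.cont_p'.add w.cont_p'
  bdd_f := by
    obtain ⟨C, hC⟩ := v.bdd_f
    obtain ⟨D, hD⟩ := w.bdd_f
    refine ⟨C * D, fun t => ?_⟩
    rw [norm_mul]
    exact mul_le_mul (hC t) (hD t) (norm_nonneg _) ((norm_nonneg _).trans (hC t))
  bdd_p := by
    obtain ⟨C, hC⟩ := v.bdd_p
    obtain ⟨D, hD⟩ := w.bdd_p
    exact ⟨C + D, fun t => (norm_add_le _ _).trans (add_le_add (hC t) (hD t))⟩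
  bdd_p' := by
    obtain ⟨C, hC⟩ := v.bdd_p'
    obtain ⟨D, hD⟩ := w.bdd_p'
    exact ⟨C + D, fun t => (norm_add_le _ _).trans (add_le_add (hC t) (hD t))⟩

theorem op_mul (v w : Weight) : (v.mul w).op = v.op * w.op := mulOp_mul v.bddCont_f w.bddCont_f

theorem op_injective (w : Weight) : Function.Injective w.op :=
  mulOp_injective _ fun _ => w.ne_zero _

/-- The trivial weight. -/
def one : Weight where
  f _ := 1
  p _ := 0
  p' _ := 0
  smooth := contDiff_const
  ne_zero _ := one_ne_zero
  deriv_f t := by simpa using hasDerivAt_const t (1 : ℂ)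
  deriv_p t := hasDerivAt_const t (0 : ℂ)
  cont_p' := continuous_const
  bdd_f := ⟨1, by simp⟩
  bdd_p := ⟨0, by simp⟩
  bdd_p' := ⟨0, by simp⟩

/-- The first order perturbation `f⁻¹ H f - H` on test functions. -/
def pert (w : Weight) (φ : TestFun) : L2 :=
  (-2 : ℂ) • mulOp _ w.bddCont_p (testToL2 (testDeriv 0 φ)) - mulOp _ w.bddCont_q (testToL2 φ)

theorem pert_ae (w : Weight) (φ : TestFun) : (w.pert φ : R3 → ℂ) =ᵐ[volume]
    fun x => -2 * (w.p (x 0) * partialDeriv 0 φ.1 x) - w.q (x 0) * φ.1 x := by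
  rw [pert]
  filter_upwards [Lp.coeFn_sub ((-2 : ℂ) • mulOp _ w.bddCont_p (testToL2 (testDeriv 0 φ)))
    (mulOp _ w.bddCont_q (testToL2 φ)), Lp.coeFn_smul (-2 : ℂ)
    (mulOp _ w.bddCont_p (testToL2 (testDeriv 0 φ))), mulOp_ae w.bddCont_q (testToL2 φ),
    mulOp_ae w.bddCont_p (testToL2 (testDeriv 0 φ)), testToL2_ae φ, testToL2_ae (testDeriv 0 φ)]
    with x h1 h2 h3 h4 h5 h6
  rw [h1, Pi.sub_apply, h2, Pi.smul_apply, h3, h4, h5, h6]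
  simp

/-- The Leibniz rule for Δ(fφ), with f' = pf and f'' = qf, while multiplication by V commutes with
f. -/
theorem testHam_testMul {V : R3 → ℝ} (hV : IsAdmissible V) (w : Weight) (φ : TestFun) :
    testHam hV (testMul _ w.smooth_coord φ) = w.op (testHam hV φ + w.pert φ) := by
  refine Lp.ext ?_
  have h0 : (testHam hV φ + w.pert φ : L2) =ᵐ[volume] _ := Lp.coeFn_add _ _
  filter_upwards [testHam_ae hV (testMul _ w.smooth_coord φ), mulOp_ae w.bddCont_f
    (testHam hV φ + w.pert φ), h0, testHam_ae hV φ, w.pert_ae φ] with x h1 h2 h3 h4 h5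
  rw [h1, op, h2, h3, Pi.add_apply, h4, h5, schrodingerExpr, schrodingerExpr, ← coe_testLap,
    ← coe_testLap, testLap_testMul, sum_partialDeriv_partialDeriv_f, Fin.sum_univ_three]
  simp only [partialDeriv_f, coe_testMul, Pi.mul_apply]
  simp
  ring

end Weight

/-! ### Conjugation of resolvents and of the spectral projection -/

/-- The data of the theorem, with a real point `x₀` of the resolvent set above `σ₀`. -/
structure Setting where
  V : R3 → ℝ
  hV : IsAdmissible V
  σ₀ : Set ℝ
  Eplus : ℝ
  hE : 0 < Eplus
  hσ : ∀ e ∈ σ₀, e ≤ -Eplus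
  x₀ : ℝ
  hx₀ : (x₀ : ℂ) ∉ spec (hamiltonian V)
  Γ : EnclosingContour (spec (hamiltonian V)) (Complex.ofReal '' σ₀)

namespace Setting

variable (𝒮 : Setting)

/-- The resolvent of the Hamiltonian. -/
def R (z : ℂ) : L2 →L[ℂ] L2 := resolventOp (hamiltonian 𝒮.V) z

/-- The spectral projection. -/
def P : L2 →L[ℂ] L2 := rieszProjection (hamiltonian 𝒮.V) 𝒮.Γ

/-- The resolvent at the base point. -/
def R₀ : L2 →L[ℂ] L2 := 𝒮.R 𝒮.x₀

theorem R_test {z : ℂ} (hz : z ∉ spec (hamiltonian 𝒮.V)) (φ : TestFun) :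
    𝒮.R z (testHamSub 𝒮.hV z φ) = testToL2 φ := resolventOp_testHamSub 𝒮.hV hz φ

theorem dense_test : DenseRange (testHamSub 𝒮.hV 𝒮.x₀) := denseRange_testHamSub 𝒮.hV 𝒮.hx₀

theorem exists_gradNormSq_le : ∃ C : ℝ, 0 ≤ C ∧ ∀ φ,
    gradNormSq φ ≤ C ^ 2 * ‖testHamSub 𝒮.hV 𝒮.x₀ φ‖ ^ 2 := by
  obtain ⟨C, hC0, hC⟩ := 𝒮.hV.exists_gradNormSq_le
  set r := ‖𝒮.R₀‖
  refine ⟨Real.sqrt (C * (r ^ 2 + (1 + |𝒮.x₀| * r) ^ 2)), Real.sqrt_nonneg _, fun φ => ?_⟩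
  rw [Real.sq_sqrt (by positivity)]
  have h1 : ‖testToL2 φ‖ ≤ r * ‖testHamSub 𝒮.hV 𝒮.x₀ φ‖ := by
    rw [← 𝒮.R_test 𝒮.hx₀ φ]
    exact 𝒮.R₀.le_opNorm _
  have h2 : ‖testHam 𝒮.hV φ‖ ≤ (1 + |𝒮.x₀| * r) * ‖testHamSub 𝒮.hV 𝒮.x₀ φ‖ := by
    have e : testHam 𝒮.hV φ = testHamSub 𝒮.hV 𝒮.x₀ φ + (𝒮.x₀ : ℂ) • testToL2 φ := by
      rw [testHamSub_apply, sub_add_cancel]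
    rw [e]
    refine (norm_add_le _ _).trans ?_
    rw [norm_smul, Complex.norm_real, Real.norm_eq_abs, add_mul, one_mul, mul_assoc]
    gcongr
  refine (hC φ).trans ?_
  rw [mul_assoc, add_mul, ← mul_pow, ← mul_pow]
  gcongr

/-- The bounded operator `∂₁ (H - x₀)⁻¹`. -/
def D : L2 →L[ℂ] L2 := (testToL2 ∘ₗ testDeriv 0).extendOfNorm (testHamSub 𝒮.hV 𝒮.x₀)

theorem D_test (φ : TestFun) :
    𝒮.D (testHamSub 𝒮.hV 𝒮.x₀ φ) = testToL2 (testDeriv 0 φ) := by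
  refine LinearMap.extendOfNorm_eq 𝒮.dense_test ?_ φ
  obtain ⟨C, hC0, hC⟩ := 𝒮.exists_gradNormSq_le
  refine ⟨C, fun φ => ?_⟩
  refine abs_le_of_sq_le_sq' ?_ (by positivity) |>.2
  rw [mul_pow]
  refine le_trans ?_ (hC φ)
  exact Finset.single_le_sum (f := fun j => ‖testToL2 (testDeriv j φ)‖ ^ 2)
    (fun _ _ => by positivity) (Finset.mem_univ 0)

/-- The relative perturbation `(f⁻¹ H f - H) (H - z)⁻¹`. -/
def K (w : Weight) (z : ℂ) : L2 →L[ℂ] L2 :=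
  ((-2 : ℂ) • (mulOp _ w.bddCont_p * 𝒮.D) - mulOp _ w.bddCont_q * 𝒮.R₀)
    * (1 + (z - 𝒮.x₀) • 𝒮.R z)

/-- The factor 1 + (z − x₀)(H − z)⁻¹ is (H − x₀)(H − z)⁻¹. The derivative is thus needed only at the
base point x₀, and `K` is visibly continuous in z. -/
theorem K_test (w : Weight) {z : ℂ} (hz : z ∉ spec (hamiltonian 𝒮.V)) (φ : TestFun) :
    𝒮.K w z (testHamSub 𝒮.hV z φ) = w.pert φ := by
  have h1 : (1 + (z - 𝒮.x₀) • 𝒮.R z) (testHamSub 𝒮.hV z φ) = testHamSub 𝒮.hV 𝒮.x₀ φ := by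
    rw [add_apply, smul_apply, 𝒮.R_test hz, testHamSub_apply, testHamSub_apply, sub_smul]
    simp
  rw [K, mul_apply_eq_comp, h1, sub_apply, smul_apply, mul_apply_eq_comp, mul_apply_eq_comp,
    𝒮.D_test, R₀, 𝒮.R_test 𝒮.hx₀]
  rfl

theorem norm_K_le (w : Weight) {z : ℂ} (hz : z ∉ spec (hamiltonian 𝒮.V)) {θ : ℝ} (hθ : 0 ≤ θ)
    (h : ∀ φ, ‖w.pert φ‖ ≤ θ * ‖testHamSub 𝒮.hV z φ‖) : ‖𝒮.K w z‖ ≤ θ := by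
  refine ContinuousLinearMap.opNorm_le_bound _ hθ fun f => ?_
  refine (denseRange_testHamSub 𝒮.hV hz).induction_on (p := fun f => ‖𝒮.K w z f‖ ≤ θ * ‖f‖) f
    (isClosed_le (by fun_prop) (by fun_prop)) fun φ => ?_
  rw [𝒮.K_test w hz]
  exact h φ

theorem continuousOn_R : ContinuousOn 𝒮.R 𝒮.Γ.trace :=
  continuousOn_resolventOp.mono 𝒮.Γ.trace_subset

theorem continuousOn_K (w : Weight) : ContinuousOn (𝒮.K w) 𝒮.Γ.trace := by
  have h := 𝒮.continuousOn_R
  unfold K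
  exact continuousOn_const.mul (continuousOn_const.add
    ((continuousOn_id.sub continuousOn_const).smul h))

/-- The relative perturbation is bounded by `θ` on the contour. -/
def RelBound (w : Weight) (θ : ℝ) : Prop := ∀ z ∈ 𝒮.Γ.trace, ‖𝒮.K w z‖ ≤ θ

variable {𝒮}

theorem RelBound.isUnit {w : Weight} {θ : ℝ} (h : 𝒮.RelBound w θ) (hθ : θ < 1) {z : ℂ}
    (hz : z ∈ 𝒮.Γ.trace) : IsUnit (1 + 𝒮.K w z) := by
  rw [← sub_neg_eq_add]
  exact isUnit_one_sub_of_norm_lt_one (by rw [norm_neg]; exact (h z hz).trans_lt hθ)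

/-- Read off from (1 + A)⁻¹ = 1 − A(1 + A)⁻¹. -/
theorem norm_inverse_one_add_le {E : Type*} [NormedAddCommGroup E] [NormedSpace ℂ E]
    {A : E →L[ℂ] E} {θ : ℝ} (hA : ‖A‖ ≤ θ) (hθ : θ < 1) (hu : IsUnit (1 + A)) :
    ‖Ring.inverse (1 + A)‖ ≤ (1 - θ)⁻¹ := by
  have h1 : Ring.inverse (1 + A) = 1 - A * Ring.inverse (1 + A) := by
    have := Ring.mul_inverse_cancel _ hu
    rw [add_mul, one_mul] at this
    exact eq_sub_of_add_eq this
  have h2 : ‖Ring.inverse (1 + A)‖ ≤ 1 + θ * ‖Ring.inverse (1 + A)‖ := by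
    nth_rw 1 [h1]
    refine (norm_sub_le _ _).trans (add_le_add ContinuousLinearMap.norm_id_le ?_)
    exact (norm_mul_le _ _).trans (mul_le_mul_of_nonneg_right hA (norm_nonneg _))
  rw [← one_div, le_div_iff₀ (by linarith)]
  linarith

variable (𝒮)

/-- The conjugated resolvent `f⁻¹ (H - z)⁻¹ f`. -/
def S (w : Weight) (z : ℂ) : L2 →L[ℂ] L2 := 𝒮.R z * Ring.inverse (1 + 𝒮.K w z)

/-- The conjugated projection `f⁻¹ P f`. -/
def proj (w : Weight) : L2 →L[ℂ] L2 := (Complex.I / (2 * Real.pi)) • 𝒮.Γ.integral (𝒮.S w)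

variable {𝒮}

theorem RelBound.continuousOn_S {w : Weight} {θ : ℝ} (h : 𝒮.RelBound w θ) (hθ : θ < 1) :
    ContinuousOn (𝒮.S w) 𝒮.Γ.trace := by
  refine 𝒮.continuousOn_R.mul fun z hz => ?_
  obtain ⟨v, hv⟩ := h.isUnit hθ hz
  have h1 : ContinuousAt Ring.inverse (1 + 𝒮.K w z) := by
    rw [← hv]
    exact NormedRing.inverse_continuousAt v
  exact ContinuousAt.comp_continuousWithinAt (f := fun z => 1 + 𝒮.K w z) h1
    (continuousWithinAt_const.add (𝒮.continuousOn_K w z hz))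

/-- On test functions (H − z)f = f(1 + K(z))(H − z), so (H − z)⁻¹f(1 + K(z)) = f(H − z)⁻¹ on a dense
set. Stated with f on both right and left factors, the identity never needs the unbounded f⁻¹. -/
theorem RelBound.R_mul_op {w : Weight} {θ : ℝ} (h : 𝒮.RelBound w θ) (hθ : θ < 1) {z : ℂ}
    (hz : z ∈ 𝒮.Γ.trace) : 𝒮.R z * w.op = w.op * 𝒮.S w z := by
  have hz' := 𝒮.Γ.trace_subset hz
  have h1 : 𝒮.R z * w.op * (1 + 𝒮.K w z) = w.op * 𝒮.R z := by
    ext1 f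
    refine (denseRange_testHamSub 𝒮.hV hz').induction_on
      (p := fun f => (𝒮.R z * w.op * (1 + 𝒮.K w z)) f = (w.op * 𝒮.R z) f) f
      (isClosed_eq (by fun_prop) (by fun_prop)) fun φ => ?_
    have h2 : (1 + 𝒮.K w z) (testHamSub 𝒮.hV z φ)
        = testHam 𝒮.hV φ + w.pert φ - z • testToL2 φ := by
      rw [add_apply, 𝒮.K_test w hz', testHamSub_apply]
      simp
      abel
    have h3 : w.op (testToL2 φ) = testToL2 (testMul _ w.smooth_coord φ) :=
      mulOp_testToL2 w.bddCont_f w.smooth_coord φ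
    rw [mul_apply_eq_comp, mul_apply_eq_comp, h2, map_sub, map_smul,
      ← w.testHam_testMul, h3, mul_apply_eq_comp, 𝒮.R_test hz', h3, ← testHamSub_apply,
      𝒮.R_test hz']
  rw [S, ← mul_assoc, ← h1, mul_assoc, Ring.mul_inverse_cancel _ (h.isUnit hθ hz), mul_one]

theorem RelBound.P_mul_op {w : Weight} {θ : ℝ} (h : 𝒮.RelBound w θ) (hθ : θ < 1) :
    𝒮.P * w.op = w.op * 𝒮.proj w := by
  have e1 := 𝒮.Γ.integral_clm ((ContinuousLinearMap.mul ℂ (L2 →L[ℂ] L2)).flip w.op)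
    𝒮.continuousOn_R
  have e2 := 𝒮.Γ.integral_clm (ContinuousLinearMap.mul ℂ (L2 →L[ℂ] L2) w.op) (h.continuousOn_S hθ)
  simp only [ContinuousLinearMap.flip_apply, ContinuousLinearMap.mul_apply'] at e1 e2
  change ((Complex.I / (2 * Real.pi)) • 𝒮.Γ.integral 𝒮.R) * w.op = _
  rw [proj, smul_mul_assoc, mul_smul_comm, e1, e2]
  congr 1
  exact 𝒮.Γ.integral_congr fun z hz => h.R_mul_op hθ hz

variable (𝒮)

theorem K_one (z : ℂ) : 𝒮.K Weight.one z = 0 := by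
  have h1 : mulOp _ Weight.one.bddCont_p = 0 := by
    ext1 u
    refine Lp.ext ?_
    filter_upwards [mulOp_ae Weight.one.bddCont_p u, Lp.coeFn_zero ℂ 2 (volume : Measure R3)]
      with x hx hx0
    rw [hx]
    simp [Weight.one]
  have h2 : mulOp _ Weight.one.bddCont_q = 0 := by
    ext1 u
    refine Lp.ext ?_
    filter_upwards [mulOp_ae Weight.one.bddCont_q u, Lp.coeFn_zero ℂ 2 (volume : Measure R3)]
      with x hx hx0
    rw [hx]
    simp [Weight.one, Weight.q]
  rw [K, h1, h2]
  simp

theorem relBound_one {θ : ℝ} (hθ : 0 ≤ θ) : 𝒮.RelBound Weight.one θ := fun z _ => by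
  rw [𝒮.K_one, norm_zero]
  exact hθ

theorem proj_one : 𝒮.proj Weight.one = 𝒮.P := by
  rw [proj, P, rieszProjection]
  congr 1
  refine 𝒮.Γ.integral_congr fun z _ => ?_
  rw [S, K_one, add_zero, Ring.inverse_one, mul_one]
  rfl

theorem exists_norm_R_le : ∃ M : ℝ, 0 ≤ M ∧ ∀ z ∈ 𝒮.Γ.trace, ‖𝒮.R z‖ ≤ M := by
  obtain ⟨M, hM⟩ := 𝒮.Γ.isCompact_trace.exists_bound_of_continuousOn 𝒮.continuousOn_R
  exact ⟨max M 0, le_max_right _ _, fun z hz => (hM z hz).trans (le_max_left _ _)⟩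

/-- `K` is linear in (p, q), composed with operators independent of the weight; its last factor is
bounded on the compact contour. -/
theorem exists_norm_K_sub_le : ∃ C : ℝ, 0 ≤ C ∧ ∀ (v w : Weight) (ε : ℝ),
    (∀ t, ‖v.p t - w.p t‖ ≤ ε) → (∀ t, ‖v.q t - w.q t‖ ≤ ε) →
    ∀ z ∈ 𝒮.Γ.trace, ‖𝒮.K v z - 𝒮.K w z‖ ≤ C * ε := by
  have hc : ContinuousOn (fun z : ℂ => (1 + (z - 𝒮.x₀) • 𝒮.R z)) 𝒮.Γ.trace :=
    continuousOn_const.add ((continuousOn_id.sub continuousOn_const).smul 𝒮.continuousOn_R)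
  obtain ⟨M, hM⟩ := 𝒮.Γ.isCompact_trace.exists_bound_of_continuousOn hc
  refine ⟨(2 * ‖𝒮.D‖ + ‖𝒮.R₀‖) * max M 0, by positivity, fun v w ε hp hq z hz => ?_⟩
  have hε : 0 ≤ ε := (norm_nonneg _).trans (hp 0)
  have bp : BddCont (fun x : R3 => v.p (x 0) - w.p (x 0)) :=
    ⟨v.bddCont_p.cont.sub w.bddCont_p.cont, ε, fun x => hp _⟩
  have bq : BddCont (fun x : R3 => v.q (x 0) - w.q (x 0)) :=
    ⟨v.bddCont_q.cont.sub w.bddCont_q.cont, ε, fun x => hq _⟩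
  have e : 𝒮.K v z - 𝒮.K w z = ((-2 : ℂ) • (mulOp _ bp * 𝒮.D) - mulOp _ bq * 𝒮.R₀)
      * (1 + (z - 𝒮.x₀) • 𝒮.R z) := by
    rw [mulOp_sub v.bddCont_p w.bddCont_p bp, mulOp_sub v.bddCont_q w.bddCont_q bq, K, K,
      ← sub_mul, sub_mul _ _ 𝒮.D, sub_mul _ _ 𝒮.R₀, smul_sub]
    congr 1
    abel
  rw [e]
  have n1 : ‖mulOp _ bp‖ ≤ ε := norm_mulOp_le bp fun x => hp _
  have n2 : ‖mulOp _ bq‖ ≤ ε := norm_mulOp_le bq fun x => hq _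
  have n3 : ‖(-2 : ℂ) • (mulOp _ bp * 𝒮.D) - mulOp _ bq * 𝒮.R₀‖
      ≤ 2 * (ε * ‖𝒮.D‖) + ε * ‖𝒮.R₀‖ := by
    refine (norm_sub_le _ _).trans (add_le_add ?_ ?_)
    · rw [norm_smul]
      simp only [norm_neg, Complex.norm_ofNat]
      gcongr
      exact (norm_mul_le _ _).trans (by gcongr)
    · exact (norm_mul_le _ _).trans (by gcongr)
  calc _ ≤ (2 * (ε * ‖𝒮.D‖) + ε * ‖𝒮.R₀‖) * max M 0 :=
        (norm_mul_le _ _).trans (mul_le_mul n3 ((hM z hz).trans (le_max_left _ _))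
          (norm_nonneg _) (by positivity))
    _ = _ := by ring

theorem exists_norm_proj_sub_le : ∃ C : ℝ, 0 ≤ C ∧ ∀ (v w : Weight) (θ δ : ℝ), θ < 1 → 0 ≤ δ →
    𝒮.RelBound v θ → 𝒮.RelBound w θ → (∀ z ∈ 𝒮.Γ.trace, ‖𝒮.K v z - 𝒮.K w z‖ ≤ δ) →
    ‖𝒮.proj v - 𝒮.proj w‖ ≤ C * (((1 - θ)⁻¹) ^ 2 * δ) := by
  obtain ⟨ℓ, hℓ0, hℓ⟩ := 𝒮.Γ.exists_norm_integral_le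
  obtain ⟨M, hM0, hM⟩ := 𝒮.exists_norm_R_le
  set κ : ℂ := Complex.I / (2 * Real.pi)
  refine ⟨‖κ‖ * (ℓ * M), by positivity, fun v w θ δ hθ hδ hv hw h => ?_⟩
  have e : 𝒮.proj v - 𝒮.proj w = κ • 𝒮.Γ.integral (fun z => 𝒮.S v z - 𝒮.S w z) := by
    rw [𝒮.Γ.integral_sub (hv.continuousOn_S hθ) (hw.continuousOn_S hθ), smul_sub]
    rfl
  have hθ' : 0 ≤ (1 - θ)⁻¹ := inv_nonneg.2 (by linarith)
  have h1 : ∀ z ∈ 𝒮.Γ.trace, ‖𝒮.S v z - 𝒮.S w z‖ ≤ M * (((1 - θ)⁻¹) ^ 2 * δ) := by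
    intro z hz
    have hv1 := hv.isUnit hθ hz
    have hw1 := hw.isUnit hθ hz
    -- The second resolvent identity, in the form B⁻¹ − A⁻¹ = B⁻¹(A − B)A⁻¹ with B = 1 + K(v) and A
    -- = 1 + K(w).
    have e2 : 𝒮.S v z - 𝒮.S w z = 𝒮.R z * (Ring.inverse (1 + 𝒮.K v z) *
        (𝒮.K w z - 𝒮.K v z) * Ring.inverse (1 + 𝒮.K w z)) := by
      have a1 := Ring.inverse_mul_cancel _ hv1
      have a2 := Ring.mul_inverse_cancel _ hw1
      rw [S, S, ← mul_sub]
      congr 1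
      have : 𝒮.K w z - 𝒮.K v z = (1 + 𝒮.K w z) - (1 + 𝒮.K v z) := by abel
      rw [this, mul_sub, sub_mul, mul_assoc, a2, a1, mul_one, one_mul]
    rw [e2]
    have b1 := norm_inverse_one_add_le (hv z hz) hθ hv1
    have b2 := norm_inverse_one_add_le (hw z hz) hθ hw1
    have b3 : ‖𝒮.K w z - 𝒮.K v z‖ ≤ δ := by rw [norm_sub_rev]; exact h z hz
    refine (norm_mul_le _ _).trans (mul_le_mul (hM z hz) ?_ (norm_nonneg _) hM0)
    calc _ ≤ (1 - θ)⁻¹ * δ * (1 - θ)⁻¹ := by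
          refine (norm_mul_le _ _).trans (mul_le_mul ((norm_mul_le _ _).trans
            (mul_le_mul b1 b3 (norm_nonneg _) hθ')) b2 (norm_nonneg _) (by positivity))
      _ = _ := by ring
  rw [e, norm_smul, mul_assoc, mul_assoc]
  gcongr
  exact hℓ _ _ h1 (by positivity)

end Setting

/-! ### The exponential weights -/

/-- `√((t - a)² + 1)`. -/
def jap (a t : ℝ) : ℝ := Real.sqrt ((t - a) ^ 2 + 1)

theorem jap_pos (a t : ℝ) : 0 < jap a t := Real.sqrt_pos.2 (by positivity)

theorem jap_sq (a t : ℝ) : jap a t ^ 2 = (t - a) ^ 2 + 1 := Real.sq_sqrt (by positivity)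

theorem one_le_jap (a t : ℝ) : 1 ≤ jap a t := by
  rw [jap, Real.one_le_sqrt]
  nlinarith [sq_nonneg (t - a)]

theorem abs_sub_le_jap (a t : ℝ) : |t - a| ≤ jap a t := by
  rw [← Real.sqrt_sq_eq_abs]
  exact Real.sqrt_le_sqrt (by linarith)

theorem hasDerivAt_jap (a t : ℝ) : HasDerivAt (jap a) ((t - a) / jap a t) t := by
  have h := ((((hasDerivAt_id t).sub_const a).pow 2).add_const (1 : ℝ)).sqrt
    (by
      have : (0 : ℝ) < (t - a) ^ 2 + 1 := by positivity
      exact this.ne')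
  convert! h using 1
  simp only [id, jap, Nat.cast_ofNat]
  have := (jap_pos a t).ne'
  rw [jap] at this
  simp
  field_simp

theorem hasDerivAt_deriv_jap (a t : ℝ) :
    HasDerivAt (fun t => (t - a) / jap a t) ((jap a t ^ 3)⁻¹) t := by
  have h0 := (jap_pos a t).ne'
  have h := ((hasDerivAt_id t).sub_const a).div (hasDerivAt_jap a t) h0
  convert! h using 1
  simp only [id]
  have h2 := jap_sq a t
  field_simp
  linear_combination -h2

theorem contDiff_jap (a : ℝ) : ContDiff ℝ ∞ (jap a) :=
  ContDiff.sqrt (by fun_prop) fun t => by positivity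

theorem abs_deriv_jap_le (a t : ℝ) : |(t - a) / jap a t| ≤ 1 := by
  rw [abs_div, abs_of_pos (jap_pos a t), div_le_one (jap_pos a t)]
  exact abs_sub_le_jap a t

theorem abs_deriv2_jap_le (a t : ℝ) : |(jap a t ^ 3)⁻¹| ≤ 1 := by
  have h := one_le_pow₀ (one_le_jap a t) (n := 3)
  rw [abs_of_pos (by have := jap_pos a t; positivity)]
  exact inv_le_one_of_one_le₀ h

/-- The weight `exp (-α √((t - a)² + 1))`. -/
def expWeight (α a : ℝ) (hα : 0 ≤ α) : Weight where
  f t := (Real.exp (-α * jap a t) : ℝ)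
  p t := ((-α * ((t - a) / jap a t) : ℝ) : ℂ)
  p' t := ((-α * (jap a t ^ 3)⁻¹ : ℝ) : ℂ)
  smooth := Complex.ofRealCLM.contDiff.comp
    (Real.contDiff_exp.comp (contDiff_const.mul (contDiff_jap a)))
  ne_zero t := by exact_mod_cast (Real.exp_pos _).ne'
  deriv_f t := by
    have h := (((hasDerivAt_jap a t).const_mul (-α)).exp).ofReal_comp
    convert! h using 1
    push_cast
    ring
  deriv_p t := ((hasDerivAt_deriv_jap a t).const_mul (-α)).ofReal_comp
  cont_p' := by
    have h := (contDiff_jap a).continuous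
    have h0 : ∀ t, jap a t ^ 3 ≠ 0 := fun t => by have := jap_pos a t; positivity
    fun_prop (disch := exact h0 _)
  bdd_f := ⟨1, fun t => by
    rw [Complex.norm_real, Real.norm_eq_abs, abs_of_pos (Real.exp_pos _), Real.exp_le_one_iff]
    have := jap_pos a t
    nlinarith⟩
  bdd_p := ⟨α, fun t => by
    rw [Complex.norm_real, Real.norm_eq_abs, abs_mul, abs_neg, abs_of_nonneg hα]
    exact mul_le_of_le_one_right hα (abs_deriv_jap_le a t)⟩
  bdd_p' := ⟨α, fun t => by
    rw [Complex.norm_real, Real.norm_eq_abs, abs_mul, abs_neg, abs_of_nonneg hα]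
    exact mul_le_of_le_one_right hα (abs_deriv2_jap_le a t)⟩

theorem norm_expWeight_p_le (α a : ℝ) (hα : 0 ≤ α) (t : ℝ) : ‖(expWeight α a hα).p t‖ ≤ α := by
  simp only [expWeight]
  rw [Complex.norm_real, Real.norm_eq_abs, abs_mul, abs_neg, abs_of_nonneg hα]
  exact mul_le_of_le_one_right hα (abs_deriv_jap_le a t)

theorem norm_expWeight_p'_le (α a : ℝ) (hα : 0 ≤ α) (t : ℝ) : ‖(expWeight α a hα).p' t‖ ≤ α := by
  simp only [expWeight]
  rw [Complex.norm_real, Real.norm_eq_abs, abs_mul, abs_neg, abs_of_nonneg hα]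
  exact mul_le_of_le_one_right hα (abs_deriv2_jap_le a t)

/-- For f = exp(−αg) one has p = −αg' and q = −αg'' + α²g'², and g depends on x₁ only. Hence
admissibility of α is precisely a relative bound for `expWeight`, uniform in a. -/
theorem conjugationTerm_parWeight (α a : ℝ) (hα : 0 ≤ α) (φ : TestFun) :
    ((expWeight α a hα).pert φ : R3 → ℂ) =ᵐ[volume] conjugationTerm α (parWeight a) φ := by
  filter_upwards [(expWeight α a hα).pert_ae φ] with x hx
  rw [hx, conjugationTerm]
  have h1 : ∀ j, partialDeriv j (parWeight a)
      = fun y : R3 => if j = 0 then (y 0 - a) / jap a (y 0) else 0 := fun j => by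
    ext y
    exact partialDeriv_comp_coord (hasDerivAt_jap a (y 0)) j
  have hd : HasDerivAt (fun t : ℝ => (((t - a) / jap a t : ℝ) : ℂ))
      (((jap a (x 0) ^ 3)⁻¹ : ℝ) : ℂ) (x 0) := (hasDerivAt_deriv_jap a (x 0)).ofReal_comp
  have h2 : partialDeriv 0 (fun y : R3 => (((y 0 - a) / jap a (y 0) : ℝ) : ℂ) * φ.1 y) x
      = (((jap a (x 0) ^ 3)⁻¹ : ℝ) : ℂ) * φ.1 x
        + (((x 0 - a) / jap a (x 0) : ℝ) : ℂ) * partialDeriv 0 φ.1 x := by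
    have hs : Differentiable ℝ (fun y : R3 => (((y 0 - a) / jap a (y 0) : ℝ) : ℂ)) := fun y =>
      DifferentiableAt.comp (g := fun t : ℝ => (((t - a) / jap a t : ℝ) : ℂ))
        (f := fun y : R3 => y 0) y ((hasDerivAt_deriv_jap a (y 0)).ofReal_comp.differentiableAt)
        (by fun_prop)
    have := partialDeriv_mul hs φ.differentiable 0 x
    rw [partialDeriv_comp_coord hd] at this
    exact this
  rw [Fin.sum_univ_three]
  simp only [h1]
  simp only [if_true, h2]
  simp [partialDeriv, expWeight, Weight.q]
  ring

/-! ### The shifted position weights -/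

/-- `s + i σ exp (-s²)`. -/
def shiftFun (σ s : ℝ) : ℂ := s + Complex.I * ((σ * Real.exp (-s ^ 2) : ℝ) : ℂ)

/-- The derivative of `shiftFun`. -/
def shiftFun' (σ s : ℝ) : ℂ := 1 + Complex.I * ((σ * (-2 * s * Real.exp (-s ^ 2)) : ℝ) : ℂ)

/-- The second derivative of `shiftFun`. -/
def shiftFun'' (σ s : ℝ) : ℂ :=
  Complex.I * ((σ * ((-2 + 4 * s ^ 2) * Real.exp (-s ^ 2)) : ℝ) : ℂ)

theorem hasDerivAt_exp_neg_sq (s : ℝ) :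
    HasDerivAt (fun s : ℝ => Real.exp (-s ^ 2)) (-2 * s * Real.exp (-s ^ 2)) s := by
  have h : HasDerivAt (fun s : ℝ => -s ^ 2) (-2 * s) s := by
    have := (hasDerivAt_pow 2 s).neg
    convert! this using 1
    push_cast
    ring
  convert! h.exp using 1
  ring

theorem hasDerivAt_shiftFun (σ s : ℝ) : HasDerivAt (shiftFun σ) (shiftFun' σ s) s := by
  have h1 := (hasDerivAt_exp_neg_sq s).const_mul σ
  exact (hasDerivAt_id s).ofReal_comp.add (h1.ofReal_comp.const_mul Complex.I)

theorem hasDerivAt_shiftFun' (σ s : ℝ) : HasDerivAt (shiftFun' σ) (shiftFun'' σ s) s := by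
  have h1 : HasDerivAt (fun s : ℝ => σ * (-2 * s * Real.exp (-s ^ 2)))
      (σ * ((-2 + 4 * s ^ 2) * Real.exp (-s ^ 2))) s := by
    have := ((((hasDerivAt_id s).const_mul (-2)).mul (hasDerivAt_exp_neg_sq s)).const_mul σ)
    convert! this using 1
    simp only [id]
    ring
  exact (h1.ofReal_comp.const_mul Complex.I).const_add 1

theorem contDiff_shiftFun (σ : ℝ) : ContDiff ℝ ∞ (shiftFun σ) := by
  have h1 : ContDiff ℝ ∞ (fun s : ℝ => σ * Real.exp (-s ^ 2)) := by fun_prop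
  exact Complex.ofRealCLM.contDiff.add (contDiff_const.mul (Complex.ofRealCLM.contDiff.comp h1))

theorem exp_neg_sq_le_one (s : ℝ) : Real.exp (-s ^ 2) ≤ 1 :=
  Real.exp_le_one_iff.2 (by nlinarith [sq_nonneg s])

theorem sq_mul_exp_neg_sq_le_one (s : ℝ) : s ^ 2 * Real.exp (-s ^ 2) ≤ 1 := by
  rw [Real.exp_neg, ← div_eq_mul_inv, div_le_one (Real.exp_pos _)]
  linarith [Real.add_one_le_exp (s ^ 2)]

theorem abs_mul_exp_neg_sq_le_one (s : ℝ) : |s| * Real.exp (-s ^ 2) ≤ 1 := by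
  have h1 := sq_mul_exp_neg_sq_le_one s
  have h2 := exp_neg_sq_le_one s
  have h3 := Real.exp_pos (-s ^ 2)
  nlinarith [sq_nonneg (|s| - 1), sq_abs s]

theorem normSq_shiftFun (σ : ℝ) (hσ : σ ^ 2 = 1) (s : ℝ) :
    ‖shiftFun σ s‖ ^ 2 = s ^ 2 + Real.exp (-s ^ 2) ^ 2 := by
  rw [← Complex.normSq_eq_norm_sq, Complex.normSq_apply]
  have h1 : (shiftFun σ s).re = s := by simp only [shiftFun, Complex.add_re, Complex.re_mul_ofReal,
    Complex.I_re, Complex.ofReal_re, zero_mul, add_zero]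
  have h2 : (shiftFun σ s).im = σ * Real.exp (-s ^ 2) := by
    simp only [shiftFun, Complex.add_im, Complex.im_mul_ofReal,
      Complex.I_im, Complex.ofReal_im, one_mul, zero_add]
  rw [h1, h2]
  linear_combination (Real.exp (-s ^ 2)) ^ 2 * hσ

/-- For s² ≥ 1/2 the real part suffices; otherwise exp(−2s²) ≥ 1 − 2s² does. The Gaussian keeps the
regularized position away from zero and still leaves it equal to s up to a rapidly decaying term. -/
theorem half_le_normSq_shiftFun (σ : ℝ) (hσ : σ ^ 2 = 1) (s : ℝ) : 1 / 2 ≤ ‖shiftFun σ s‖ ^ 2 := by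
  rw [normSq_shiftFun σ hσ]
  have h1 : Real.exp (-s ^ 2) ^ 2 = Real.exp (-2 * s ^ 2) := by
    rw [sq, ← Real.exp_add]; ring_nf
  rw [h1]
  have h2 := Real.add_one_le_exp (-2 * s ^ 2)
  have h3 := Real.exp_pos (-2 * s ^ 2)
  rcases le_total (s ^ 2) (1 / 2) with h | h <;> linarith

theorem half_le_norm_shiftFun (σ : ℝ) (hσ : σ ^ 2 = 1) (s : ℝ) : 1 / 2 ≤ ‖shiftFun σ s‖ := by
  have h := half_le_normSq_shiftFun σ hσ s
  nlinarith [norm_nonneg (shiftFun σ s)]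

theorem abs_le_norm_shiftFun (σ : ℝ) (hσ : σ ^ 2 = 1) (s : ℝ) : |s| ≤ ‖shiftFun σ s‖ := by
  have h := normSq_shiftFun σ hσ s
  refine abs_le_of_sq_le_sq ?_ (norm_nonneg _)
  nlinarith [sq_nonneg (Real.exp (-s ^ 2))]

theorem abs_eq_one_of_sq {σ : ℝ} (hσ : σ ^ 2 = 1) : |σ| = 1 := by
  rw [← Real.sqrt_sq_eq_abs, hσ, Real.sqrt_one]

theorem norm_shiftFun'_le (σ : ℝ) (hσ : σ ^ 2 = 1) (s : ℝ) : ‖shiftFun' σ s‖ ≤ 3 := by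
  refine (norm_add_le _ _).trans ?_
  rw [norm_mul, Complex.norm_I, Complex.norm_real, Real.norm_eq_abs, abs_mul, abs_eq_one_of_sq hσ,
    abs_mul, abs_mul, abs_of_pos (Real.exp_pos _)]
  have := abs_mul_exp_neg_sq_le_one s
  simp
  linarith

theorem norm_shiftFun''_le (σ : ℝ) (hσ : σ ^ 2 = 1) (s : ℝ) : ‖shiftFun'' σ s‖ ≤ 6 := by
  rw [shiftFun'', norm_mul, Complex.norm_I, Complex.norm_real, Real.norm_eq_abs, abs_mul,
    abs_eq_one_of_sq hσ, one_mul, one_mul]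
  have h1 := sq_mul_exp_neg_sq_le_one s
  have h2 := exp_neg_sq_le_one s
  have h3 := Real.exp_pos (-s ^ 2)
  have h4 : 0 ≤ s ^ 2 * Real.exp (-s ^ 2) := by positivity
  rw [abs_le]
  constructor <;> nlinarith

/-- The logarithmic derivative of `shiftFun`. -/
def shiftLog (σ s : ℝ) : ℂ := shiftFun' σ s / shiftFun σ s

/-- The derivative of `shiftLog`. -/
def shiftLog' (σ s : ℝ) : ℂ := shiftFun'' σ s / shiftFun σ s - shiftLog σ s ^ 2

theorem shiftFun_ne_zero (σ : ℝ) (hσ : σ ^ 2 = 1) (s : ℝ) : shiftFun σ s ≠ 0 := by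
  have := half_le_norm_shiftFun σ hσ s
  exact norm_pos_iff.1 (by linarith)

theorem hasDerivAt_shiftLog (σ : ℝ) (hσ : σ ^ 2 = 1) (s : ℝ) :
    HasDerivAt (shiftLog σ) (shiftLog' σ s) s := by
  have h0 := shiftFun_ne_zero σ hσ s
  convert! (hasDerivAt_shiftFun' σ s).div (hasDerivAt_shiftFun σ s) h0 using 1
  simp only [shiftLog', shiftLog]
  field_simp

theorem norm_shiftLog_le (σ : ℝ) (hσ : σ ^ 2 = 1) (s : ℝ) : ‖shiftLog σ s‖ ≤ 6 := by
  have h := half_le_norm_shiftFun σ hσ s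
  rw [shiftLog, norm_div, div_le_iff₀ (by linarith)]
  linarith [norm_shiftFun'_le σ hσ s]

theorem norm_shiftLog'_le (σ : ℝ) (hσ : σ ^ 2 = 1) (s : ℝ) : ‖shiftLog' σ s‖ ≤ 48 := by
  have h := half_le_norm_shiftFun σ hσ s
  have h1 : ‖shiftFun'' σ s / shiftFun σ s‖ ≤ 12 := by
    rw [norm_div, div_le_iff₀ (by linarith)]
    linarith [norm_shiftFun''_le σ hσ s]
  have h2 : ‖shiftLog σ s ^ 2‖ ≤ 36 := by
    rw [norm_pow]
    have := norm_shiftLog_le σ hσ s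
    nlinarith [norm_nonneg (shiftLog σ s)]
  exact (norm_sub_le _ _).trans (by linarith)

/-- The weight `1 / (s + i σ exp (-s²))` at `s = (t - a) / b`. -/
def shiftWeight (σ b a : ℝ) (hσ : σ ^ 2 = 1) : Weight where
  f t := (shiftFun σ ((t - a) / b))⁻¹
  p t := -(shiftLog σ ((t - a) / b) / b)
  p' t := -(shiftLog' σ ((t - a) / b) / b / b)
  smooth := ContDiff.inv ((contDiff_shiftFun σ).comp (by fun_prop)) fun t => shiftFun_ne_zero σ hσ _
  ne_zero t := inv_ne_zero (shiftFun_ne_zero σ hσ _)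
  deriv_f t := by
    have h0 := shiftFun_ne_zero σ hσ ((t - a) / b)
    have h1 : HasDerivAt (fun t => (t - a) / b) (1 / b) t :=
      ((hasDerivAt_id t).sub_const a).div_const b
    have h2 : HasDerivAt (fun t => shiftFun σ ((t - a) / b))
        ((1 / b) • shiftFun' σ ((t - a) / b)) t :=
      HasDerivAt.scomp (g₁ := shiftFun σ) t (hasDerivAt_shiftFun σ ((t - a) / b)) h1
    convert! h2.inv h0 using 1
    rw [Complex.real_smul, shiftLog]
    push_cast
    field_simp
  deriv_p t := by
    have h1 : HasDerivAt (fun t => (t - a) / b) (1 / b) t :=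
      ((hasDerivAt_id t).sub_const a).div_const b
    have h2 := (((hasDerivAt_shiftLog σ hσ ((t - a) / b)).scomp t h1).div_const (b : ℂ)).neg
    convert! h2 using 1
    rw [Complex.real_smul]
    push_cast
    ring
  cont_p' := by
    have h0 := shiftFun_ne_zero σ hσ
    have h1 : Continuous (shiftFun σ) := (contDiff_shiftFun σ).continuous
    have h2 : Continuous (shiftFun'' σ) := by unfold shiftFun''; fun_prop
    have h3 : Continuous (shiftLog σ) :=
      continuous_iff_continuousAt.2 fun s => (hasDerivAt_shiftLog σ hσ s).continuousAt
    have h4 : Continuous (shiftLog' σ) := (h2.div h1 h0).sub (h3.pow 2)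
    fun_prop
  bdd_f := ⟨2, fun t => by
    have := half_le_norm_shiftFun σ hσ ((t - a) / b)
    rw [norm_inv]
    exact inv_le_of_inv_le₀ (by norm_num) (by linarith)⟩
  bdd_p := ⟨6 / |b|, fun t => by
    rw [norm_neg, norm_div, Complex.norm_real, Real.norm_eq_abs]
    gcongr
    exact norm_shiftLog_le σ hσ _⟩
  bdd_p' := ⟨48 / |b| / |b|, fun t => by
    rw [norm_neg, norm_div, norm_div, Complex.norm_real, Real.norm_eq_abs]
    gcongr
    exact norm_shiftLog'_le σ hσ _⟩

/-- The constant 48 is needed only for the derivative p'; using it here as well lets one threshold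
on b serve both. -/
theorem norm_shiftWeight_p_le (σ b a : ℝ) (hσ : σ ^ 2 = 1) (hb : 1 ≤ b) (t : ℝ) :
    ‖(shiftWeight σ b a hσ).p t‖ ≤ 48 / b := by
  simp only [shiftWeight]
  rw [norm_neg, norm_div, Complex.norm_real, Real.norm_eq_abs, abs_of_pos (by linarith)]
  gcongr
  exact (norm_shiftLog_le σ hσ _).trans (by norm_num)

theorem norm_shiftWeight_p'_le (σ b a : ℝ) (hσ : σ ^ 2 = 1) (hb : 1 ≤ b) (t : ℝ) :
    ‖(shiftWeight σ b a hσ).p' t‖ ≤ 48 / b := by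
  simp only [shiftWeight]
  rw [norm_neg, norm_div, norm_div, Complex.norm_real, Real.norm_eq_abs, abs_of_pos (by linarith)]
  have h := norm_shiftLog'_le σ hσ ((t - a) / b)
  refine (div_le_self (by positivity) hb).trans ?_
  gcongr

/-! ### Admissible exponents -/

namespace Setting

variable (𝒮 : Setting)

theorem eLpNorm_eq_of_ae {u : L2} {f : R3 → ℂ} (h : (u : R3 → ℂ) =ᵐ[volume] f) :
    eLpNorm f 2 volume = ENNReal.ofReal ‖u‖ := by
  rw [← eLpNorm_congr_ae h, Lp.norm_def, ENNReal.ofReal_toReal (Lp.eLpNorm_ne_top u)]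

theorem testHamSub_ae (z : ℂ) (φ : TestFun) : (testHamSub 𝒮.hV z φ : R3 → ℂ) =ᵐ[volume]
    fun x => schrodingerExpr 𝒮.V φ x - z * φ.1 x := by
  rw [testHamSub_apply]
  filter_upwards [Lp.coeFn_sub (testHam 𝒮.hV φ) (z • testToL2 φ), testHam_ae 𝒮.hV φ,
    Lp.coeFn_smul z (testToL2 φ), testToL2_ae φ] with x h1 h2 h3 h4
  rw [h1, Pi.sub_apply, h2, h3, Pi.smul_apply, h4, smul_eq_mul]

theorem conjugation_bound_iff (α a : ℝ) (hα : 0 ≤ α) (z : ℂ) (b : ℝ≥0) (φ : TestFun) :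
    eLpNorm (conjugationTerm α (parWeight a) φ) 2 volume
      ≤ b * eLpNorm (fun x => schrodingerExpr 𝒮.V φ x - z * φ.1 x) 2 volume
    ↔ ‖(expWeight α a hα).pert φ‖ ≤ b * ‖testHamSub 𝒮.hV z φ‖ := by
  rw [eLpNorm_eq_of_ae (conjugationTerm_parWeight α a hα φ), eLpNorm_eq_of_ae (𝒮.testHamSub_ae z φ),
    ← ENNReal.ofReal_coe_nnreal, ← ENNReal.ofReal_mul (by positivity),
    ENNReal.ofReal_le_ofReal_iff (by positivity)]

theorem relBound_of_isParallelExponent {α : ℝ} (h : IsParallelExponent 𝒮.V 𝒮.Γ.trace α) :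
    ∃ θ : ℝ, θ < 1 ∧ ∀ a, 𝒮.RelBound (expWeight α a h.1.le) θ := by
  obtain ⟨hα, b, hb, h⟩ := h
  refine ⟨b, by exact_mod_cast hb, fun a z hz => ?_⟩
  exact 𝒮.norm_K_le _ (𝒮.Γ.trace_subset hz) b.2 fun φ =>
    (𝒮.conjugation_bound_iff α a hα.le z b φ).1 (h z hz a φ φ.2)

/-- Comparison with the trivial weight, whose perturbation vanishes: for α ≤ 1 both p and q are at
most 2α, and α = 1/(4(C + 1)) makes the relative bound at most 1/2. -/
theorem exists_isParallelExponent : ∃ α, IsParallelExponent 𝒮.V 𝒮.Γ.trace α := by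
  obtain ⟨C, hC0, hC⟩ := 𝒮.exists_norm_K_sub_le
  set α : ℝ := 1 / (4 * (C + 1)) with hα
  have hα0 : 0 < α := by positivity
  have hα1 : α ≤ 1 := by
    rw [hα, div_le_one (by positivity)]
    linarith
  refine ⟨α, hα0, 1 / 2, by norm_num, fun z hz a φ hφ => ?_⟩
  refine (𝒮.conjugation_bound_iff α a hα0.le z (1 / 2) ⟨φ, hφ⟩).2 ?_
  have h1 := hC (expWeight α a hα0.le) Weight.one (2 * α) (fun t => by
      have := norm_expWeight_p_le α a hα0.le t
      simp only [Weight.one, sub_zero]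
      linarith) (fun t => by
      have h1 := norm_expWeight_p_le α a hα0.le t
      have h2 := norm_expWeight_p'_le α a hα0.le t
      simp only [Weight.one, Weight.q]
      rw [sq (0 : ℂ), mul_zero, add_zero, sub_zero]
      refine (norm_add_le _ _).trans ?_
      rw [norm_pow]
      nlinarith [norm_nonneg ((expWeight α a hα0.le).p t)]) z hz
  rw [𝒮.K_one, sub_zero] at h1
  rw [← 𝒮.K_test _ (𝒮.Γ.trace_subset hz)]
  refine (ContinuousLinearMap.le_opNorm _ _).trans ?_
  gcongr
  refine h1.trans ?_
  rw [hα]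
  push_cast
  rw [mul_div_assoc', mul_div_assoc', div_le_div_iff₀ (by positivity) (by norm_num)]
  linarith

/-- Weights with nearby logarithmic derivatives have nearby conjugated projections. -/
theorem exists_relBound_of_close (A θ : ℝ) (hA : 0 ≤ A) (hθ : θ < 1) : ∃ ε > 0, ∀ v w : Weight,
    𝒮.RelBound w θ → (∀ t, ‖w.p t‖ ≤ A) → (∀ t, ‖v.p t - w.p t‖ ≤ ε) →
    (∀ t, ‖v.p' t - w.p' t‖ ≤ ε) →
    𝒮.RelBound v ((1 + θ) / 2) ∧ ‖𝒮.proj v - 𝒮.proj w‖ ≤ 1 / 2 := by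
  obtain ⟨C₁, hC₁0, hC₁⟩ := 𝒮.exists_norm_K_sub_le
  obtain ⟨C₂, hC₂0, hC₂⟩ := 𝒮.exists_norm_proj_sub_le
  set θ' := (1 + θ) / 2 with hθ'
  have hθ1 : θ' < 1 := by rw [hθ']; linarith
  have hi : 0 < (1 - θ')⁻¹ := inv_pos.2 (by linarith)
  set B := C₁ * (2 * A + 2) with hB
  have hB0 : 0 ≤ B := by positivity
  -- The first entry moves the relative bound at most from θ to the midpoint θ' of θ and 1; the
  -- second keeps the conjugated projections within 1/2.
  set δ : ℝ := min ((1 - θ) / 2) (1 / (2 * (C₂ * (1 - θ')⁻¹ ^ 2 + 1))) with hδ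
  have hδ0 : 0 < δ := lt_min (by linarith) (by positivity)
  refine ⟨min 1 (δ / (B + 1)), lt_min one_pos (by positivity), fun v w hw hwp hp hp' => ?_⟩
  set ε := min 1 (δ / (B + 1)) with hε
  have hε0 : 0 < ε := lt_min one_pos (by positivity)
  have hε1 : ε ≤ 1 := min_le_left _ _
  have hεδ : B * ε ≤ δ := by
    have : ε ≤ δ / (B + 1) := min_le_right _ _
    rw [le_div_iff₀ (by positivity)] at this
    nlinarith
  have hq : ∀ t, ‖v.q t - w.q t‖ ≤ (2 * A + 2) * ε := fun t => by
    have e : v.q t - w.q t = (v.p' t - w.p' t) + (v.p t - w.p t) * ((v.p t - w.p t) + 2 * w.p t) := by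
      simp only [Weight.q]; ring
    rw [e]
    refine (norm_add_le _ _).trans ?_
    rw [norm_mul]
    have h1 : ‖(v.p t - w.p t) + 2 * w.p t‖ ≤ 1 + 2 * A := by
      refine (norm_add_le _ _).trans (add_le_add ((hp t).trans hε1) ?_)
      rw [norm_mul]
      simp only [Complex.norm_ofNat]
      linarith [hwp t]
    have := mul_le_mul (hp t) h1 (norm_nonneg _) hε0.le
    linarith [hp' t]
  have hK : ∀ z ∈ 𝒮.Γ.trace, ‖𝒮.K v z - 𝒮.K w z‖ ≤ δ := fun z hz => by
    refine (hC₁ v w ((2 * A + 2) * ε) (fun t => (hp t).trans ?_) hq z hz).trans ?_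
    · nlinarith
    · rw [← mul_assoc]; exact hεδ
  have hv : 𝒮.RelBound v θ' := fun z hz => by
    have h1 := norm_add_le (𝒮.K v z - 𝒮.K w z) (𝒮.K w z)
    rw [sub_add_cancel] at h1
    have h2 : δ ≤ (1 - θ) / 2 := min_le_left _ _
    have := hK z hz
    have := hw z hz
    rw [hθ']
    linarith
  have hw' : 𝒮.RelBound w θ' := fun z hz => (hw z hz).trans (by rw [hθ']; linarith)
  refine ⟨hv, (hC₂ v w θ' δ hθ1 hδ0.le hv hw' hK).trans ?_⟩
  have h2 : δ ≤ 1 / (2 * (C₂ * (1 - θ')⁻¹ ^ 2 + 1)) := min_le_right _ _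
  rw [le_div_iff₀ (by positivity)] at h2
  nlinarith

/-- Logarithmic derivatives add under multiplication, so the shift factor alters p and p' by O(1/b)
whatever w and a are. This uniformity makes the decay constants independent of the eigenvalue. -/
theorem exists_relBound_shiftWeight (A θ : ℝ) (hA : 0 ≤ A) (hθ : θ < 1) : ∃ b₀ : ℝ, 1 ≤ b₀ ∧
    ∀ (w : Weight) (σ b a : ℝ) (hσ : σ ^ 2 = 1), b₀ ≤ b →
    𝒮.RelBound w θ → (∀ t, ‖w.p t‖ ≤ A) →
    𝒮.RelBound (w.mul (shiftWeight σ b a hσ)) ((1 + θ) / 2) ∧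
      ‖𝒮.proj (w.mul (shiftWeight σ b a hσ)) - 𝒮.proj w‖ ≤ 1 / 2 := by
  obtain ⟨ε, hε, h⟩ := 𝒮.exists_relBound_of_close A θ hA hθ
  refine ⟨max 1 (48 / ε), le_max_left _ _, fun w σ b a hσ hb hw hwp => ?_⟩
  have hb1 : 1 ≤ b := (le_max_left _ _).trans hb
  have hb2 : 48 / b ≤ ε := by
    have : 48 / ε ≤ b := (le_max_right _ _).trans hb
    rw [div_le_iff₀ hε] at this
    rw [div_le_iff₀ (by linarith)]
    linarith
  refine h _ _ hw hwp (fun t => ?_) (fun t => ?_)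
  · simp only [Weight.mul, add_sub_cancel_left]
    exact (norm_shiftWeight_p_le σ b a hσ hb1 t).trans hb2
  · simp only [Weight.mul, add_sub_cancel_left]
    exact (norm_shiftWeight_p'_le σ b a hσ hb1 t).trans hb2

end Setting

/-! ### Decay away from the axis -/

/-- If `A ≤ -e P` in the sense of forms while the form of `M A` on `Ran P` is at least
`-κ ‖M P f‖² - C ‖f‖²` with `κ < e`, then `M P` is bounded in terms of `C` and `e - κ`. -/
theorem norm_mul_sq_le_of_form_bounds {E : Type*} [NormedAddCommGroup E] [InnerProductSpace ℂ E]
    [CompleteSpace E] {P A M : E →L[ℂ] E} (hPsa : IsSelfAdjoint P) (hP : IsIdempotentElem P)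
    (hPA : P * A = A) {e κ C : ℝ} (he : 0 ≤ e) (hκ0 : 0 ≤ κ) (hC : 0 ≤ C)
    (hA : ∀ f, (inner ℂ f (A f)).re ≤ -e * ‖P f‖ ^ 2)
    (hM : ∀ f, -κ * ‖(M * P) f‖ ^ 2 - C * ‖P f‖ ^ 2 ≤ (inner ℂ ((M * P) f) (M (A f))).re) :
    ‖M * P‖ ^ 2 * (e - κ) ≤ C := by
  set N := M * P with hN
  set n := ‖N‖ with hn
  rcases (norm_nonneg N).eq_or_lt with h0 | hn0
  · rw [hn, ← h0]
    simpa using hC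
  set F := N.adjoint * N with hF
  have hFn : ‖F‖ = n ^ 2 := by
    rw [hF, sq]
    exact ContinuousLinearMap.norm_adjoint_comp_self N
  have key : ∀ ε : ℝ, 0 < ε → n ^ 2 * (e - κ) ≤ C + (ε * e + Real.sqrt (2 * n ^ 2 * ε) * ‖A‖) := by
    intro ε hε
    -- A near-maximizer g of ‖Ng‖, with the threshold chosen so that its square is at least n² − ε
    -- when it is nonnegative. Replacing g by f = Pg does not change Nf and does not increase the
    -- norm.
    obtain ⟨g, hg1, hg⟩ := N.exists_lt_apply_of_lt_opNorm (r := n - ε / (2 * n))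
      (by have : 0 < ε / (2 * n) := by positivity
          linarith)
    set f := P g with hf
    have hPf : P f = f := congrArg (fun T : E →L[ℂ] E => T g) hP
    have hNf : N f = N g := by
      rw [hN, mul_apply_eq_comp, hPf, hf, mul_apply_eq_comp]
    have hf1 : ‖f‖ ≤ 1 := by
      have h1 : ‖f‖ ^ 2 ≤ ‖f‖ * ‖g‖ := by
        have h2 : inner ℂ f f = inner ℂ f g := by
          have h3 : inner ℂ (P f) g = inner ℂ f (P g) := by
            rw [← ContinuousLinearMap.adjoint_inner_left, hPsa.adjoint_eq]
          rw [hPf] at h3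
          exact h3.symm
        calc ‖f‖ ^ 2 = ‖inner ℂ f f‖ := by rw [inner_self_eq_norm_sq_to_K]; simp
          _ = ‖inner ℂ f g‖ := by rw [h2]
          _ ≤ _ := norm_inner_le_norm _ _
      rcases (norm_nonneg f).eq_or_lt with h | h
      · rw [← h]; norm_num
      · nlinarith
    have hNf2 : n ^ 2 - ε ≤ ‖N f‖ ^ 2 := by
      rw [hNf]
      have hn1 : n ≠ 0 := hn0.ne'
      have e1 : (n - ε / (2 * n)) ^ 2 = n ^ 2 - ε + (ε / (2 * n)) ^ 2 := by
        field_simp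
        ring
      rcases le_or_gt 0 (n - ε / (2 * n)) with h | h
      · have := pow_le_pow_left₀ h hg.le 2
        nlinarith [sq_nonneg (ε / (2 * n))]
      · have h5 : n * (2 * n) < ε := by
          rw [← lt_div_iff₀ (by positivity)]
          linarith
        nlinarith [sq_nonneg ‖N g‖]
    have hNf3 : ‖N f‖ ≤ n * ‖f‖ := N.le_opNorm f
    have hNf4 : ‖N f‖ ^ 2 ≤ n ^ 2 * ‖f‖ ^ 2 := by
      rw [← mul_pow]; exact pow_le_pow_left₀ (norm_nonneg _) hNf3 2
    have hf2 : ‖f‖ ^ 2 ≤ 1 := pow_le_one₀ (norm_nonneg _) hf1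
    -- A near-maximizer is almost an eigenvector of N*N: the expanded square is at most n⁴ − 2n²(n²
    -- − ε) + n⁴ = 2n²ε. So ⟨Nf, MAf⟩ = ⟨N*Nf, Af⟩ may be replaced by n²⟨f, Af⟩, and no commutator
    -- of M with P appears.
    have hFf : ‖F f - ((n ^ 2 : ℝ) : ℂ) • f‖ ≤ Real.sqrt (2 * n ^ 2 * ε) := by
      refine Real.le_sqrt_of_sq_le ?_
      have h1 : ‖F f‖ ≤ n ^ 2 := by
        refine (F.le_opNorm f).trans ?_
        rw [hFn]
        exact mul_le_of_le_one_right (by positivity) hf1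
      have h2 : (inner ℂ (F f) f).re = ‖N f‖ ^ 2 := by
        rw [hF, mul_apply_eq_comp, ContinuousLinearMap.adjoint_inner_left]
        exact inner_self_eq_norm_sq (𝕜 := ℂ) _
      have h3 := norm_sub_sq (𝕜 := ℂ) (F f) (((n ^ 2 : ℝ) : ℂ) • f)
      rw [h3, inner_smul_right, norm_smul, Complex.norm_real, Real.norm_eq_abs,
        abs_of_nonneg (by positivity)]
      have h4 : RCLike.re (((n ^ 2 : ℝ) : ℂ) * inner ℂ (F f) f) = n ^ 2 * ‖N f‖ ^ 2 := by
        rw [← h2]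
        exact Complex.re_ofReal_mul _ _
      rw [h4]
      have h5 : ‖F f‖ ^ 2 ≤ (n ^ 2) ^ 2 := pow_le_pow_left₀ (norm_nonneg _) h1 2
      have h6 : (n ^ 2 * ‖f‖) ^ 2 ≤ (n ^ 2) ^ 2 := by
        rw [mul_pow]
        exact mul_le_of_le_one_right (by positivity) hf2
      nlinarith [mul_le_mul_of_nonneg_left hNf2 (sq_nonneg n)]
    have e1 : (inner ℂ (N f) (M (A f))).re = (inner ℂ (F f) (A f)).re := by
      have : M (A f) = N (A f) := by
        rw [hN, mul_apply_eq_comp, ← mul_apply_eq_comp P A, hPA]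
      rw [this, hF, mul_apply_eq_comp N.adjoint, ContinuousLinearMap.adjoint_inner_left]
    have e2 : (inner ℂ (F f) (A f)).re
        = n ^ 2 * (inner ℂ f (A f)).re + (inner ℂ (F f - ((n ^ 2 : ℝ) : ℂ) • f) (A f)).re := by
      rw [inner_sub_left, inner_smul_left, Complex.sub_re, Complex.conj_ofReal,
        Complex.re_ofReal_mul]
      ring
    have e3 : (inner ℂ (F f - ((n ^ 2 : ℝ) : ℂ) • f) (A f)).re
        ≤ Real.sqrt (2 * n ^ 2 * ε) * ‖A‖ := by
      refine (Complex.re_le_norm _).trans ((norm_inner_le_norm _ _).trans ?_)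
      refine mul_le_mul hFf ?_ (norm_nonneg _) (Real.sqrt_nonneg _)
      exact (A.le_opNorm f).trans (mul_le_of_le_one_right (norm_nonneg _) hf1)
    have h1 := hM f
    have h2 := hA f
    rw [hPf] at h1 h2
    rw [e1, e2] at h1
    have h3 := mul_le_mul_of_nonneg_left h2 (sq_nonneg n)
    have h4 : κ * ‖N f‖ ^ 2 ≤ κ * n ^ 2 := by
      refine mul_le_mul_of_nonneg_left (hNf4.trans ?_) hκ0
      exact mul_le_of_le_one_right (by positivity) hf2
    have h5 : C * ‖f‖ ^ 2 ≤ C := mul_le_of_le_one_right hC hf2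
    have h6 := mul_le_mul_of_nonneg_left (hNf2.trans hNf4) he
    nlinarith
  have ht : Tendsto (fun ε : ℝ => C + (ε * e + Real.sqrt (2 * n ^ 2 * ε) * ‖A‖)) (𝓝[>] 0)
      (𝓝 (C + (0 * e + Real.sqrt (2 * n ^ 2 * 0) * ‖A‖))) :=
    (Continuous.tendsto (by fun_prop) 0).mono_left nhdsWithin_le_nhds
  simp only [zero_mul, mul_zero, Real.sqrt_zero, add_zero] at ht
  exact ge_of_tendsto ht (eventually_nhdsWithin_of_forall fun ε hε => key ε hε)

theorem sum_sq_apply_single_le (L : R3 →L[ℝ] ℝ) :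
    ∑ j, L (EuclideanSpace.single j 1) ^ 2 ≤ ‖L‖ ^ 2 := by
  set v : R3 := ∑ j, L (EuclideanSpace.single j 1) • EuclideanSpace.single j 1 with hv
  have h1 : L v = ∑ j, L (EuclideanSpace.single j 1) ^ 2 := by
    rw [hv, map_sum]
    exact Finset.sum_congr rfl fun j _ => by rw [map_smul, smul_eq_mul, sq]
  have h2 : ‖v‖ ^ 2 = ∑ j, L (EuclideanSpace.single j 1) ^ 2 := by
    rw [EuclideanSpace.norm_sq_eq]
    refine Finset.sum_congr rfl fun j _ => ?_
    have : v j = L (EuclideanSpace.single j 1) := by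
      rw [hv, Fin.sum_univ_three]
      fin_cases j <;> simp
    rw [this, Real.norm_eq_abs, sq_abs]
  rw [← h2] at h1 ⊢
  have h3 : ‖v‖ ^ 2 ≤ ‖L‖ * ‖v‖ := by
    rw [← h1]
    exact (le_abs_self _).trans (L.le_opNorm v)
  rcases (norm_nonneg v).eq_or_lt with h | h
  · rw [← h, zero_pow two_ne_zero]
    positivity
  · have : ‖v‖ ≤ ‖L‖ := by nlinarith
    exact pow_le_pow_left₀ (norm_nonneg _) this 2

theorem norm_sq_eq_integral (v : L2) : ‖v‖ ^ 2 = ∫ x, ‖v x‖ ^ 2 := by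
  have h := L2.inner_def (𝕜 := ℂ) v v
  rw [inner_self_eq_norm_sq_to_K] at h
  have h2 : ∀ x, inner ℂ (v x) (v x) = ((‖v x‖ ^ 2 : ℝ) : ℂ) := fun x => by
    rw [inner_self_eq_norm_sq_to_K]
    push_cast
    rfl
  simp only [h2, integral_complex_ofReal] at h
  exact Complex.ofReal_injective (by simpa using h)

/-- `√(|x_⊥|² + 1)`. -/
def perpJap (x : R3) : ℝ := Real.sqrt (x 1 ^ 2 + x 2 ^ 2 + 1)

theorem perpJap_eq (x : R3) : perpJap x = Real.sqrt (perpNorm x ^ 2 + 1) := by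
  rw [perpNorm, Real.sq_sqrt (by positivity), perpJap]

theorem perpJap_pos (x : R3) : 0 < perpJap x := Real.sqrt_pos.2 (by positivity)

theorem perpNorm_le_perpJap (x : R3) : perpNorm x ≤ perpJap x :=
  Real.sqrt_le_sqrt (by linarith)

theorem contDiff_perpJap : ContDiff ℝ ∞ perpJap :=
  ContDiff.sqrt (by fun_prop) fun x => by positivity

theorem abs_sqrt_sq_add_one_sub_le (a b : ℝ) :
    |Real.sqrt (a ^ 2 + 1) - Real.sqrt (b ^ 2 + 1)| ≤ |a - b| := by
  refine abs_le_of_sq_le_sq ?_ (abs_nonneg _)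
  have h1 := Real.sq_sqrt (show 0 ≤ a ^ 2 + 1 by positivity)
  have h2 := Real.sq_sqrt (show 0 ≤ b ^ 2 + 1 by positivity)
  have h3 : a * b + 1 ≤ Real.sqrt (a ^ 2 + 1) * Real.sqrt (b ^ 2 + 1) := by
    rw [← Real.sqrt_mul (by positivity)]
    refine Real.le_sqrt_of_sq_le ?_
    nlinarith [sq_nonneg (a - b)]
  rw [sq_abs]
  nlinarith

theorem abs_perpJap_sub_le (x y : R3) : |perpJap x - perpJap y| ≤ ‖x - y‖ := by
  rw [perpJap_eq, perpJap_eq]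
  refine (abs_sqrt_sq_add_one_sub_le _ _).trans (abs_le.2 ⟨?_, ?_⟩)
  · have := perpNorm_sub_le y x
    rw [norm_sub_rev] at this
    linarith
  · linarith [perpNorm_sub_le x y]

/-- The bounded exponent `α s / (1 + τ s)` with `s = √(|x_⊥|² + 1)`. -/
def perpExponent (α τ : ℝ) (x : R3) : ℝ := α * perpJap x / (1 + τ * perpJap x)

section

variable {α τ : ℝ}

theorem one_add_mul_perpJap_pos (hτ : 0 < τ) (x : R3) : 0 < 1 + τ * perpJap x := by
  have := perpJap_pos x
  positivity

theorem contDiff_perpExponent (hτ : 0 < τ) : ContDiff ℝ ∞ (perpExponent α τ) :=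
  (contDiff_const.mul contDiff_perpJap).div (contDiff_const.add (contDiff_const.mul contDiff_perpJap))
    fun x => (one_add_mul_perpJap_pos hτ x).ne'

theorem perpExponent_le (hα : 0 ≤ α) (hτ : 0 < τ) (x : R3) : perpExponent α τ x ≤ α * perpJap x := by
  have := perpJap_pos x
  refine div_le_self (by positivity) ?_
  nlinarith

theorem perpExponent_le_div (hα : 0 ≤ α) (hτ : 0 < τ) (x : R3) : perpExponent α τ x ≤ α / τ := by
  have h := perpJap_pos x
  rw [perpExponent, div_le_div_iff₀ (one_add_mul_perpJap_pos hτ x) hτ]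
  nlinarith

/-- The map s ↦ s/(1 + τs) is a contraction on s ≥ 0, and √(|x_⊥|² + 1) is 1-Lipschitz. The
truncation thus makes the weight bounded without enlarging the slope α, uniformly in τ. -/
theorem lipschitzWith_perpExponent (hα : 0 ≤ α) (hτ : 0 < τ) :
    LipschitzWith α.toNNReal (perpExponent α τ) := by
  refine LipschitzWith.of_dist_le_mul fun x y => ?_
  rw [Real.coe_toNNReal _ hα, Real.dist_eq, dist_eq_norm]
  have hx := one_add_mul_perpJap_pos hτ x
  have hy := one_add_mul_perpJap_pos hτ y
  have e : perpExponent α τ x - perpExponent α τ y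
      = α * (perpJap x - perpJap y) / ((1 + τ * perpJap x) * (1 + τ * perpJap y)) := by
    have hx0 := hx.ne'
    have hy0 := hy.ne'
    rw [perpExponent, perpExponent, div_sub_div _ _ hx0 hy0]
    ring
  rw [e, abs_div, abs_mul, abs_of_nonneg hα, abs_of_pos (mul_pos hx hy)]
  have h1 := perpJap_pos x
  have h2 := perpJap_pos y
  refine (div_le_self (by positivity) ?_).trans
    (mul_le_mul_of_nonneg_left (abs_perpJap_sub_le x y) hα)
  have : 0 ≤ τ * perpJap x := by positivity
  have : 0 ≤ τ * perpJap y := by positivity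
  nlinarith

theorem tendsto_perpExponent (x : R3) :
    Tendsto (fun n : ℕ => perpExponent α (1 / ((n : ℝ) + 1)) x) atTop (𝓝 (α * perpJap x)) := by
  have h := tendsto_one_div_add_atTop_nhds_zero_nat (𝕜 := ℝ)
  have h1 : Tendsto (fun n : ℕ => 1 + 1 / ((n : ℝ) + 1) * perpJap x) atTop
      (𝓝 (1 + 0 * perpJap x)) := tendsto_const_nhds.add (h.mul tendsto_const_nhds)
  have h2 := (tendsto_const_nhds (x := α * perpJap x)).div h1 (by simp)
  simp only [zero_mul, add_zero, div_one] at h2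
  exact h2

/-- The bounded weight `exp (α s / (1 + τ s))`. -/
def perpWeight (α τ : ℝ) (x : R3) : ℝ := Real.exp (perpExponent α τ x)

theorem contDiff_perpWeight (hτ : 0 < τ) : ContDiff ℝ ∞ (perpWeight α τ) :=
  Real.contDiff_exp.comp (contDiff_perpExponent hτ)

theorem sum_sq_partialDeriv_perpWeight_le (hα : 0 ≤ α) (hτ : 0 < τ) (x : R3) :
    ∑ j, partialDeriv j (perpWeight α τ) x ^ 2 ≤ α ^ 2 * perpWeight α τ x ^ 2 := by
  have hd : DifferentiableAt ℝ (perpExponent α τ) x :=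
    (contDiff_perpExponent hτ).differentiable (by simp) x
  have h1 : fderiv ℝ (perpWeight α τ) x = perpWeight α τ x • fderiv ℝ (perpExponent α τ) x :=
    hd.hasFDerivAt.exp.fderiv
  refine (sum_sq_apply_single_le (fderiv ℝ (perpWeight α τ) x)).trans ?_
  have h2 := norm_fderiv_le_of_lipschitz ℝ (lipschitzWith_perpExponent hα hτ) (x₀ := x)
  rw [Real.coe_toNNReal _ hα] at h2
  rw [h1, norm_smul, Real.norm_eq_abs, mul_pow, sq_abs, mul_comm]
  gcongr

theorem bddCont_perpWeight (hα : 0 ≤ α) (hτ : 0 < τ) :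
    BddCont (fun x => ((perpWeight α τ x : ℝ) : ℂ)) :=
  ⟨Complex.continuous_ofReal.comp (contDiff_perpWeight hτ).continuous, Real.exp (α / τ), fun x => by
    rw [Complex.norm_real, Real.norm_eq_abs, perpWeight, abs_of_pos (Real.exp_pos _)]
    exact Real.exp_le_exp.2 (perpExponent_le_div hα hτ x)⟩

end

/-! ### Transverse decay in the range of the projection. -/

namespace Setting

variable (𝒮 : Setting)

/-- Here f + x₀R₀f stands for HR₀f, and density reduces to test functions. The localization error
|∇M|² is at most α²M², the kinetic term is dropped as ε ≤ 1, and on the tube around the axis M is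
bounded independently of τ; hence so is C. -/
theorem exists_perpWeight_le_re_inner {α ε : ℝ} (hα : 0 ≤ α) (hε : 0 < ε) (hε1 : ε ≤ 1) :
    ∃ C : ℝ, 0 ≤ C ∧ ∀ (τ : ℝ) (hτ : 0 < τ) (f : L2),
      -(α ^ 2 + ε) * ‖mulOp _ (bddCont_perpWeight hα hτ) (𝒮.R₀ f)‖ ^ 2 - C * ‖𝒮.R₀ f‖ ^ 2
      ≤ (inner ℂ (mulOp _ (bddCont_perpWeight hα hτ) (𝒮.R₀ f))
          (mulOp _ (bddCont_perpWeight hα hτ) (f + (𝒮.x₀ : ℂ) • 𝒮.R₀ f))).re := by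
  lift ε to ℝ≥0 using hε.le
  obtain ⟨C, R, h⟩ := 𝒮.hV.exists_le_re_inner ε (by exact_mod_cast hε)
  set c : ℝ := Real.exp (α * Real.sqrt (R ^ 2 + 1)) with hc
  refine ⟨C * c ^ 2, by positivity, fun τ hτ f => ?_⟩
  set M := mulOp _ (bddCont_perpWeight hα hτ) with hM
  refine 𝒮.dense_test.induction_on (p := fun f => -(α ^ 2 + ε) * ‖M (𝒮.R₀ f)‖ ^ 2
      - C * c ^ 2 * ‖𝒮.R₀ f‖ ^ 2 ≤ (inner ℂ (M (𝒮.R₀ f)) (M (f + (𝒮.x₀ : ℂ) • 𝒮.R₀ f))).re) f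
    (isClosed_le (by fun_prop) (Complex.continuous_re.comp (by fun_prop))) fun φ => ?_
  have hs : ContDiff ℝ ∞ (perpWeight α τ) := contDiff_perpWeight hτ
  have hMt : ∀ ψ : TestFun, M (testToL2 ψ) = testToL2 (testMulReal _ hs ψ) := fun ψ =>
    mulOp_testToL2 (bddCont_perpWeight hα hτ) (Complex.ofRealCLM.contDiff.comp hs) ψ
  have hMs : ∀ u v : L2, inner ℂ (M u) (M v) = inner ℂ (M (M u)) v := by
    intro u v
    rw [L2.inner_def, L2.inner_def]
    refine integral_congr_ae ?_
    filter_upwards [mulOp_ae (bddCont_perpWeight hα hτ) u, mulOp_ae (bddCont_perpWeight hα hτ) v,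
      mulOp_ae (bddCont_perpWeight hα hτ) (M u)] with x h1 h2 h3
    rw [h3, hM, h1, h2, RCLike.inner_apply, RCLike.inner_apply]
    simp
    ring
  have e1 : testHamSub 𝒮.hV 𝒮.x₀ φ + (𝒮.x₀ : ℂ) • 𝒮.R₀ (testHamSub 𝒮.hV 𝒮.x₀ φ)
      = testHam 𝒮.hV φ := by
    rw [R₀, 𝒮.R_test 𝒮.hx₀, testHamSub_apply, sub_add_cancel]
  rw [e1, R₀, 𝒮.R_test 𝒮.hx₀, hMs, hMt, hMt]
  have h1 := h _ hs c.toNNReal (fun x hx => by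
    rw [Real.coe_toNNReal _ (Real.exp_pos _).le, perpWeight, abs_of_pos (Real.exp_pos _)]
    refine Real.exp_le_exp.2 ((perpExponent_le hα hτ x).trans ?_)
    rw [perpJap_eq]
    have h0 : 0 ≤ perpNorm x := Real.sqrt_nonneg _
    gcongr) φ
  rw [Real.coe_toNNReal _ (Real.exp_pos _).le] at h1
  refine le_trans ?_ h1
  have h2 : ∑ j, ‖testToL2 (testMulReal (partialDeriv j (perpWeight α τ))
      (contDiff_partialDeriv hs j) φ)‖ ^ 2 ≤ α ^ 2 * ‖testToL2 (testMulReal _ hs φ)‖ ^ 2 := by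
    simp only [norm_sq_testToL2]
    have hi : ∀ ψ : TestFun, Integrable (fun x => ‖ψ.1 x‖ ^ 2) volume := fun ψ =>
      (memLp_two_iff_integrable_sq_norm ψ.continuous.aestronglyMeasurable).1 (ψ.memLp 2)
    rw [← integral_finsetSum _ fun j _ => hi _, ← integral_const_mul]
    refine integral_mono (integrable_finsetSum _ fun j _ => hi _) ((hi _).const_mul _) fun x => ?_
    simp only [testMulReal_apply, norm_mul, mul_pow, Complex.norm_real, Real.norm_eq_abs, sq_abs]
    rw [← Finset.sum_mul, ← mul_assoc]
    gcongr
    exact sum_sq_partialDeriv_perpWeight_le hα hτ x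
  have h3 := gradNormSq_nonneg (testMulReal _ hs φ)
  have h4 : 0 ≤ (1 - ε) * gradNormSq (testMulReal _ hs φ) := mul_nonneg (by linarith) h3
  linarith

theorem P_properties : IsSelfAdjoint 𝒮.P ∧ IsIdempotentElem 𝒮.P ∧
    ∃ G : L2 →L[ℂ] L2, 𝒮.P = 𝒮.R₀ * G ∧ 𝒮.P * G = G ∧ G * 𝒮.P = G ∧
      ∀ u, (inner ℂ u (G u)).re ≤ (-𝒮.Eplus - 𝒮.x₀) * ‖𝒮.P u‖ ^ 2 :=
  rieszProjection_properties 𝒮.hσ 𝒮.hx₀ (isSelfAdjoint_resolventOp 𝒮.hV 𝒮.hx₀) 𝒮.Γ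

/-- Exponential decay away from the axis, uniform on the range of the projection. -/
theorem exists_perp_decay {α : ℝ} (hα : 0 ≤ α) (hαE : α < Real.sqrt 𝒮.Eplus) :
    ∃ C : ℝ, 0 ≤ C ∧ ∀ u : L2, 𝒮.P u = u →
      ∫⁻ x, ENNReal.ofReal (Real.exp (2 * α * perpNorm x) * ‖u x‖ ^ 2)
        ≤ ENNReal.ofReal (C * ‖u‖ ^ 2) := by
  obtain ⟨hsa, hid, G, hG1, hG2, hG3, hG4⟩ := 𝒮.P_properties
  have hα2 : α ^ 2 < 𝒮.Eplus := (Real.lt_sqrt hα).1 hαE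
  set ε : ℝ := min 1 ((𝒮.Eplus - α ^ 2) / 2) with hε
  have hε0 : 0 < ε := lt_min one_pos (by linarith)
  have hεE : α ^ 2 + ε < 𝒮.Eplus := by
    have : ε ≤ (𝒮.Eplus - α ^ 2) / 2 := min_le_right _ _
    linarith
  obtain ⟨C, hC0, hC⟩ := 𝒮.exists_perpWeight_le_re_inner hα hε0 (min_le_left _ _)
  set K : ℝ := C / (𝒮.Eplus - (α ^ 2 + ε)) with hK
  have hK0 : 0 ≤ K := div_nonneg hC0 (by linarith)
  refine ⟨K, hK0, fun u hu => ?_⟩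
  have hbound : ∀ (τ : ℝ) (hτ : 0 < τ),
      ‖mulOp _ (bddCont_perpWeight hα hτ) u‖ ^ 2 ≤ K * ‖u‖ ^ 2 := by
    intro τ hτ
    set M := mulOp _ (bddCont_perpWeight hα hτ) with hM
    -- Here A = G + x₀P is the bounded operator HP.
    have h1 := norm_mul_sq_le_of_form_bounds (P := 𝒮.P) (A := G + (𝒮.x₀ : ℂ) • 𝒮.P) (M := M)
      hsa hid (by rw [mul_add, hG2, mul_smul_comm, hid]) 𝒮.hE.le
      (by positivity : 0 ≤ α ^ 2 + ε) hC0
      (fun f => by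
        have h2 : (inner ℂ f (𝒮.P f)).re = ‖𝒮.P f‖ ^ 2 := by
          have h3 : 𝒮.P f = 𝒮.P (𝒮.P f) := (congrArg (fun T : L2 →L[ℂ] L2 => T f) hid).symm
          rw [h3, ← ContinuousLinearMap.adjoint_inner_left, hsa.adjoint_eq, ← h3]
          exact inner_self_eq_norm_sq (𝕜 := ℂ) _
        rw [add_apply, inner_add_right, smul_apply, inner_smul_right, Complex.add_re,
          Complex.re_ofReal_mul, h2]
        linarith [hG4 f])
      (fun f => by
        have h2 := hC τ hτ (G f)
        have h3 : 𝒮.R₀ (G f) = 𝒮.P f := by rw [hG1]; rfl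
        rw [h3] at h2
        exact h2)
    have h2 : ‖M * 𝒮.P‖ ^ 2 ≤ K := by
      rw [hK, le_div_iff₀ (by linarith)]
      exact h1
    have h3 : M u = (M * 𝒮.P) u := by rw [mul_apply_eq_comp, hu]
    rw [h3]
    calc ‖(M * 𝒮.P) u‖ ^ 2 ≤ (‖M * 𝒮.P‖ * ‖u‖) ^ 2 :=
          pow_le_pow_left₀ (norm_nonneg _) (ContinuousLinearMap.le_opNorm _ _) 2
      _ ≤ _ := by rw [mul_pow]; gcongr
  have hum := (Lp.aestronglyMeasurable u).norm.aemeasurable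
  have hn : ∀ n : ℕ, ∫⁻ x, ENNReal.ofReal (perpWeight α (1 / ((n : ℝ) + 1)) x ^ 2 * ‖u x‖ ^ 2)
      ≤ ENNReal.ofReal (K * ‖u‖ ^ 2) := by
    intro n
    have hτ : (0 : ℝ) < 1 / ((n : ℝ) + 1) := by positivity
    refine le_trans (le_of_eq ?_) (ENNReal.ofReal_le_ofReal (hbound _ hτ))
    set v := mulOp _ (bddCont_perpWeight hα hτ) u
    rw [norm_sq_eq_integral, ofReal_integral_eq_lintegral_ofReal
      ((memLp_two_iff_integrable_sq_norm (Lp.aestronglyMeasurable v)).1 (Lp.memLp v))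
      (ae_of_all _ fun x => by positivity)]
    refine lintegral_congr_ae ?_
    filter_upwards [mulOp_ae (bddCont_perpWeight hα hτ) u] with x hx
    rw [hx, norm_mul, mul_pow, Complex.norm_real, Real.norm_eq_abs, sq_abs]
  set F : ℕ → R3 → ENNReal := fun n x =>
    ENNReal.ofReal (perpWeight α (1 / ((n : ℝ) + 1)) x ^ 2 * ‖u x‖ ^ 2) with hF
  -- Fatou's lemma removes the truncation as τ = 1/(n + 1) tends to 0.
  have hFatou : ∫⁻ x, liminf (fun n => F n x) atTop ≤ liminf (fun n => ∫⁻ x, F n x) atTop := by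
    refine lintegral_liminf_le' fun n => ?_
    have hτ : (0 : ℝ) < 1 / ((n : ℝ) + 1) := by positivity
    have := (contDiff_perpWeight (α := α) hτ).continuous.measurable
    exact (((this.pow_const 2).aemeasurable).mul (hum.pow_const 2)).ennreal_ofReal
  refine le_trans ?_ (hFatou.trans ?_)
  · refine lintegral_mono fun x => ?_
    have h1 : Tendsto (fun n : ℕ => ENNReal.ofReal
        (perpWeight α (1 / ((n : ℝ) + 1)) x ^ 2 * ‖u x‖ ^ 2)) atTop
        (𝓝 (ENNReal.ofReal (Real.exp (α * perpJap x) ^ 2 * ‖u x‖ ^ 2))) :=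
      (ENNReal.continuous_ofReal.tendsto _).comp
        (((((Real.continuous_exp.tendsto _).comp (tendsto_perpExponent x)).pow 2)).mul
          tendsto_const_nhds)
    rw [Tendsto.liminf_eq h1]
    refine ENNReal.ofReal_le_ofReal (mul_le_mul_of_nonneg_right ?_ (by positivity))
    rw [← Real.exp_nat_mul]
    refine Real.exp_le_exp.2 ?_
    have := mul_le_mul_of_nonneg_left (perpNorm_le_perpJap x) hα
    push_cast
    linarith
  · refine (liminf_le_liminf (f := atTop) (Eventually.of_forall hn)).trans ?_
    exact (liminf_const _).le

end Setting

/-! ### Perturbations of the identity of norm at most one half -/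

section Half

variable {E : Type*} [NormedAddCommGroup E] [NormedSpace ℂ E] {X : E →L[ℂ] E}

theorem eq_zero_of_eq_apply (hX : ‖X‖ ≤ 1 / 2) {w : E} (hw : w = X w) : w = 0 := by
  have h := X.le_opNorm w
  rw [← hw] at h
  have h1 := norm_nonneg w
  exact norm_eq_zero.1 (by nlinarith)

theorem norm_le_two_mul_of_eq_apply_add (hX : ‖X‖ ≤ 1 / 2) {w f : E} (hw : w = X w + f) :
    ‖w‖ ≤ 2 * ‖f‖ := by
  have h := X.le_opNorm w
  have h1 := norm_nonneg w
  have h2 := norm_add_le (X w) f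
  rw [← hw] at h2
  nlinarith

theorem exists_eq_apply_add [CompleteSpace E] (hX : ‖X‖ ≤ 1 / 2) (f : E) : ∃ w, w = X w + f := by
  obtain ⟨u, hu⟩ := isUnit_one_sub_of_norm_lt_one (x := X) (by linarith)
  refine ⟨(↑u⁻¹ : E →L[ℂ] E) f, ?_⟩
  have h : (1 - X) ((↑u⁻¹ : E →L[ℂ] E) f) = f := by
    rw [← hu]
    exact congrArg (fun T : E →L[ℂ] E => T f) u.mul_inv
  rw [sub_apply] at h
  exact eq_add_of_sub_eq' h

end Half

/-! ### The shift weights and the position operator -/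

theorem bddCont_gauss (b a : ℝ) :
    BddCont (fun x : R3 => ((Real.exp (-((x 0 - a) / b) ^ 2) : ℝ) : ℂ)) :=
  ⟨by fun_prop, 1, fun x => by
    rw [Complex.norm_real, Real.norm_eq_abs, abs_of_pos (Real.exp_pos _)]
    exact exp_neg_sq_le_one _⟩

/-- Multiplication by `exp (-((x₁ - a) / b)²)`. -/
def gaussOp (b a : ℝ) : L2 →L[ℂ] L2 := mulOp _ (bddCont_gauss b a)

theorem norm_gaussOp_le (b a : ℝ) : ‖gaussOp b a‖ ≤ 1 :=
  norm_mulOp_le _ fun x => by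
    rw [Complex.norm_real, Real.norm_eq_abs, abs_of_pos (Real.exp_pos _)]
    exact exp_neg_sq_le_one _

theorem inner_mulOp_ofReal {f : R3 → ℝ} (hf : BddCont (fun x => (f x : ℂ))) (u v : L2) :
    inner ℂ (mulOp _ hf u) v = inner ℂ u (mulOp _ hf v) := by
  rw [L2.inner_def, L2.inner_def]
  refine integral_congr_ae ?_
  filter_upwards [mulOp_ae hf u, mulOp_ae hf v] with x h1 h2
  rw [h1, h2, RCLike.inner_apply, RCLike.inner_apply]
  simp
  ring

theorem inner_coordMul (u v : positionDomain) :
    inner ℂ (coordMul u) (v : L2) = inner ℂ (u : L2) (coordMul v) := by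
  rw [L2.inner_def, L2.inner_def]
  refine integral_congr_ae ?_
  filter_upwards [coordMul_ae u, coordMul_ae v] with x h1 h2
  rw [h1, h2, RCLike.inner_apply, RCLike.inner_apply]
  simp
  ring

theorem Weight.op_ae (w : Weight) (u : L2) :
    (w.op u : R3 → ℂ) =ᵐ[volume] fun x => w.f (x 0) * u x := mulOp_ae w.bddCont_f u

theorem shiftWeight_op_ae (σ b a : ℝ) (hσ : σ ^ 2 = 1) (w : L2) :
    ((shiftWeight σ b a hσ).op w : R3 → ℂ) =ᵐ[volume]
      fun x => (shiftFun σ ((x 0 - a) / b))⁻¹ * w x :=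
  (shiftWeight σ b a hσ).op_ae w

/-- With x₁ = a + bs and s = f⁻¹ − iσ exp(−s²), the product x₁·fw involves only bounded operations
on w. Hence the range of the shift weight lies in the domain of position. -/
theorem coord_mul_shiftWeight_ae (σ b a : ℝ) (hσ : σ ^ 2 = 1) (hb : b ≠ 0) (w : L2) :
    (((a : ℂ) • (shiftWeight σ b a hσ).op w + (b : ℂ) • (w - (Complex.I * σ) •
      gaussOp b a ((shiftWeight σ b a hσ).op w)) : L2) : R3 → ℂ)
      =ᵐ[volume] fun x => (x 0 : ℂ) * (shiftWeight σ b a hσ).op w x := by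
  set u := (shiftWeight σ b a hσ).op w with hu
  filter_upwards [shiftWeight_op_ae σ b a hσ w,
    Lp.coeFn_add ((a : ℂ) • u) ((b : ℂ) • (w - (Complex.I * σ) • gaussOp b a u)),
    Lp.coeFn_smul (a : ℂ) u, Lp.coeFn_smul (b : ℂ) (w - (Complex.I * σ) • gaussOp b a u),
    Lp.coeFn_sub w ((Complex.I * σ) • gaussOp b a u),
    Lp.coeFn_smul (Complex.I * σ) (gaussOp b a u), mulOp_ae (bddCont_gauss b a) u]
    with x h1 h2 h3 h4 h5 h6 h7
  have h0 := shiftFun_ne_zero σ hσ ((x 0 - a) / b)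
  have h8 : w x = shiftFun σ ((x 0 - a) / b) * u x := by
    rw [h1, mul_inv_cancel_left₀ h0]
  have hb' : (b : ℂ) ≠ 0 := by exact_mod_cast hb
  rw [h2, Pi.add_apply, h3, h4, Pi.smul_apply, Pi.smul_apply, h5, Pi.sub_apply, h6, Pi.smul_apply,
    gaussOp, h7, h8, shiftFun]
  simp only [smul_eq_mul]
  push_cast
  field_simp
  ring

theorem shiftWeight_op_mem (σ b a : ℝ) (hσ : σ ^ 2 = 1) (hb : b ≠ 0) (w : L2) :
    (shiftWeight σ b a hσ).op w ∈ positionDomain :=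
  (memLp_congr_ae (coord_mul_shiftWeight_ae σ b a hσ hb w)).1 (Lp.memLp _)

theorem coordMul_shiftWeight_op (σ b a : ℝ) (hσ : σ ^ 2 = 1) (hb : b ≠ 0) (w : L2) :
    coordMul ⟨_, shiftWeight_op_mem σ b a hσ hb w⟩ =
      (a : ℂ) • (shiftWeight σ b a hσ).op w + (b : ℂ) • (w - (Complex.I * σ) •
        gaussOp b a ((shiftWeight σ b a hσ).op w)) :=
  Lp.ext ((coordMul_ae _).trans (coord_mul_shiftWeight_ae σ b a hσ hb w).symm)

/-- The preimage of `u` under the shift weight. -/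
def unshift (σ b a : ℝ) (u : positionDomain) : L2 :=
  (b : ℂ)⁻¹ • (coordMul u - (a : ℂ) • (u : L2)) + (Complex.I * σ) • gaussOp b a u

theorem shiftWeight_op_unshift (σ b a : ℝ) (hσ : σ ^ 2 = 1) (u : positionDomain) :
    (shiftWeight σ b a hσ).op (unshift σ b a u) = u := by
  refine Lp.ext ?_
  filter_upwards [shiftWeight_op_ae σ b a hσ (unshift σ b a u),
    Lp.coeFn_add ((b : ℂ)⁻¹ • (coordMul u - (a : ℂ) • (u : L2)))
      ((Complex.I * σ) • gaussOp b a u),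
    Lp.coeFn_smul (b : ℂ)⁻¹ (coordMul u - (a : ℂ) • (u : L2)),
    Lp.coeFn_sub (coordMul u) ((a : ℂ) • (u : L2)),
    Lp.coeFn_smul (a : ℂ) (u : L2), coordMul_ae u,
    Lp.coeFn_smul (Complex.I * σ) (gaussOp b a u), mulOp_ae (bddCont_gauss b a) (u : L2)]
    with x h1 h2 h3 h4 h5 h6 h7 h8
  have h0 := shiftFun_ne_zero σ hσ ((x 0 - a) / b)
  rw [h1, inv_mul_eq_iff_eq_mul₀ h0, unshift, h2, Pi.add_apply, h3, Pi.smul_apply, h4,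
    Pi.sub_apply, h5, Pi.smul_apply, h6, h7, Pi.smul_apply, gaussOp, h8, shiftFun]
  simp only [smul_eq_mul]
  push_cast
  ring

/-! ### The shifted equation in the range of the projection. -/

namespace Setting

variable (𝒮 : Setting)

theorem P_mul_P : 𝒮.P * 𝒮.P = 𝒮.P := 𝒮.P_properties.2.1

theorem P_P (u : L2) : 𝒮.P (𝒮.P u) = 𝒮.P u := congrArg (fun T : L2 →L[ℂ] L2 => T u) 𝒮.P_mul_P

theorem inner_P (u v : L2) : inner ℂ (𝒮.P u) v = inner ℂ u (𝒮.P v) := by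
  rw [← ContinuousLinearMap.adjoint_inner_left, 𝒮.P_properties.1.adjoint_eq]

theorem norm_P_le (u : L2) : ‖𝒮.P u‖ ≤ ‖u‖ := by
  have h1 : ‖𝒮.P u‖ ^ 2 ≤ ‖𝒮.P u‖ * ‖u‖ := by
    calc ‖𝒮.P u‖ ^ 2 = ‖inner ℂ (𝒮.P u) (𝒮.P u)‖ := by rw [inner_self_eq_norm_sq_to_K]; simp
      _ = ‖inner ℂ (𝒮.P u) u‖ := by rw [← 𝒮.inner_P, 𝒮.P_P]
      _ ≤ _ := norm_inner_le_norm _ _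
  rcases (norm_nonneg (𝒮.P u)).eq_or_lt with h | h
  · rw [← h]; exact norm_nonneg _
  · nlinarith

/-- The shift weight tends to the trivial one, in logarithmic derivative, as b grows, and the
trivial weight conjugates P to itself. The threshold is uniform in the centre a. -/
theorem exists_shift_bound : ∃ b₀ : ℝ, 1 ≤ b₀ ∧ ∀ (σ b a : ℝ) (hσ : σ ^ 2 = 1), b₀ ≤ b →
    𝒮.RelBound (shiftWeight σ b a hσ) (1 / 2) ∧
      ‖𝒮.proj (shiftWeight σ b a hσ) - 𝒮.P‖ ≤ 1 / 2 := by
  obtain ⟨ε, hε, h⟩ := 𝒮.exists_relBound_of_close 0 0 le_rfl one_pos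
  refine ⟨max 1 (48 / ε), le_max_left _ _, fun σ b a hσ hb => ?_⟩
  have hb1 : 1 ≤ b := (le_max_left _ _).trans hb
  have hb2 : 48 / b ≤ ε := by
    have : 48 / ε ≤ b := (le_max_right _ _).trans hb
    rw [div_le_iff₀ hε] at this
    rw [div_le_iff₀ (by linarith)]
    linarith
  have h1 := h (shiftWeight σ b a hσ) Weight.one (𝒮.relBound_one le_rfl)
    (fun t => by simp [Weight.one])
    (fun t => by
      simp only [Weight.one, sub_zero]
      exact (norm_shiftWeight_p_le σ b a hσ hb1 t).trans hb2)
    (fun t => by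
      simp only [Weight.one, sub_zero]
      exact (norm_shiftWeight_p'_le σ b a hσ hb1 t).trans hb2)
  rw [𝒮.proj_one, add_zero] at h1
  exact h1

variable {𝒮}

theorem RelBound.P_op {w : Weight} {θ : ℝ} (h : 𝒮.RelBound w θ) (hθ : θ < 1) (u : L2) :
    𝒮.P (w.op u) = w.op (𝒮.proj w u) :=
  congrArg (fun T : L2 →L[ℂ] L2 => T u) (h.P_mul_op hθ)

theorem RelBound.proj_proj {w : Weight} {θ : ℝ} (h : 𝒮.RelBound w θ) (hθ : θ < 1) (u : L2) :
    𝒮.proj w (𝒮.proj w u) = 𝒮.proj w u := by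
  apply w.op_injective
  rw [← h.P_op hθ, ← h.P_op hθ, 𝒮.P_P]

/-- The equation satisfied by the preimage of a vector in the range of the projection. -/
theorem unshift_eq {σ b a : ℝ} {hσ : σ ^ 2 = 1}
    (h : 𝒮.RelBound (shiftWeight σ b a hσ) (1 / 2)) (u : positionDomain) (hu : 𝒮.P u = u) :
    unshift σ b a u = (𝒮.proj (shiftWeight σ b a hσ) - 𝒮.P) (unshift σ b a u)
      + ((b : ℂ)⁻¹ • (𝒮.P (coordMul u) - (a : ℂ) • (u : L2))
        + (Complex.I * σ) • 𝒮.P (gaussOp b a u)) := by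
  set w := unshift σ b a u with hw
  -- With f the weight, f applied to Qw is P(fw) = Pu = u = fw, and f is injective. So w = Qw = (Q −
  -- P)w + Pw, where Pw is explicit.
  have h1 : 𝒮.proj (shiftWeight σ b a hσ) w = w := by
    apply (shiftWeight σ b a hσ).op_injective
    rw [← h.P_op (by norm_num), hw, shiftWeight_op_unshift, hu]
  have h2 : 𝒮.P w = (b : ℂ)⁻¹ • (𝒮.P (coordMul u) - (a : ℂ) • (u : L2))
        + (Complex.I * σ) • 𝒮.P (gaussOp b a u) := by
    rw [hw, unshift, map_add, map_smul, map_sub, map_smul, map_smul, hu]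
  rw [← h2, sub_apply, h1, sub_add_cancel]

/-- Solvability of the shifted equation in the range of the projection. -/
theorem exists_shift_solution {σ b a : ℝ} {hσ : σ ^ 2 = 1} (hb : b ≠ 0)
    (h : 𝒮.RelBound (shiftWeight σ b a hσ) (1 / 2))
    (hd : ‖𝒮.proj (shiftWeight σ b a hσ) - 𝒮.P‖ ≤ 1 / 2) (f : L2) (hf : 𝒮.P f = f) :
    ∃ u : positionDomain, 𝒮.P u = u ∧
      𝒮.P (coordMul u) - (a : ℂ) • (u : L2) + (Complex.I * (σ * b)) • 𝒮.P (gaussOp b a u)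
        = (b : ℂ) • f := by
  obtain ⟨w, hw⟩ := exists_eq_apply_add hd f
  set Q := 𝒮.proj (shiftWeight σ b a hσ) with hQ
  have hQw : Q w = w := by
    -- The vector w − Qw lies in Ran P and is annihilated by Q, hence is fixed by P − Q, whose norm
    -- is at most 1/2; it must vanish.
    have h1 : w - Q w = f - 𝒮.P w := by
      rw [sub_apply] at hw
      nth_rw 1 [hw]
      abel
    have h2 : w - Q w = 𝒮.P (w - Q w) := by rw [h1, map_sub, hf, 𝒮.P_P]
    have h3 : Q (w - Q w) = 0 := by rw [map_sub, hQ, h.proj_proj (by norm_num), sub_self]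
    have h4 : w - Q w = (𝒮.P - Q) (w - Q w) := by rw [sub_apply, h3, sub_zero, ← h2]
    have h5 := eq_zero_of_eq_apply (by rw [norm_sub_rev]; exact hd) h4
    exact (sub_eq_zero.1 h5).symm
  refine ⟨⟨_, shiftWeight_op_mem σ b a hσ hb w⟩, ?_, ?_⟩
  · rw [h.P_op (by norm_num), ← hQ, hQw]
  · have hPw : 𝒮.P w = f := by
      rw [sub_apply, hQw, sub_add_eq_add_sub, eq_sub_iff_add_eq, add_right_inj] at hw
      exact hw
    have hPu : 𝒮.P ((shiftWeight σ b a hσ).op w) = (shiftWeight σ b a hσ).op w := by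
      rw [h.P_op (by norm_num), ← hQ, hQw]
    rw [coordMul_shiftWeight_op σ b a hσ hb w, map_add, map_smul, map_smul, map_sub, map_smul, hPw]
    simp only [hPu]
    rw [smul_sub, smul_smul]
    have : (b : ℂ) * (Complex.I * σ) = Complex.I * (σ * b) := by ring
    rw [this]
    abel

/-! ### Decay of eigenvectors along the axis -/

/-- The Gaussian absorbs the exponential growth, since α|bs| ≤ α²b² + s². This is why the
regularization of position is a Gaussian rather than a constant. -/
theorem bddCont_inv_exp_mul_gauss {α b : ℝ} (hα : 0 ≤ α) (hb : b ≠ 0) (a : ℝ) :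
    BddCont (fun x : R3 =>
      ((Real.exp (α * jap a (x 0)) * Real.exp (-((x 0 - a) / b) ^ 2) : ℝ) : ℂ)) ∧
    ∀ x : R3, ‖((Real.exp (α * jap a (x 0)) * Real.exp (-((x 0 - a) / b) ^ 2) : ℝ) : ℂ)‖
      ≤ Real.exp (α + α ^ 2 * b ^ 2) := by
  have h1 : ∀ x : R3, ‖((Real.exp (α * jap a (x 0)) * Real.exp (-((x 0 - a) / b) ^ 2) : ℝ) : ℂ)‖
      ≤ Real.exp (α + α ^ 2 * b ^ 2) := fun x => by
    rw [Complex.norm_real, Real.norm_eq_abs, ← Real.exp_add, abs_of_pos (Real.exp_pos _)]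
    refine Real.exp_le_exp.2 ?_
    set s := (x 0 - a) / b with hs
    have e : x 0 - a = b * s := by rw [hs]; field_simp
    have h2 : jap a (x 0) ≤ 1 + |b * s| := by
      rw [jap, e]
      refine Real.sqrt_le_iff.2 ⟨by positivity, ?_⟩
      rw [add_sq, sq_abs]
      nlinarith [abs_nonneg (b * s)]
    have h3 := mul_le_mul_of_nonneg_left h2 hα
    have h4 : α * |b * s| ≤ α ^ 2 * b ^ 2 + s ^ 2 := by
      rw [abs_mul, ← sq_abs b, ← sq_abs s]
      nlinarith [sq_nonneg (α * |b| - |s|), mul_nonneg (mul_nonneg hα (abs_nonneg b)) (abs_nonneg s)]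
    linarith
  exact ⟨⟨by
    have := (contDiff_jap a).continuous
    have h2 : Continuous fun x : R3 => jap a (x 0) := this.comp Weight.continuous_coord
    fun_prop, _, h1⟩, h1⟩

/-- Compared with the trivial weight. The maximum with 0 is there because the trivial weight
satisfies the relative bound only for nonnegative constants. -/
theorem exists_norm_proj_le {θ : ℝ} (hθ : θ < 1) :
    ∃ C : ℝ, 0 ≤ C ∧ ∀ w : Weight, 𝒮.RelBound w θ → ‖𝒮.proj w‖ ≤ C := by
  obtain ⟨C, hC0, hC⟩ := 𝒮.exists_norm_proj_sub_le
  refine ⟨C * (((1 - max θ 0)⁻¹) ^ 2 * 1) + ‖𝒮.P‖, by positivity, fun w hw => ?_⟩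
  have h0 : max θ 0 < 1 := max_lt hθ one_pos
  have hw' : 𝒮.RelBound w (max θ 0) := fun z hz => (hw z hz).trans (le_max_left _ _)
  have h1 := hC w Weight.one (max θ 0) 1 h0 zero_le_one hw' (𝒮.relBound_one (le_max_right _ _))
    fun z hz => by
      rw [𝒮.K_one, sub_zero]
      exact (hw z hz).trans hθ.le
  rw [𝒮.proj_one] at h1
  have h2 := norm_add_le (𝒮.proj w - 𝒮.P) 𝒮.P
  rw [sub_add_cancel] at h2
  linarith

variable (𝒮)

/-- Eigenvectors of the band position operator decay exponentially along the axis. -/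
theorem exists_parallel_decay {α : ℝ} (hpar : IsParallelExponent 𝒮.V 𝒮.Γ.trace α) :
    ∃ C : ℝ, 0 ≤ C ∧ ∀ (g : ℝ) (u : positionDomain), 𝒮.P u = u →
      𝒮.P (coordMul u) = (g : ℂ) • (u : L2) →
      ∫⁻ x, ENNReal.ofReal (Real.exp (2 * α * |x 0 - g|) * ‖(u : L2) x‖ ^ 2)
        ≤ ENNReal.ofReal (C * ‖(u : L2)‖ ^ 2) := by
  have hα : 0 ≤ α := hpar.1.le
  obtain ⟨θ, hθ, hE⟩ := 𝒮.relBound_of_isParallelExponent hpar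
  obtain ⟨b₁, hb₁, h₁⟩ := 𝒮.exists_shift_bound
  obtain ⟨b₂, hb₂, h₂⟩ := 𝒮.exists_relBound_shiftWeight α θ hα hθ
  obtain ⟨C, hC0, hC⟩ := exists_norm_proj_le (𝒮 := 𝒮) hθ
  set b := max b₁ b₂ with hb
  have hb0 : b ≠ 0 := by
    have : b₁ ≤ b := le_max_left _ _
    linarith
  set c := Real.exp (α + α ^ 2 * b ^ 2)
  have h1 : (1 : ℝ) ^ 2 = 1 := one_pow 2
  refine ⟨(2 * (2 * (C * c))) ^ 2, by positivity, fun g u hu hug => ?_⟩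
  set k := shiftWeight 1 b g h1 with hk
  set e := expWeight α g hα with he
  obtain ⟨hk1, hk2⟩ := h₁ 1 b g h1 (le_max_left _ _)
  obtain ⟨hek1, hek2⟩ := h₂ e 1 b g h1 (le_max_right _ _) (hE g) (norm_expWeight_p_le α g hα)
  rw [← hk] at hk1 hk2 hek1 hek2
  have hθ' : (1 + θ) / 2 < 1 := by linarith
  obtain ⟨hB, hBc⟩ := bddCont_inv_exp_mul_gauss hα hb0 g
  -- h is e⁻¹ applied to the Gaussian times u, bounded although e⁻¹ is not.
  set h := mulOp _ hB (u : L2) with hh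
  have hhn : ‖h‖ ≤ c * ‖(u : L2)‖ :=
    (ContinuousLinearMap.le_opNorm _ _).trans (by gcongr; exact norm_mulOp_le hB hBc)
  have heh : e.op h = gaussOp b g u := by
    refine Lp.ext ?_
    filter_upwards [e.op_ae h, mulOp_ae hB (u : L2), mulOp_ae (bddCont_gauss b g) (u : L2)]
      with x a1 a2 a3
    rw [a1, hh, a2, gaussOp, a3, ← mul_assoc]
    congr 1
    simp only [he, expWeight]
    rw [← Complex.ofReal_mul, ← mul_assoc, ← Real.exp_add]
    simp
  -- This is the equation for `unshift` conjugated by e: the contraction (k⁻¹Pk) − P becomes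
  -- (ek)⁻¹P(ek) − e⁻¹Pe, again of norm at most 1/2.
  obtain ⟨v, hv⟩ := exists_eq_apply_add hek2 (Complex.I • 𝒮.proj e h)
  have hvn : ‖v‖ ≤ 2 * (C * (c * ‖(u : L2)‖)) := by
    refine (norm_le_two_mul_of_eq_apply_add hek2 hv).trans ?_
    rw [norm_smul, Complex.norm_I, one_mul]
    gcongr
    exact (ContinuousLinearMap.le_opNorm _ _).trans
      (mul_le_mul (hC _ (hE g)) hhn (norm_nonneg _) hC0)
  have hcomm : ∀ y, k.op (e.op y) = e.op (k.op y) := fun y => by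
    refine Lp.ext ?_
    filter_upwards [k.op_ae (e.op y), e.op_ae y, e.op_ae (k.op y), k.op_ae y] with x a1 a2 a3 a4
    rw [a1, a2, a3, a4, mul_left_comm]
  have hPk : ∀ y, 𝒮.proj k (e.op y) = e.op (𝒮.proj (e.mul k) y) := fun y => by
    apply k.op_injective
    rw [← hk1.P_op (by norm_num), hcomm, hcomm]
    have := hek1.P_op hθ' y
    rw [Weight.op_mul] at this
    exact this
  have hPe : ∀ y, 𝒮.P (e.op y) = e.op (𝒮.proj e y) := (hE g).P_op hθ
  have hev : e.op v = (𝒮.proj k - 𝒮.P) (e.op v) + Complex.I • 𝒮.P (gaussOp b g u) := by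
    rw [← heh, hPe, sub_apply, hPk, hPe, ← map_sub, ← map_smul, ← map_add]
    exact congrArg e.op hv
  have hw := unshift_eq hk1 u hu
  rw [hug, sub_self, smul_zero, zero_add, Complex.ofReal_one, mul_one, ← hk] at hw
  -- Both vectors solve the same fixed point equation of a contraction, so they agree. Decay is
  -- obtained by constructing the decaying solution first, without assuming that e⁻¹u is square
  -- integrable.
  have hwe : unshift 1 b g u = e.op v := by
    refine sub_eq_zero.1 (eq_zero_of_eq_apply hk2 ?_)
    rw [map_sub]
    nth_rw 1 [hw, hev]
    abel
  have hu2 : (u : L2) = e.op (k.op v) := by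
    rw [← hcomm, ← hwe, hk, shiftWeight_op_unshift]
  have hkv : ‖k.op v‖ ≤ 2 * ‖v‖ := by
    refine (ContinuousLinearMap.le_opNorm _ _).trans ?_
    gcongr
    refine norm_mulOp_le _ fun x => ?_
    have := half_le_norm_shiftFun 1 h1 ((x 0 - g) / b)
    simp only [hk, shiftWeight, norm_inv]
    exact inv_le_of_inv_le₀ (by norm_num) (by linarith)
  set y := k.op v with hy
  calc ∫⁻ x, ENNReal.ofReal (Real.exp (2 * α * |x 0 - g|) * ‖(u : L2) x‖ ^ 2)
      ≤ ∫⁻ x, ENNReal.ofReal (‖y x‖ ^ 2) := by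
        refine lintegral_mono_ae ?_
        filter_upwards [e.op_ae y] with x hx
        rw [hu2, hx, norm_mul, mul_pow, ← mul_assoc]
        refine ENNReal.ofReal_le_ofReal (mul_le_of_le_one_left (by positivity) ?_)
        simp only [he, expWeight]
        rw [Complex.norm_real, Real.norm_eq_abs, abs_of_pos (Real.exp_pos _), ← Real.exp_nat_mul,
          ← Real.exp_add, Real.exp_le_one_iff]
        have := mul_le_mul_of_nonneg_left (abs_sub_le_jap g (x 0)) hα
        push_cast
        linarith
    _ = ENNReal.ofReal (‖y‖ ^ 2) := by
        rw [norm_sq_eq_integral, ofReal_integral_eq_lintegral_ofReal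
          ((memLp_two_iff_integrable_sq_norm (Lp.aestronglyMeasurable y)).1 (Lp.memLp y))
          (ae_of_all _ fun x => by positivity)]
    _ ≤ _ := by
        refine ENNReal.ofReal_le_ofReal ?_
        rw [← mul_pow]
        refine pow_le_pow_left₀ (norm_nonneg _) (hkv.trans ?_) 2
        calc 2 * ‖v‖ ≤ 2 * (2 * (C * (c * ‖(u : L2)‖))) := by gcongr
          _ = _ := by ring

end Setting

/-! ### Self-adjoint operators with discrete spectrum -/

section Abstract

variable {E : Type*} [NormedAddCommGroup E] [InnerProductSpace ℂ E]

/-- A symmetric operator which has no proper formal adjoint. -/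
structure IsMaximalSymmetric (T : E →ₗ.[ℂ] E) : Prop where
  symm : ∀ u v : T.domain, inner ℂ (T u) (v : E) = inner ℂ (u : E) (T v)
  maximal : ∀ v z : E, (∀ u : T.domain, inner ℂ v (T u) = inner ℂ z (u : E)) →
    ∃ h : v ∈ T.domain, T ⟨v, h⟩ = z

variable {T : E →ₗ.[ℂ] E}

/-- Given ⟨v, Tu⟩ = ⟨z, u⟩ on the domain, solve (T + iB)w = z + iBv. Then v − w is orthogonal to the
range of T − iB, which is everything. No positivity of B is needed. -/
theorem isMaximalSymmetric_of_surjective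
    (hs : ∀ u v : T.domain, inner ℂ (T u) (v : E) = inner ℂ (u : E) (T v)) (B : E →L[ℂ] E)
    (hB : ∀ u v, inner ℂ (B u) v = inner ℂ u (B v))
    (hp : ∀ f, ∃ u : T.domain, T u + Complex.I • B u = f)
    (hm : ∀ f, ∃ u : T.domain, T u - Complex.I • B u = f) : IsMaximalSymmetric T := by
  refine ⟨hs, fun v z h => ?_⟩
  obtain ⟨w, hw⟩ := hp (z + Complex.I • B v)
  have key : v = w := by
    obtain ⟨u, hu⟩ := hm (v - w)
    have h1 : inner ℂ (v - w) (T u - Complex.I • B u) = 0 := by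
      rw [inner_sub_left, inner_sub_right, inner_sub_right, h, ← hs, inner_smul_right,
        inner_smul_right, ← hB, ← hB]
      have h2 : inner ℂ (T w + Complex.I • B w) (u : E) = inner ℂ (z + Complex.I • B v) (u : E) := by
        rw [hw]
      rw [inner_add_left, inner_add_left, inner_smul_left, inner_smul_left, Complex.conj_I] at h2
      linear_combination -h2
    rw [hu, inner_self_eq_zero, sub_eq_zero] at h1
    exact h1
  subst key
  refine ⟨w.2, ?_⟩
  exact add_right_cancel hw

/-- If y is orthogonal to the domain, write y = (T + iB)u and u = (T − iB)v; then 0 = ⟨y, v⟩ = ⟨u,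
u⟩, so y = 0. -/
theorem dense_domain_of_surjective
    (hs : ∀ u v : T.domain, inner ℂ (T u) (v : E) = inner ℂ (u : E) (T v)) (B : E →L[ℂ] E)
    (hB : ∀ u v, inner ℂ (B u) v = inner ℂ u (B v)) [CompleteSpace E]
    (hp : ∀ f, ∃ u : T.domain, T u + Complex.I • B u = f)
    (hm : ∀ f, ∃ u : T.domain, T u - Complex.I • B u = f) : Dense (T.domain : Set E) := by
  rw [Submodule.dense_iff_topologicalClosure_eq_top, Submodule.topologicalClosure_eq_top_iff,
    Submodule.eq_bot_iff]
  intro y hy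
  rw [Submodule.mem_orthogonal'] at hy
  obtain ⟨u, hu⟩ := hp y
  obtain ⟨v, hv⟩ := hm (u : E)
  have h1 : inner ℂ (u : E) (T v - Complex.I • B v) = 0 := by
    have h2 := hy v v.2
    rw [← hu, inner_add_left, inner_smul_left, Complex.conj_I, hs, hB] at h2
    rw [inner_sub_right, inner_smul_right]
    linear_combination h2
  rw [hv, inner_self_eq_zero] at h1
  have h3 : u = 0 := Subtype.ext h1
  rw [← hu, h3]
  simp

theorem IsMaximalSymmetric.isSelfAdjoint [CompleteSpace E] (h : IsMaximalSymmetric T)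
    (hd : Dense (T.domain : Set E)) : IsSelfAdjoint T := by
  rw [LinearPMap.isSelfAdjoint_def]
  refine le_antisymm ?_ (LinearPMap.IsFormalAdjoint.le_adjoint hd fun u v => h.symm u v)
  refine ⟨fun v hv => ?_, fun x y hxy => ?_⟩
  · obtain ⟨h1, -⟩ := h.maximal v (T.adjoint ⟨v, hv⟩) fun u =>
      ((LinearPMap.adjoint_isFormalAdjoint hd) ⟨v, hv⟩ u).symm
    exact h1
  · obtain ⟨h1, h2⟩ := h.maximal x (T.adjoint x) fun u =>
      ((LinearPMap.adjoint_isFormalAdjoint hd) x u).symm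
    rw [← h2]
    congr 1
    exact Subtype.ext hxy

theorem IsMaximalSymmetric.closed (h : IsMaximalSymmetric T) {ι : Type*} {l : Filter ι} [l.NeBot]
    {u : ι → T.domain} {v z : E} (hu : Tendsto (fun i => (u i : E)) l (𝓝 v))
    (hz : Tendsto (fun i => T (u i)) l (𝓝 z)) : ∃ hv : v ∈ T.domain, T ⟨v, hv⟩ = z := by
  refine h.maximal v z fun w => ?_
  have h1 : Tendsto (fun i => inner ℂ (u i : E) (T w)) l (𝓝 (inner ℂ v (T w))) :=
    hu.inner tendsto_const_nhds
  have h2 : Tendsto (fun i => inner ℂ (T (u i)) (w : E)) l (𝓝 (inner ℂ z (w : E))) :=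
    hz.inner tendsto_const_nhds
  simp only [h.symm] at h2
  exact tendsto_nhds_unique h1 h2

/-- `T - z` as a linear map on the domain. -/
def subSMul (T : E →ₗ.[ℂ] E) (z : ℂ) : T.domain →ₗ[ℂ] E := T.toFun - z • T.domain.subtype

theorem subSMul_apply (z : ℂ) (u : T.domain) : subSMul T z u = T u - z • (u : E) := rfl

theorem IsMaximalSymmetric.closed_subSMul (h : IsMaximalSymmetric T) (z : ℂ) {u : ℕ → T.domain}
    {v y : E} (hu : Tendsto (fun i => (u i : E)) atTop (𝓝 v))
    (hy : Tendsto (fun i => subSMul T z (u i)) atTop (𝓝 y)) :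
    ∃ hv : v ∈ T.domain, subSMul T z ⟨v, hv⟩ = y := by
  obtain ⟨h1, h2⟩ := h.closed (z := y + z • v) hu (by
    have := hy.add (hu.const_smul z)
    simpa [subSMul_apply] using this)
  exact ⟨h1, by rw [subSMul_apply, h2, add_sub_cancel_right]⟩

/-- A point is in the resolvent set if `T - z` is injective and bounded below on a subspace of
finite codimension, and `T - conj z` is injective. -/
theorem IsMaximalSymmetric.not_mem_spec [CompleteSpace E] (h : IsMaximalSymmetric T) {z : ℂ}
    {n : ℕ} (A : E →L[ℂ] (Fin n → ℂ)) {c : ℝ}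
    (hA : ∀ u : T.domain, A u = 0 → ‖(u : E)‖ ≤ c * ‖T u - z • (u : E)‖)
    (h1 : ∀ u : T.domain, T u = z • (u : E) → u = 0)
    (h2 : ∀ u : T.domain, T u = starRingEnd ℂ z • (u : E) → u = 0) : z ∉ spec T := by
  -- On the kernel of A, of finite codimension, T − z is bounded below and closed, so its image is
  -- closed; a finite dimensional enlargement keeps the range closed.
  have hclosed : IsClosed (LinearMap.range (subSMul T z) : Set E) := by
    set s : Submodule ℂ T.domain := LinearMap.ker ((A : E →ₗ[ℂ] (Fin n → ℂ)) ∘ₗ T.domain.subtype)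
    have : s.CoFG := Submodule.CoFG.ker _
    refine LinearMap.isClosed_range_of_isClosed_map_of_finiteDimensional_quotient (s := s) ?_
    refine IsSeqClosed.isClosed fun y y₀ hy hy₀ => ?_
    choose u hus hu using hy
    have hus' : ∀ i, A (u i) = 0 := hus
    have hcau : CauchySeq (fun i => (u i : E)) := by
      have hle : ∀ i j, dist (u i : E) (u j) ≤ (|c| + 1) * dist (y i) (y j) := fun i j => by
        have h3 := hA (u i - u j) (by
          rw [AddSubgroupClass.coe_sub, map_sub, hus', hus', sub_zero])
        rw [← subSMul_apply, map_sub, hu, hu, AddSubgroupClass.coe_sub] at h3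
        rw [dist_eq_norm, dist_eq_norm]
        refine h3.trans (mul_le_mul_of_nonneg_right ?_ (norm_nonneg _))
        linarith [le_abs_self c]
      refine Metric.cauchySeq_iff.2 fun ε hε => ?_
      have hc : 0 < |c| + 1 := by positivity
      obtain ⟨N, hN⟩ := Metric.cauchySeq_iff.1 hy₀.cauchySeq (ε / (|c| + 1)) (by positivity)
      refine ⟨N, fun i hi j hj => (hle i j).trans_lt ?_⟩
      rw [mul_comm, ← lt_div_iff₀ hc]
      exact hN i hi j hj
    obtain ⟨v, hv⟩ := cauchySeq_tendsto_of_complete hcau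
    obtain ⟨hv1, hv2⟩ := h.closed_subSMul z hv (y := y₀) (by simpa only [hu] using hy₀)
    refine ⟨⟨v, hv1⟩, ?_, hv2⟩
    have h3 : Tendsto (fun i => A (u i)) atTop (𝓝 (A v)) := (A.continuous.tendsto v).comp hv
    simp only [hus'] at h3
    exact (tendsto_nhds_unique tendsto_const_nhds h3).symm
  -- A vector orthogonal to the range is, by maximality, in the domain and an eigenvector for the
  -- conjugate of z, hence zero.
  have hrange : LinearMap.range (subSMul T z) = ⊤ := by
    have : CompleteSpace (LinearMap.range (subSMul T z)) := hclosed.completeSpace_coe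
    rw [← Submodule.orthogonal_eq_bot_iff, Submodule.eq_bot_iff]
    intro y hy
    rw [Submodule.mem_orthogonal'] at hy
    obtain ⟨h3, h4⟩ := h.maximal y (starRingEnd ℂ z • y) fun u => by
      have := hy _ ⟨u, rfl⟩
      rw [subSMul_apply, inner_sub_right, sub_eq_zero, inner_smul_right] at this
      rw [this, inner_smul_left, Complex.conj_conj]
    exact congrArg Subtype.val (h2 ⟨y, h3⟩ h4)
  have hinj : Function.Injective (subSMul T z) := by
    rw [← LinearMap.ker_eq_bot, LinearMap.ker_eq_bot']
    intro u hu
    exact h1 u (sub_eq_zero.1 hu)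
  set e := LinearEquiv.ofBijective (subSMul T z) ⟨hinj, LinearMap.range_eq_top.1 hrange⟩ with he
  have he1 : ∀ f, subSMul T z (e.symm f) = f := fun f => e.apply_symm_apply f
  have he2 : ∀ u, e.symm (subSMul T z u) = u := fun u => e.symm_apply_apply u
  set R := T.domain.subtype ∘ₗ (e.symm : E →ₗ[ℂ] T.domain) with hR
  -- Boundedness of the algebraic inverse comes from the closed graph theorem.
  have hc : Continuous R := by
    refine R.continuous_of_seq_closed_graph fun f f₀ y hf hy => ?_
    obtain ⟨h3, h4⟩ := h.closed_subSMul z (u := fun i => e.symm (f i)) (v := y) (y := f₀) hy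
      (by simpa only [he1] using hf)
    have h5 : e.symm f₀ = ⟨y, h3⟩ := by rw [← h4, he2]
    change y = (e.symm f₀ : E)
    rw [h5]
  refine not_not.2 ⟨⟨R, hc⟩, fun f => ⟨(e.symm f).2, he1 f⟩, fun u => ?_⟩
  exact congrArg Subtype.val (he2 u)

theorem im_inner_eq_zero (h : IsMaximalSymmetric T) (u : T.domain) :
    (inner ℂ (u : E) (T u)).im = 0 := by
  rw [← Complex.conj_eq_iff_im, inner_conj_symm, h.symm]

/-- Symmetry gives ‖(T − w)u‖ ≥ |Im w|‖u‖, so the criterion applies with no functionals at all (n =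
0). -/
theorem IsMaximalSymmetric.im_eq_zero [CompleteSpace E] (h : IsMaximalSymmetric T) {z : ℂ}
    (hz : z ∈ spec T) : z.im = 0 := by
  by_contra him
  have key : ∀ w : ℂ, w.im ≠ 0 → ∀ u : T.domain, ‖(u : E)‖ ≤ |w.im|⁻¹ * ‖T u - w • (u : E)‖ := by
    intro w hw u
    have h1 : (inner ℂ (u : E) (T u - w • (u : E))).im = -(w.im * ‖(u : E)‖ ^ 2) := by
      rw [inner_sub_right, inner_smul_right, Complex.sub_im, im_inner_eq_zero h,
        inner_self_eq_norm_sq_to_K]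
      simp [Complex.mul_im, ← Complex.ofReal_pow]
    have h2 : |w.im| * ‖(u : E)‖ ^ 2 ≤ ‖(u : E)‖ * ‖T u - w • (u : E)‖ := by
      refine le_trans (le_of_eq ?_) ((Complex.abs_im_le_norm _).trans (norm_inner_le_norm _ _))
      rw [h1, abs_neg, abs_mul, abs_of_nonneg (sq_nonneg ‖(u : E)‖)]
    have h3 : 0 < |w.im| := abs_pos.2 hw
    rw [← div_eq_inv_mul, le_div_iff₀ h3]
    rcases (norm_nonneg (u : E)).eq_or_lt with h4 | h4
    · rw [← h4, zero_mul]; exact norm_nonneg _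
    · nlinarith
  have inj : ∀ w : ℂ, w.im ≠ 0 → ∀ u : T.domain, T u = w • (u : E) → u = 0 := by
    intro w hw u hu
    have := key w hw u
    rw [hu, sub_self, norm_zero, mul_zero] at this
    exact Subtype.ext (norm_le_zero_iff.1 this)
  exact h.not_mem_spec (n := 0) 0 (fun u _ => key z him u) (inj z him)
    (inj _ (by simpa using him)) hz

theorem mem_eigenspaceOf {z : ℂ} (u : T.domain) (hu : T u = z • (u : E)) :
    (u : E) ∈ eigenspaceOf T z := ⟨u.2, hu⟩

theorem orthogonalFamily_eigenspaceOf (h : IsMaximalSymmetric T) :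
    OrthogonalFamily ℂ (fun g : ℝ => eigenspaceOf T (g : ℂ))
      fun g => (eigenspaceOf T (g : ℂ)).subtypeₗᵢ := by
  intro g g' hne ⟨u, hu, hu'⟩ ⟨v, hv, hv'⟩
  have h1 := h.symm ⟨u, hu⟩ ⟨v, hv⟩
  rw [hu', hv', inner_smul_left, inner_smul_right, Complex.conj_ofReal] at h1
  have h2 : (g : ℂ) - g' ≠ 0 := by
    rw [sub_ne_zero]
    exact_mod_cast hne
  have h3 : ((g : ℂ) - g') * inner ℂ u v = 0 := by linear_combination h1
  exact (mul_eq_zero.1 h3).resolve_left h2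

/-- `A` separates the spectral subspace of `T` for the interval `[a - L, a + L]`. -/
def Separates (T : E →ₗ.[ℂ] E) (a L : ℝ) {n : ℕ} (A : E →L[ℂ] (Fin n → ℂ)) : Prop :=
  ∀ u : T.domain, A u = 0 → ‖T u - (a : ℂ) • (u : E)‖ ≤ L * ‖(u : E)‖ → u = 0

/-- By orthogonality of eigenspaces, a finite combination U of eigenvectors with eigenvalues in [a −
L, a + L] satisfies ‖(T − a)U‖ ≤ L‖U‖. If A also annihilates U, then U and all its components
vanish. -/
theorem Separates.injective (h : IsMaximalSymmetric T) {a L : ℝ} {n : ℕ}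
    {A : E →L[ℂ] (Fin n → ℂ)} (hA : Separates T a L A) (s : Finset ℝ)
    (hs : ∀ g ∈ s, |g - a| ≤ L) :
    Function.Injective ((A : E →ₗ[ℂ] (Fin n → ℂ)) ∘ₗ
      ∑ g : s, (eigenspaceOf T ((g : ℝ) : ℂ)).subtype ∘ₗ
        LinearMap.proj (φ := fun g : s => eigenspaceOf T ((g : ℝ) : ℂ)) g) := by
  have hO : OrthogonalFamily ℂ (fun g : s => eigenspaceOf T ((g : ℝ) : ℂ))
      fun g => (eigenspaceOf T ((g : ℝ) : ℂ)).subtypeₗᵢ :=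
    (orthogonalFamily_eigenspaceOf h).comp Subtype.val_injective
  rw [← LinearMap.ker_eq_bot, LinearMap.ker_eq_bot']
  intro u hu
  choose hd hT using fun g => (u g).2
  set U : T.domain := ∑ g, ⟨(u g : E), hd g⟩ with hU
  have hUE : (U : E) = ∑ g, (u g : E) := by rw [hU, Submodule.coe_sum]
  have hTU : T U = ∑ g : s, ((g : ℝ) : ℂ) • (u g : E) := by
    change T.toFun U = _
    rw [hU, map_sum]
    exact Finset.sum_congr rfl fun g _ => hT g
  have hAU : A U = 0 := by
    rw [hUE]
    simpa [LinearMap.sum_apply] using hu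
  have n1 : ‖(U : E)‖ ^ 2 = ∑ g, ‖u g‖ ^ 2 := by
    rw [hUE]
    exact hO.norm_sum u Finset.univ
  have n2 : ‖T U - (a : ℂ) • (U : E)‖ ^ 2 = ∑ g : s, ((g : ℝ) - a) ^ 2 * ‖u g‖ ^ 2 := by
    have := hO.norm_sum (fun g => (((g : ℝ) : ℂ) - a) • u g) Finset.univ
    rw [hTU, hUE, Finset.smul_sum, ← Finset.sum_sub_distrib]
    simp only [← sub_smul]
    refine this.trans (Finset.sum_congr rfl fun g _ => ?_)
    rw [norm_smul, mul_pow, ← Complex.ofReal_sub, Complex.norm_real, Real.norm_eq_abs, sq_abs]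
  have hU0 : U = 0 := by
    rcases s.eq_empty_or_nonempty with rfl | ⟨g₀, hg₀⟩
    · rw [hU]; simp
    have hL : 0 ≤ L := (abs_nonneg _).trans (hs g₀ hg₀)
    refine hA U hAU ?_
    refine abs_le_of_sq_le_sq' ?_ (by positivity) |>.2
    rw [mul_pow, n1, n2, Finset.mul_sum]
    refine Finset.sum_le_sum fun g _ => ?_
    refine mul_le_mul_of_nonneg_right ?_ (sq_nonneg _)
    exact sq_le_sq' (abs_le.1 (hs g g.2)).1 (abs_le.1 (hs g g.2)).2
  rw [hU0] at n1
  simp only [ZeroMemClass.coe_zero, norm_zero] at n1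
  rw [zero_pow two_ne_zero] at n1
  have n3 := (Finset.sum_eq_zero_iff_of_nonneg fun g _ => sq_nonneg ‖u g‖).1 n1.symm
  ext g
  have := n3 g (Finset.mem_univ g)
  simpa using this

theorem Separates.finiteDimensional {a L : ℝ} {n : ℕ}
    {A : E →L[ℂ] (Fin n → ℂ)} (hA : Separates T a L A) {g : ℝ} (hg : |g - a| ≤ L) :
    FiniteDimensional ℂ (eigenspaceOf T (g : ℂ)) := by
  refine FiniteDimensional.of_injective
    ((A : E →ₗ[ℂ] (Fin n → ℂ)) ∘ₗ (eigenspaceOf T (g : ℂ)).subtype) ?_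
  rw [← LinearMap.ker_eq_bot, LinearMap.ker_eq_bot']
  rintro ⟨u, hu, hu'⟩ hAu
  have := hA ⟨u, hu⟩ hAu (by
    rw [hu', ← sub_smul, norm_smul, ← Complex.ofReal_sub, Complex.norm_real, Real.norm_eq_abs]
    gcongr)
  have h0 : u = 0 := congrArg (fun x : T.domain => (x : E)) this
  exact Subtype.ext h0

theorem Separates.sum_finrank_le (h : IsMaximalSymmetric T) {a L : ℝ} {n : ℕ}
    {A : E →L[ℂ] (Fin n → ℂ)} (hA : Separates T a L A) (s : Finset ℝ)
    (hs : ∀ g ∈ s, |g - a| ≤ L) :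
    ∑ g ∈ s, Module.finrank ℂ (eigenspaceOf T (g : ℂ)) ≤ n := by
  have hf : ∀ g : s, FiniteDimensional ℂ (eigenspaceOf T ((g : ℝ) : ℂ)) :=
    fun g => hA.finiteDimensional (hs g g.2)
  have h1 := LinearMap.finrank_le_finrank_of_injective (hA.injective h s hs)
  rw [Module.finrank_pi_fintype, Module.finrank_fin_fun] at h1
  rw [← Finset.sum_coe_sort]
  exact h1

/-- Separation says that ‖(T − a)u‖ ≥ L‖u‖ on the kernel of A. Without an eigenvector,
`IsMaximalSymmetric.not_mem_spec` would put a into the resolvent set. -/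
theorem Separates.eigenspaceOf_ne_bot [CompleteSpace E] (h : IsMaximalSymmetric T) {a L : ℝ}
    (hL : 0 < L) {n : ℕ} {A : E →L[ℂ] (Fin n → ℂ)} (hA : Separates T a L A)
    (ha : (a : ℂ) ∈ spec T) : eigenspaceOf T (a : ℂ) ≠ ⊥ := by
  intro hbot
  have inj : ∀ u : T.domain, T u = (a : ℂ) • (u : E) → u = 0 := fun u hu => by
    have := mem_eigenspaceOf u hu
    rw [hbot, Submodule.mem_bot] at this
    exact Subtype.ext this
  refine h.not_mem_spec A (c := L⁻¹) (fun u hu => ?_) inj (by rwa [Complex.conj_ofReal]) ha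
  rw [← div_eq_inv_mul, le_div_iff₀ hL]
  by_contra hlt
  rw [not_le] at hlt
  have := hA u hu (by linarith)
  rw [this] at hlt
  simp at hlt

theorem IsMaximalSymmetric.eq_ofReal [CompleteSpace E] (h : IsMaximalSymmetric T) {z : ℂ}
    (hz : z ∈ spec T) : z = (z.re : ℂ) := by
  refine Complex.ext rfl ?_
  rw [h.im_eq_zero hz, Complex.ofReal_im]

/-- Every spectral point is an eigenvalue, and the dimensions of the eigenspaces with eigenvalues in
[a − 1, a + 1] add up to at most n. So only finitely many spectral points lie there, which isolates
a. -/
theorem hasPurelyDiscreteSpectrum_of_separates [CompleteSpace E] (h : IsMaximalSymmetric T)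
    (hsep : ∀ a : ℝ, ∃ (n : ℕ) (A : E →L[ℂ] (Fin n → ℂ)), Separates T a 1 A) :
    HasPurelyDiscreteSpectrum T := by
  intro z hz
  obtain ⟨a, rfl⟩ : ∃ a : ℝ, z = a := ⟨z.re, h.eq_ofReal hz⟩
  obtain ⟨n, A, hA⟩ := hsep a
  refine ⟨?_, hA.eigenspaceOf_ne_bot h one_pos hz, hA.finiteDimensional (by simp)⟩
  set S : Set ℝ := {g | |g - a| ≤ 1 ∧ (g : ℂ) ∈ spec T} with hS
  have hpos : ∀ g ∈ S, 1 ≤ Module.finrank ℂ (eigenspaceOf T (g : ℂ)) := by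
    intro g hg
    obtain ⟨n', A', hA'⟩ := hsep g
    have := hA.finiteDimensional hg.1
    rw [Nat.one_le_iff_ne_zero]
    intro h0
    exact hA'.eigenspaceOf_ne_bot h one_pos hg.2 (Submodule.finrank_eq_zero.1 h0)
  have hfin : S.Finite := by
    by_contra hinf
    obtain ⟨s, hs, hcard⟩ := Set.Infinite.exists_subset_card_eq hinf (n + 1)
    have h1 := hA.sum_finrank_le h s fun g hg => (hs hg).1
    have h2 : ∑ _g ∈ s, 1 ≤ ∑ g ∈ s, Module.finrank ℂ (eigenspaceOf T (g : ℂ)) :=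
      Finset.sum_le_sum fun g hg => hpos g (hs hg)
    rw [Finset.sum_const, hcard] at h2
    simp at h2
    omega
  have hclosed : IsClosed (S \ {a}) := (hfin.subset sdiff_subset).isClosed
  obtain ⟨ε, hε, hball⟩ := Metric.isOpen_iff.1 hclosed.isOpen_compl a (by simp)
  refine ⟨min ε 1, lt_min hε one_pos, fun w hw hne => ?_⟩
  obtain ⟨g, rfl⟩ : ∃ g : ℝ, w = g := ⟨w.re, h.eq_ofReal hw⟩
  by_contra hlt
  rw [not_le, lt_min_iff] at hlt
  have hd : dist (g : ℂ) a = |g - a| := by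
    rw [Complex.dist_eq, ← Complex.ofReal_sub, Complex.norm_real, Real.norm_eq_abs]
  rw [hd] at hlt
  exact hball (a := g) (by rw [Metric.mem_ball, Real.dist_eq]; exact hlt.1)
    ⟨⟨hlt.2.le, hw⟩, fun h => hne (by rw [h])⟩

theorem Separates.totalMultiplicity_le (h : IsMaximalSymmetric T) {a L : ℝ} {n : ℕ}
    {A : E →L[ℂ] (Fin n → ℂ)} (hA : Separates T a L A) :
    totalMultiplicity T (a - L) (a + L) ≤ n := by
  rw [totalMultiplicity, ENNReal.tsum_eq_iSup_sum]
  refine iSup_le fun s => ?_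
  have hmem : ∀ g ∈ s.map (Function.Embedding.subtype _), |g - a| ≤ L := by
    intro g hg
    obtain ⟨g', -, rfl⟩ := Finset.mem_map.1 hg
    have := g'.2.1
    rw [abs_le]
    constructor <;> simp <;> linarith [this.1, this.2]
  have h1 := hA.sum_finrank_le h _ hmem
  rw [Finset.sum_map] at h1
  have h2 : ∀ g ∈ s, ((Cardinal.toENat (Module.rank ℂ (eigenspaceOf T ((g : ℝ) : ℂ))) : ℕ∞)
      : ENNReal) = (Module.finrank ℂ (eigenspaceOf T ((g : ℝ) : ℂ)) : ENNReal) := by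
    intro g hg
    have := hA.finiteDimensional (hmem g (Finset.mem_map_of_mem _ hg))
    rw [← Module.finrank_eq_rank, map_natCast, ENat.toENNReal_coe]
  rw [Finset.sum_congr rfl h2]
  exact_mod_cast h1

end Abstract

/-! ### Translations -/

theorem ofReal_norm_sq_eq_lintegral (v : L2) : ENNReal.ofReal (‖v‖ ^ 2) = ∫⁻ x, ‖v x‖ₑ ^ 2 := by
  rw [norm_sq_eq_integral, ofReal_integral_eq_lintegral_ofReal
    ((memLp_two_iff_integrable_sq_norm (Lp.aestronglyMeasurable v)).1 (Lp.memLp v))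
    (ae_of_all _ fun x => by positivity)]
  refine lintegral_congr fun x => ?_
  rw [ENNReal.ofReal_pow (norm_nonneg _), ofReal_norm]

theorem sq_lintegral_le {α : Type*} [MeasurableSpace α] (μ : Measure α) {f : α → ENNReal}
    (hf : AEMeasurable f μ) : (∫⁻ x, f x ∂μ) ^ 2 ≤ μ univ * ∫⁻ x, f x ^ 2 ∂μ := by
  have h := ENNReal.lintegral_mul_le_Lp_mul_Lq μ Real.HolderConjugate.two_two
    (aemeasurable_const (b := (1 : ENNReal))) hf
  have h2 := pow_le_pow_left₀ zero_le h 2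
  rw [mul_pow, ← ENNReal.rpow_natCast (_ ^ (1 / (2 : ℝ))), ← ENNReal.rpow_natCast (_ ^ (1 / (2 : ℝ))),
    ← ENNReal.rpow_mul, ← ENNReal.rpow_mul] at h2
  simpa using h2

/-- Write the difference as the integral of the derivative along the segment from x to x + h, then
apply Cauchy–Schwarz in t and translation invariance in x. -/
theorem lintegral_sub_translate_le (φ : TestFun) (h : R3) :
    ∫⁻ x, ‖φ.1 (x + h) - φ.1 x‖ₑ ^ 2 ≤ ‖h‖ₑ ^ 2 * ∫⁻ x, gradSq φ x := by
  have hmeas : Measurable fun p : R3 × ℝ => gradSq φ (p.1 + p.2 • h) :=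
    (measurable_gradSq φ).comp (by fun_prop)
  have hpt : ∀ x, ‖φ.1 (x + h) - φ.1 x‖ₑ ^ 2
      ≤ ∫⁻ t in Ioc (0 : ℝ) 1, ‖h‖ₑ ^ 2 * gradSq φ (x + t • h) := by
    intro x
    have hder : ∀ t : ℝ, HasDerivAt (fun t : ℝ => φ.1 (x + t • h)) (fderiv ℝ φ.1 (x + t • h) h) t := by
      intro t
      have h1 : HasDerivAt (fun t : ℝ => x + t • h) h t := by
        simpa using ((hasDerivAt_id t).smul_const h).const_add x
      exact (φ.differentiable (x + t • h)).hasFDerivAt.comp_hasDerivAt t h1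
    have hcont : Continuous fun t : ℝ => fderiv ℝ φ.1 (x + t • h) h := by
      have := φ.contDiff.continuous_fderiv (by simp)
      fun_prop
    have h1 : φ.1 (x + h) - φ.1 x = ∫ t in Ioc (0 : ℝ) 1, fderiv ℝ φ.1 (x + t • h) h := by
      rw [← intervalIntegral.integral_of_le zero_le_one,
        intervalIntegral.integral_eq_sub_of_hasDerivAt (fun t _ => hder t)
          (hcont.intervalIntegrable _ _)]
      simp
    rw [h1]
    refine (pow_le_pow_left₀ zero_le (enorm_integral_le_lintegral_enorm _) 2).trans ?_
    refine (sq_lintegral_le _ hcont.enorm.measurable.aemeasurable).trans ?_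
    simp only [Measure.restrict_apply_univ, Real.volume_Ioc, sub_zero, ENNReal.ofReal_one, one_mul]
    refine lintegral_mono fun t => ?_
    refine (pow_le_pow_left₀ zero_le (ContinuousLinearMap.le_opENorm _ _) 2).trans ?_
    rw [mul_pow, mul_comm]
    gcongr
    exact enorm_fderiv_sq_le φ.1 _
  refine (lintegral_mono hpt).trans ?_
  rw [lintegral_lintegral_swap ((hmeas.const_mul _).aemeasurable)]
  have h2 : ∀ t : ℝ, ∫⁻ x, ‖h‖ₑ ^ 2 * gradSq φ (x + t • h) = ‖h‖ₑ ^ 2 * ∫⁻ x, gradSq φ x := by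
    intro t
    have h3 : Measurable fun x => gradSq φ (x + t • h) :=
      (measurable_gradSq φ).comp (measurable_id.add_const (t • h))
    rw [lintegral_const_mul _ h3, lintegral_add_right_eq_self (fun x => gradSq φ x)]
  simp only [h2]
  simp

/-- Translation by `h` on `L²`. -/
def translate (h : R3) : L2 →+ L2 :=
  Lp.compMeasurePreserving (fun x => x + h) (measurePreserving_add_right volume h)

theorem translate_ae (h : R3) (u : L2) :
    (translate h u : R3 → ℂ) =ᵐ[volume] fun x => u (x + h) :=
  Lp.coeFn_compMeasurePreserving u (measurePreserving_add_right volume h)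

theorem continuous_translate (h : R3) : Continuous (translate h) :=
  (Lp.isometry_compMeasurePreserving (measurePreserving_add_right volume h)).continuous

theorem norm_translate_testToL2_sub_le (φ : TestFun) (h : R3) :
    ‖translate h (testToL2 φ) - testToL2 φ‖ ^ 2 ≤ ‖h‖ ^ 2 * gradNormSq φ := by
  have h0 := gradNormSq_nonneg φ
  rw [← ENNReal.ofReal_le_ofReal_iff (by positivity), ofReal_norm_sq_eq_lintegral,
    ENNReal.ofReal_mul (by positivity), ← lintegral_gradSq_eq, ENNReal.ofReal_pow (norm_nonneg _),
    ofReal_norm]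
  refine le_trans (le_of_eq ?_) (lintegral_sub_translate_le φ h)
  refine lintegral_congr_ae ?_
  have h1 := (measurePreserving_add_right volume h).quasiMeasurePreserving.ae (testToL2_ae φ)
  filter_upwards [Lp.coeFn_sub (translate h (testToL2 φ)) (testToL2 φ),
    translate_ae h (testToL2 φ), testToL2_ae φ, h1] with x a1 a2 a3 a4
  rw [a1, Pi.sub_apply, a2, a3, a4]

/-! ### Functions with vanishing averages over small balls -/

/-- A function with vanishing integrals over a family of balls of radius `r` is controlled on their
union by its translates. -/
theorem lintegral_iUnion_closedBall_le {f : R3 → ℂ} (hf : Measurable f) {ι : Type*}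
    (c : ι → R3) {r : ℝ} (hr : 0 < r) (hint : ∀ i, IntegrableOn f (Metric.closedBall (c i) r))
    (h0 : ∀ i, ∫ x in Metric.closedBall (c i) r, f x = 0) {B : ENNReal}
    (hB : ∀ h : R3, ‖h‖ ≤ 2 * r → ∫⁻ x, ‖f (x + h) - f x‖ₑ ^ 2 ≤ B) :
    ∫⁻ x in ⋃ i, Metric.closedBall (c i) r, ‖f x‖ₑ ^ 2 ≤ 8 * B := by
  set m := volume (Metric.closedBall (0 : R3) r) with hm
  have hm0 : m ≠ 0 := (Metric.measure_closedBall_pos volume _ hr).ne'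
  have hmt : m ≠ ⊤ := measure_closedBall_lt_top.ne
  have hmi : ∀ i, volume (Metric.closedBall (c i) r) = m := fun i =>
    Measure.addHaar_closedBall_center volume (c i) r
  set G : R3 → ENNReal := fun x => ∫⁻ h in Metric.closedBall (0 : R3) (2 * r),
    ‖f (x + h) - f x‖ₑ ^ 2 with hG
  have hmeas : Measurable fun p : R3 × R3 => ‖f (p.1 + p.2) - f p.1‖ₑ ^ 2 := by fun_prop
  -- For x in a ball Q with zero average, m f(x) is the integral of f(x) − f(y) over y in Q.
  -- Cauchy–Schwarz and y = x + h with |h| ≤ 2r bound it by a quantity independent of the ball, so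
  -- overlaps cost nothing.
  have key : ∀ x ∈ ⋃ i, Metric.closedBall (c i) r, m * ‖f x‖ₑ ^ 2 ≤ G x := by
    intro x hx
    obtain ⟨i, hi⟩ := mem_iUnion.1 hx
    set Q := Metric.closedBall (c i) r with hQ
    have hQm : MeasurableSet Q := Metric.isClosed_closedBall.measurableSet
    have e1 : ∫ y in Q, (f x - f y) = (volume.real Q : ℂ) * f x := by
      have e0 : IntegrableOn (fun _ => f x) Q := integrableOn_const (by rw [hmi]; exact hmt)
      rw [integral_sub e0 (hint i), h0, sub_zero, setIntegral_const, Complex.real_smul]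
    have e2 : ‖(volume.real Q : ℂ) * f x‖ₑ = m * ‖f x‖ₑ := by
      rw [enorm_mul, ← ofReal_norm (volume.real Q : ℂ), Complex.norm_real, Real.norm_eq_abs,
        abs_of_nonneg measureReal_nonneg, Measure.real, hmi, ENNReal.ofReal_toReal hmt]
    have hfm : Measurable fun y => ‖f x - f y‖ₑ := by fun_prop
    have h1 : (m * ‖f x‖ₑ) ^ 2 ≤ m * ∫⁻ y in Q, ‖f x - f y‖ₑ ^ 2 := by
      rw [← e2, ← e1]
      refine (pow_le_pow_left₀ zero_le (enorm_integral_le_lintegral_enorm _) 2).trans ?_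
      refine (sq_lintegral_le _ hfm.aemeasurable).trans ?_
      rw [Measure.restrict_apply_univ, hmi]
    have h2 : m * ‖f x‖ₑ ^ 2 ≤ ∫⁻ y in Q, ‖f x - f y‖ₑ ^ 2 := by
      rw [mul_pow, sq m, mul_assoc] at h1
      exact (ENNReal.mul_le_mul_iff_right hm0 hmt).1 h1
    refine h2.trans ?_
    rw [← lintegral_indicator hQm, ← lintegral_add_left_eq_self _ x,
      hG]
    change _ ≤ ∫⁻ h in Metric.closedBall (0 : R3) (2 * r), ‖f (x + h) - f x‖ₑ ^ 2
    rw [← lintegral_indicator Metric.isClosed_closedBall.measurableSet]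
    refine lintegral_mono fun h => ?_
    by_cases hh : x + h ∈ Q
    · have hd : h ∈ Metric.closedBall (0 : R3) (2 * r) := by
        rw [mem_closedBall_zero_iff]
        have h3 := dist_triangle_right (x + h) x (c i)
        rw [dist_eq_norm, add_sub_cancel_left] at h3
        linarith [Metric.mem_closedBall.1 hh, Metric.mem_closedBall.1 hi]
      rw [indicator_of_mem hh, indicator_of_mem hd, ← enorm_neg, neg_sub]
    · rw [indicator_of_notMem hh]
      exact zero_le
  -- The factor 8 = 2³ is the volume ratio in dimension three.
  have hball : volume (Metric.closedBall (0 : R3) (2 * r)) = 8 * m := by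
    rw [hm, Measure.addHaar_closedBall_mul volume (0 : R3) zero_le_two hr.le]
    congr 1
    rw [finrank_euclideanSpace_fin]
    norm_num
  have h3 : m * ∫⁻ x in ⋃ i, Metric.closedBall (c i) r, ‖f x‖ₑ ^ 2 ≤ m * (8 * B) := by
    rw [← lintegral_const_mul _ (hf.enorm.pow_const 2)]
    calc ∫⁻ x in ⋃ i, Metric.closedBall (c i) r, m * ‖f x‖ₑ ^ 2
        ≤ ∫⁻ x in ⋃ i, Metric.closedBall (c i) r, G x :=
          setLIntegral_mono (Measurable.lintegral_prod_right' hmeas) key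
      _ ≤ ∫⁻ x, G x := setLIntegral_le_lintegral _ _
      _ = ∫⁻ h in Metric.closedBall (0 : R3) (2 * r), ∫⁻ x, ‖f (x + h) - f x‖ₑ ^ 2 :=
          lintegral_lintegral_swap hmeas.aemeasurable
      _ ≤ ∫⁻ _h in Metric.closedBall (0 : R3) (2 * r), B :=
          setLIntegral_mono measurable_const fun h hh => hB h (mem_closedBall_zero_iff.1 hh)
      _ = m * (8 * B) := by
          rw [setLIntegral_const, hball]
          ring
  exact (ENNReal.mul_le_mul_iff_right hm0 hmt).1 h3

/-! ### A covering of a box by balls -/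

/-- The points of a cubic lattice of mesh `s` in a box around `(a, 0, 0)`. -/
def latticePoint (a s : ℝ) (z : ℤ × ℤ × ℤ) : R3 := !₂[a + s * z.1, s * z.2.1, s * z.2.2]

/-- The index set of the covering. -/
def latticeBox (k l : ℕ) : Finset (ℤ × ℤ × ℤ) :=
  Finset.Icc (-k : ℤ) k ×ˢ Finset.Icc (-l : ℤ) l ×ˢ Finset.Icc (-l : ℤ) l

theorem card_latticeBox (k l : ℕ) : (latticeBox k l).card = (2 * k + 1) * (2 * l + 1) ^ 2 := by
  rw [latticeBox, Finset.card_product, Finset.card_product, Int.card_Icc, Int.card_Icc]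
  have h1 : ((k : ℤ) + 1 - -k).toNat = 2 * k + 1 := by omega
  have h2 : ((l : ℤ) + 1 - -l).toNat = 2 * l + 1 := by omega
  rw [h1, h2]
  ring

theorem exists_lattice_coord {s t : ℝ} (hs : 0 < s) {k : ℕ} (ht : |t| ≤ k * s) :
    ∃ z : ℤ, z ∈ Finset.Icc (-k : ℤ) k ∧ |t - s * z| ≤ s := by
  refine ⟨⌊t / s⌋, ?_, ?_⟩
  · rw [abs_le] at ht
    rw [Finset.mem_Icc]
    constructor
    · rw [Int.le_floor, le_div_iff₀ hs]
      push_cast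
      linarith
    · have h1 : t / s ≤ k := by rw [div_le_iff₀ hs]; exact ht.2
      have h2 := Int.floor_le (t / s)
      exact_mod_cast h2.trans h1
  · have h1 := Int.floor_le (t / s)
    have h2 := Int.lt_floor_add_one (t / s)
    rw [le_div_iff₀ hs] at h1
    rw [div_lt_iff₀ hs] at h2
    rw [abs_le]
    constructor <;> linarith

/-- Rounding each coordinate down errs by at most s, so the distance is at most √3·s ≤ 2s. -/
theorem exists_mem_closedBall_latticePoint {a s : ℝ} (hs : 0 < s) {k l : ℕ} {x : R3}
    (h0 : |x 0 - a| ≤ k * s) (h1 : |x 1| ≤ l * s) (h2 : |x 2| ≤ l * s) :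
    ∃ z ∈ latticeBox k l, x ∈ Metric.closedBall (latticePoint a s z) (2 * s) := by
  obtain ⟨z0, hz0, h0⟩ := exists_lattice_coord hs h0
  obtain ⟨z1, hz1, h1⟩ := exists_lattice_coord hs h1
  obtain ⟨z2, hz2, h2⟩ := exists_lattice_coord hs h2
  refine ⟨(z0, z1, z2), Finset.mem_product.2 ⟨hz0, Finset.mem_product.2 ⟨hz1, hz2⟩⟩, ?_⟩
  rw [Metric.mem_closedBall, EuclideanSpace.dist_eq]
  refine Real.sqrt_le_iff.2 ⟨by positivity, ?_⟩
  rw [Fin.sum_univ_three]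
  simp only [Real.dist_eq, sq_abs, latticePoint]
  have e0 : (x 0 - (a + s * z0)) ^ 2 ≤ s ^ 2 := by
    rw [← sq_abs, ← sub_sub]; exact pow_le_pow_left₀ (abs_nonneg _) h0 2
  have e1 : (x 1 - s * z1) ^ 2 ≤ s ^ 2 := by
    rw [← sq_abs]; exact pow_le_pow_left₀ (abs_nonneg _) h1 2
  have e2 : (x 2 - s * z2) ^ 2 ≤ s ^ 2 := by
    rw [← sq_abs]; exact pow_le_pow_left₀ (abs_nonneg _) h2 2
  simp
  nlinarith [sq_nonneg s]

/-- The integrals over the balls around the lattice points. -/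
def ballIntegrals (a s : ℝ) (k l : ℕ) : L2 →L[ℂ] (Fin (latticeBox k l).card → ℂ) :=
  ContinuousLinearMap.pi fun i => innerSL ℂ (indicatorConstLp 2
    (Metric.isClosed_closedBall (x := latticePoint a s ((latticeBox k l).equivFin.symm i))
      (ε := 2 * s)).measurableSet measure_closedBall_lt_top.ne (1 : ℂ))

theorem ballIntegrals_eq_zero {a s : ℝ} {k l : ℕ} {u : L2} (h : ballIntegrals a s k l u = 0)
    (z : latticeBox k l) : ∫ x in Metric.closedBall (latticePoint a s z) (2 * s), u x = 0 := by
  have h1 := congrFun h ((latticeBox k l).equivFin z)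
  rw [ballIntegrals, ContinuousLinearMap.pi_apply, innerSL_apply_apply,
    L2.inner_indicatorConstLp_one] at h1
  simpa using h1

/-! ### Counting eigenvalues -/

namespace Setting

variable (𝒮 : Setting)

/-- Vectors in Ran P have the form R₀Gu, and the gradient of R₀f is bounded by ‖f‖. This is the H¹
bound, expressed through translations so that no weak derivatives are needed. -/
theorem exists_translate_le : ∃ C : ℝ, 0 ≤ C ∧ ∀ u : L2, 𝒮.P u = u → ∀ h : R3,
    ∫⁻ x, ‖u (x + h) - u x‖ₑ ^ 2 ≤ ENNReal.ofReal ((C * ‖h‖ * ‖u‖) ^ 2) := by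
  obtain ⟨-, -, G, hG1, -⟩ := 𝒮.P_properties
  obtain ⟨C, hC0, hC⟩ := 𝒮.exists_gradNormSq_le
  have hR : ∀ (h : R3) (f : L2), ‖translate h (𝒮.R₀ f) - 𝒮.R₀ f‖ ≤ C * ‖h‖ * ‖f‖ := by
    intro h f
    have hc := continuous_translate h
    refine 𝒮.dense_test.induction_on
      (p := fun f => ‖translate h (𝒮.R₀ f) - 𝒮.R₀ f‖ ≤ C * ‖h‖ * ‖f‖) f
      (isClosed_le (by fun_prop) (by fun_prop)) fun φ => ?_
    rw [R₀, 𝒮.R_test 𝒮.hx₀]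
    refine abs_le_of_sq_le_sq' ?_ (by positivity) |>.2
    refine (norm_translate_testToL2_sub_le φ h).trans ?_
    have := mul_le_mul_of_nonneg_left (hC φ) (sq_nonneg ‖h‖)
    nlinarith
  refine ⟨C * ‖G‖, by positivity, fun u hu h => ?_⟩
  have hu' : u = 𝒮.R₀ (G u) := by
    nth_rw 1 [← hu, hG1]
    rfl
  have h1 : ‖translate h u - u‖ ≤ C * ‖G‖ * ‖h‖ * ‖u‖ := by
    have h2 := hR h (G u)
    rw [← hu'] at h2
    refine h2.trans ?_
    have := mul_le_mul_of_nonneg_left (G.le_opNorm u) (mul_nonneg hC0 (norm_nonneg h))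
    linarith
  refine le_trans (le_of_eq ?_) (ENNReal.ofReal_le_ofReal (pow_le_pow_left₀ (norm_nonneg _) h1 2))
  rw [ofReal_norm_sq_eq_lintegral]
  refine lintegral_congr_ae ?_
  filter_upwards [Lp.coeFn_sub (translate h u) u, translate_ae h u] with x a1 a2
  rw [a1, Pi.sub_apply, a2]

theorem setLIntegral_norm_sq_le {u : L2} {w : R3 → ℝ} {C c : ℝ} {S : Set R3}
    (hS : MeasurableSet S) (hc : 0 < c) (hw : ∀ x ∈ S, c ≤ w x)
    (h : ∫⁻ x, ENNReal.ofReal (w x * ‖u x‖ ^ 2) ≤ ENNReal.ofReal C) :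
    ∫⁻ x in S, ‖u x‖ₑ ^ 2 ≤ ENNReal.ofReal (C / c) := by
  have h1 : ENNReal.ofReal c * ∫⁻ x in S, ‖u x‖ₑ ^ 2 ≤ ENNReal.ofReal C := by
    rw [← lintegral_const_mul' _ _ ENNReal.ofReal_ne_top]
    refine le_trans ?_ h
    refine le_trans ?_ (setLIntegral_le_lintegral S _)
    refine lintegral_mono_ae ((ae_restrict_mem hS).mono fun x hx => ?_)
    rw [← ofReal_norm, ← ENNReal.ofReal_pow (norm_nonneg _), ← ENNReal.ofReal_mul hc.le]
    exact ENNReal.ofReal_le_ofReal (mul_le_mul_of_nonneg_right (hw x hx) (by positivity))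
  rw [ENNReal.ofReal_div_of_pos hc, ENNReal.le_div_iff_mul_le
    (Or.inl (by simpa using hc)) (Or.inl ENNReal.ofReal_ne_top), mul_comm]
  exact h1

/-- Chebyshev with the transverse weight: ρ is chosen so that exp(2αρ) = 4C + 1, and C/(4C + 1) ≤
1/4. -/
theorem exists_perp_tail : ∃ ρ : ℝ, 0 ≤ ρ ∧ ∀ u : L2, 𝒮.P u = u →
    ∫⁻ x in {x : R3 | ρ ≤ perpNorm x}, ‖u x‖ₑ ^ 2 ≤ ENNReal.ofReal (1 / 4 * ‖u‖ ^ 2) := by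
  have hE : 0 < Real.sqrt 𝒮.Eplus := Real.sqrt_pos.2 𝒮.hE
  set α := Real.sqrt 𝒮.Eplus / 2 with hα
  have hα0 : 0 < α := by positivity
  obtain ⟨C, hC0, hC⟩ := 𝒮.exists_perp_decay hα0.le (by rw [hα]; linarith)
  have h4 : (1 : ℝ) ≤ 4 * C + 1 := by linarith
  set ρ := Real.log (4 * C + 1) / (2 * α) with hρ
  refine ⟨ρ, div_nonneg (Real.log_nonneg h4) (by positivity), fun u hu => ?_⟩
  have hS : MeasurableSet {x : R3 | ρ ≤ perpNorm x} :=
    (isClosed_le continuous_const continuous_perpNorm).measurableSet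
  refine (setLIntegral_norm_sq_le hS (c := 4 * C + 1) (by linarith) (fun x hx => ?_)
    (hC u hu)).trans (ENNReal.ofReal_le_ofReal ?_)
  · have hx' : ρ ≤ perpNorm x := hx
    rw [hρ, div_le_iff₀ (by positivity)] at hx'
    rw [← Real.log_le_iff_le_exp (by linarith)]
    linarith
  · rw [div_le_iff₀ (by linarith)]
    nlinarith [sq_nonneg ‖u‖]

/-- Solving the equation for w = `unshift` gives ‖w‖ ≤ 2(L + 1)‖u‖ ≤ 4L‖u‖, while |s||u| ≤ |w|
pointwise. Where |x₁ − a| ≥ 8bL one has |s| ≥ 8L, so the mass there is at most (4L)²/(8L)² = 1/4 of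
the total. -/
theorem exists_parallel_tail : ∃ Λ : ℝ, 0 < Λ ∧ ∀ (a L : ℝ), 1 ≤ L → ∀ u : positionDomain,
    𝒮.P u = u → ‖𝒮.P (coordMul u) - (a : ℂ) • (u : L2)‖ ≤ L * ‖(u : L2)‖ →
    ∫⁻ x in {x : R3 | Λ * L ≤ |x 0 - a|}, ‖(u : L2) x‖ₑ ^ 2
      ≤ ENNReal.ofReal (1 / 4 * ‖(u : L2)‖ ^ 2) := by
  obtain ⟨b, hb1, hb⟩ := 𝒮.exists_shift_bound
  have hb0 : 0 < b := by linarith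
  refine ⟨8 * b, by positivity, fun a L hL u hu huL => ?_⟩
  have h1 : (1 : ℝ) ^ 2 = 1 := one_pow 2
  obtain ⟨hk1, hk2⟩ := hb 1 b a h1 le_rfl
  set w := unshift 1 b a u with hw
  have hwn : ‖w‖ ≤ 4 * L * ‖(u : L2)‖ := by
    refine (norm_le_two_mul_of_eq_apply_add hk2 (unshift_eq hk1 u hu)).trans ?_
    have n1 : ‖(b : ℂ)⁻¹ • (𝒮.P (coordMul u) - (a : ℂ) • (u : L2))‖ ≤ L * ‖(u : L2)‖ := by
      rw [norm_smul, norm_inv, Complex.norm_real, Real.norm_eq_abs, abs_of_pos hb0]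
      refine (mul_le_of_le_one_left (norm_nonneg _) (inv_le_one_of_one_le₀ hb1)).trans huL
    have n2 : ‖(Complex.I * ((1 : ℝ) : ℂ)) • 𝒮.P (gaussOp b a u)‖ ≤ 1 * ‖(u : L2)‖ := by
      rw [norm_smul, Complex.ofReal_one, mul_one, Complex.norm_I, one_mul]
      refine (𝒮.norm_P_le _).trans ((ContinuousLinearMap.le_opNorm _ _).trans ?_)
      gcongr
      exact norm_gaussOp_le b a
    have n3 := mul_le_mul_of_nonneg_right hL (norm_nonneg (u : L2))
    have := norm_add_le ((b : ℂ)⁻¹ • (𝒮.P (coordMul u) - (a : ℂ) • (u : L2)))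
      ((Complex.I * ((1 : ℝ) : ℂ)) • 𝒮.P (gaussOp b a u))
    linarith
  have hku : (u : L2) = (shiftWeight 1 b a h1).op w := (shiftWeight_op_unshift 1 b a h1 u).symm
  have hS : MeasurableSet {x : R3 | 8 * b * L ≤ |x 0 - a|} :=
    (isClosed_le continuous_const (by fun_prop)).measurableSet
  have hle : ∫⁻ x, ENNReal.ofReal (((x 0 - a) / b) ^ 2 * ‖(u : L2) x‖ ^ 2)
      ≤ ENNReal.ofReal (‖w‖ ^ 2) := by
    rw [ofReal_norm_sq_eq_lintegral]
    refine lintegral_mono_ae ?_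
    filter_upwards [shiftWeight_op_ae 1 b a h1 w] with x hx
    rw [← ofReal_norm, ← ENNReal.ofReal_pow (norm_nonneg _), hku, hx, norm_mul, norm_inv]
    refine ENNReal.ofReal_le_ofReal ?_
    have n0 := half_le_norm_shiftFun 1 h1 ((x 0 - a) / b)
    have n1 := abs_le_norm_shiftFun 1 h1 ((x 0 - a) / b)
    rw [mul_pow, ← mul_assoc]
    refine mul_le_of_le_one_left (by positivity) ?_
    rw [← mul_pow, ← div_eq_mul_inv, ← sq_abs, abs_div, abs_of_nonneg (norm_nonneg _)]
    exact pow_le_one₀ (by positivity) (div_le_one_of_le₀ n1 (norm_nonneg _))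
  refine (setLIntegral_norm_sq_le hS (c := (8 * L) ^ 2) (by positivity) (fun x hx => ?_)
    hle).trans (ENNReal.ofReal_le_ofReal ?_)
  · have hx' : 8 * b * L ≤ |x 0 - a| := hx
    rw [← sq_abs ((x 0 - a) / b), abs_div, abs_of_pos hb0]
    refine pow_le_pow_left₀ (by positivity) ?_ 2
    rw [le_div_iff₀ hb0]
    linarith
  · rw [div_le_iff₀ (by positivity)]
    have := pow_le_pow_left₀ (norm_nonneg w) hwn 2
    nlinarith

/-- The space splits into a box covered by O(L) balls and two tails. Each of the three pieces
carries at most a quarter of the mass of u, which forces u = 0. -/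
theorem exists_separating : ∃ M : ℝ, ∀ a L : ℝ, 1 ≤ L →
    ∃ (n : ℕ) (A : L2 →L[ℂ] (Fin n → ℂ)), (n : ℝ) ≤ M * L ∧ ∀ u : positionDomain, 𝒮.P u = u →
      A u = 0 → ‖𝒮.P (coordMul u) - (a : ℂ) • (u : L2)‖ ≤ L * ‖(u : L2)‖ → (u : L2) = 0 := by
  obtain ⟨ρ, hρ0, hρ⟩ := 𝒮.exists_perp_tail
  obtain ⟨Λ, hΛ0, hΛ⟩ := 𝒮.exists_parallel_tail
  obtain ⟨C, hC0, hC⟩ := 𝒮.exists_translate_le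
  -- The balls have radius 2s, so translations up to 4s enter; C·4s ≤ 1/8 gives 8·(1/8)² = 1/8 ≤ 1/4
  -- on the box.
  set s : ℝ := 1 / (32 * (C + 1)) with hs
  have hs0 : 0 < s := by positivity
  have hCs : C * s ≤ 1 / 32 := by
    rw [hs, mul_one_div, div_le_div_iff₀ (by positivity) (by norm_num)]
    linarith
  set l : ℕ := ⌈ρ / s⌉₊ with hl
  have hls : ρ ≤ l * s := by
    rw [← div_le_iff₀ hs0]
    exact Nat.le_ceil _
  refine ⟨(2 * Λ / s + 3) * (2 * l + 1) ^ 2, fun a L hL => ?_⟩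
  set k : ℕ := ⌈Λ * L / s⌉₊ with hk
  have hks : Λ * L ≤ k * s := by
    rw [← div_le_iff₀ hs0]
    exact Nat.le_ceil _
  refine ⟨_, ballIntegrals a s k l, ?_, fun u hu hA huL => ?_⟩
  · rw [card_latticeBox]
    push_cast
    have h1 : (k : ℝ) ≤ Λ * L / s + 1 := (Nat.ceil_lt_add_one (by positivity)).le
    have h2 : (2 * (k : ℝ) + 1) ≤ (2 * Λ / s + 3) * L := by
      have : 2 * (Λ * L / s) = 2 * Λ / s * L := by ring
      linarith
    calc (2 * (k : ℝ) + 1) * (2 * l + 1) ^ 2 ≤ (2 * Λ / s + 3) * L * (2 * l + 1) ^ 2 := by gcongr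
      _ = _ := by ring
  · set v : L2 := (u : L2) with hv
    set U : Set R3 := ⋃ z : latticeBox k l, Metric.closedBall (latticePoint a s z) (2 * s) with hU
    set S₁ : Set R3 := {x | Λ * L ≤ |x 0 - a|} with hS₁
    set S₂ : Set R3 := {x | ρ ≤ perpNorm x} with hS₂
    have hcover : (univ : Set R3) ⊆ U ∪ (S₁ ∪ S₂) := by
      intro x _
      by_cases h1 : x ∈ S₁
      · exact Or.inr (Or.inl h1)
      by_cases h2 : x ∈ S₂
      · exact Or.inr (Or.inr h2)
      left
      have h1' : |x 0 - a| < Λ * L := not_le.1 h1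
      have h2' : perpNorm x < ρ := not_le.1 h2
      have e1 : |x 1| ≤ perpNorm x := by
        rw [← Real.sqrt_sq_eq_abs]
        exact Real.sqrt_le_sqrt (by nlinarith [sq_nonneg (x 2)])
      have e2 : |x 2| ≤ perpNorm x := by
        rw [← Real.sqrt_sq_eq_abs]
        exact Real.sqrt_le_sqrt (by nlinarith [sq_nonneg (x 1)])
      obtain ⟨z, hz, hxz⟩ := exists_mem_closedBall_latticePoint (a := a) hs0
        (k := k) (l := l) (x := x) (by linarith) (by linarith) (by linarith)
      exact mem_iUnion.2 ⟨⟨z, hz⟩, hxz⟩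
    have b0 : ∫⁻ x in U, ‖v x‖ₑ ^ 2 ≤ ENNReal.ofReal (1 / 4 * ‖v‖ ^ 2) := by
      refine (lintegral_iUnion_closedBall_le (Lp.stronglyMeasurable v).measurable
        (fun z : latticeBox k l => latticePoint a s z) (r := 2 * s) (by positivity) (fun z => ?_)
        (ballIntegrals_eq_zero hA) (B := ENNReal.ofReal ((C * (4 * s) * ‖v‖) ^ 2))
        fun h hh => ?_).trans ?_
      · have hfin : IsFiniteMeasure (volume.restrict
            (Metric.closedBall (latticePoint a s z) (2 * s))) :=
          isFiniteMeasure_restrict.2 measure_closedBall_lt_top.ne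
        exact ((Lp.memLp v).restrict _).integrable one_le_two
      · refine (hC v hu h).trans (ENNReal.ofReal_le_ofReal ?_)
        gcongr
        linarith
      · rw [← ENNReal.ofReal_ofNat 8, ← ENNReal.ofReal_mul (by norm_num)]
        refine ENNReal.ofReal_le_ofReal ?_
        have e1 : C * (4 * s) * ‖v‖ ≤ 1 / 8 * ‖v‖ :=
          mul_le_mul_of_nonneg_right (by linarith) (norm_nonneg _)
        have e2 := pow_le_pow_left₀ (by positivity) e1 2
        nlinarith [sq_nonneg ‖v‖]
    have b1 := hΛ a L hL u hu huL
    have b2 := hρ v hu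
    have htot : ENNReal.ofReal (‖v‖ ^ 2) ≤ ENNReal.ofReal (3 / 4 * ‖v‖ ^ 2) := by
      calc ENNReal.ofReal (‖v‖ ^ 2) = ∫⁻ x in univ, ‖v x‖ₑ ^ 2 := by
            rw [ofReal_norm_sq_eq_lintegral, setLIntegral_univ]
        _ ≤ ∫⁻ x in U ∪ (S₁ ∪ S₂), ‖v x‖ₑ ^ 2 := lintegral_mono_set hcover
        _ ≤ (∫⁻ x in U, ‖v x‖ₑ ^ 2) + ((∫⁻ x in S₁, ‖v x‖ₑ ^ 2) + ∫⁻ x in S₂, ‖v x‖ₑ ^ 2) :=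
            (lintegral_union_le _ _ _).trans (add_le_add le_rfl (lintegral_union_le _ _ _))
        _ ≤ ENNReal.ofReal (1 / 4 * ‖v‖ ^ 2) + (ENNReal.ofReal (1 / 4 * ‖v‖ ^ 2)
              + ENNReal.ofReal (1 / 4 * ‖v‖ ^ 2)) := add_le_add b0 (add_le_add b1 b2)
        _ = _ := by
            rw [← ENNReal.ofReal_add (by positivity) (by positivity),
              ← ENNReal.ofReal_add (by positivity) (by positivity)]
            congr 1
            ring
    rw [ENNReal.ofReal_le_ofReal_iff (by positivity)] at htot
    have : ‖v‖ ^ 2 = 0 := le_antisymm (by linarith) (sq_nonneg _)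
    exact norm_eq_zero.1 (pow_eq_zero_iff two_ne_zero |>.1 this)

/-! ### The band position operator -/

theorem mem_ran_iff (u : L2) : u ∈ ran 𝒮.P ↔ 𝒮.P u = u :=
  ⟨fun ⟨v, hv⟩ => by rw [← hv]; exact 𝒮.P_P v, fun h => ⟨u, h⟩⟩

theorem completeSpace_ran : CompleteSpace (ran 𝒮.P) := by
  have h : IsClosed (ran 𝒮.P : Set L2) := by
    have e : (ran 𝒮.P : Set L2) = {u | 𝒮.P u = u} := by
      ext u
      exact 𝒮.mem_ran_iff u
    rw [e]
    exact isClosed_eq 𝒮.P.continuous continuous_id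
  exact h.completeSpace_coe

/-- An element of the domain of the band position operator, as an element of the domain of the
position operator. -/
def toPosition (u : (bandPosition 𝒮.P).domain) : positionDomain := ⟨((u : ran 𝒮.P) : L2), u.2⟩

theorem P_toPosition (u : (bandPosition 𝒮.P).domain) : 𝒮.P (𝒮.toPosition u) = 𝒮.toPosition u :=
  (𝒮.mem_ran_iff _).1 (u : ran 𝒮.P).2

theorem coe_bandPosition (u : (bandPosition 𝒮.P).domain) :
    ((bandPosition 𝒮.P u : ran 𝒮.P) : L2) = 𝒮.P (coordMul (𝒮.toPosition u)) := rfl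

theorem bandPosition_symm (u v : (bandPosition 𝒮.P).domain) :
    inner ℂ (bandPosition 𝒮.P u) (v : ran 𝒮.P) = inner ℂ (u : ran 𝒮.P) (bandPosition 𝒮.P v) := by
  rw [Submodule.coe_inner, Submodule.coe_inner, coe_bandPosition, coe_bandPosition,
    𝒮.inner_P (coordMul (𝒮.toPosition u)), ← 𝒮.inner_P ((u : ran 𝒮.P) : L2)]
  have h1 : 𝒮.P ((v : ran 𝒮.P) : L2) = (v : ran 𝒮.P) := 𝒮.P_toPosition v
  have h2 : 𝒮.P ((u : ran 𝒮.P) : L2) = (u : ran 𝒮.P) := 𝒮.P_toPosition u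
  rw [h1, h2]
  exact inner_coordMul (𝒮.toPosition u) (𝒮.toPosition v)

/-- The bounded operator `b P exp (-(x₁ / b)²) P` on the range of the projection. -/
def bandGauss (b : ℝ) : ran 𝒮.P →L[ℂ] ran 𝒮.P :=
  (((b : ℂ) • (𝒮.P * gaussOp b 0)).comp (ran 𝒮.P).subtypeL).codRestrict (ran 𝒮.P)
    fun _ => (ran 𝒮.P).smul_mem _ ⟨_, rfl⟩

theorem coe_bandGauss (b : ℝ) (u : ran 𝒮.P) :
    (𝒮.bandGauss b u : L2) = (b : ℂ) • 𝒮.P (gaussOp b 0 u) := rfl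

theorem bandGauss_symm (b : ℝ) (u v : ran 𝒮.P) :
    inner ℂ (𝒮.bandGauss b u) v = inner ℂ u (𝒮.bandGauss b v) := by
  rw [Submodule.coe_inner, Submodule.coe_inner, coe_bandGauss, coe_bandGauss, inner_smul_left,
    inner_smul_right, Complex.conj_ofReal, 𝒮.inner_P, ← 𝒮.inner_P (u : L2),
    (𝒮.mem_ran_iff _).1 u.2, (𝒮.mem_ran_iff _).1 v.2]
  congr 1
  exact inner_mulOp_ofReal (bddCont_gauss b 0) u v

/-- The shifted equation with a = 0 is solved for the right-hand side b⁻¹f; one b serves both signs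
σ. -/
theorem exists_bandPosition_surjective : ∃ b : ℝ, ∀ σ : ℝ, σ ^ 2 = 1 → ∀ f : ran 𝒮.P,
    ∃ u : (bandPosition 𝒮.P).domain,
      bandPosition 𝒮.P u + (σ : ℂ) • Complex.I • 𝒮.bandGauss b u = f := by
  obtain ⟨b, hb1, hb⟩ := 𝒮.exists_shift_bound
  have hb0 : b ≠ 0 := by linarith
  refine ⟨b, fun σ hσ f => ?_⟩
  obtain ⟨h1, h2⟩ := hb σ b 0 hσ le_rfl
  obtain ⟨u, hu, huf⟩ := exists_shift_solution hb0 h1 h2 ((b : ℂ)⁻¹ • (f : L2))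
    (by rw [map_smul, (𝒮.mem_ran_iff _).1 f.2])
  refine ⟨⟨⟨u, (𝒮.mem_ran_iff _).2 hu⟩, u.2⟩, Subtype.ext ?_⟩
  rw [smul_smul, mul_inv_cancel₀ (by exact_mod_cast hb0), one_smul, Complex.ofReal_zero, zero_smul,
    sub_zero] at huf
  rw [← huf, Submodule.coe_add, Submodule.coe_smul, Submodule.coe_smul, coe_bandGauss,
    coe_bandPosition, smul_smul, smul_smul]
  congr 2
  ring

theorem isMaximalSymmetric_bandPosition : IsMaximalSymmetric (bandPosition 𝒮.P) ∧
    Dense ((bandPosition 𝒮.P).domain : Set (ran 𝒮.P)) := by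
  have := 𝒮.completeSpace_ran
  obtain ⟨b, hb⟩ := 𝒮.exists_bandPosition_surjective
  have hp : ∀ f, ∃ u : (bandPosition 𝒮.P).domain,
      bandPosition 𝒮.P u + Complex.I • 𝒮.bandGauss b u = f := by
    simpa using hb 1 (by norm_num)
  have hm : ∀ f, ∃ u : (bandPosition 𝒮.P).domain,
      bandPosition 𝒮.P u - Complex.I • 𝒮.bandGauss b u = f := by
    simpa [sub_eq_add_neg] using hb (-1) (by norm_num)
  exact ⟨isMaximalSymmetric_of_surjective 𝒮.bandPosition_symm _ (𝒮.bandGauss_symm b) hp hm,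
    dense_domain_of_surjective 𝒮.bandPosition_symm _ (𝒮.bandGauss_symm b) hp hm⟩

theorem exists_separates : ∃ M : ℝ, ∀ a L : ℝ, 1 ≤ L →
    ∃ (n : ℕ) (A : ran 𝒮.P →L[ℂ] (Fin n → ℂ)), (n : ℝ) ≤ M * L ∧
      Separates (bandPosition 𝒮.P) a L A := by
  obtain ⟨M, hM⟩ := 𝒮.exists_separating
  refine ⟨M, fun a L hL => ?_⟩
  obtain ⟨n, A, hn, hA⟩ := hM a L hL
  refine ⟨n, A.comp (ran 𝒮.P).subtypeL, hn, fun u hu huL => ?_⟩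
  exact Subtype.ext (Subtype.ext (hA (𝒮.toPosition u) (𝒮.P_toPosition u) hu huL))

/-- The exponent is a convex combination of the two extreme exponents, hence at most their maximum,
and exp(max) is at most the sum of the exponentials. The bound C₁ + C₂ is therefore uniform in β. -/
theorem exists_eigenvector_decay {αpar αperp : ℝ}
    (hpar : IsParallelExponent 𝒮.V 𝒮.Γ.trace αpar) (h0 : 0 < αperp)
    (hE : αperp < Real.sqrt 𝒮.Eplus) : ∃ M : ℝ, ∀ β ∈ Icc (0 : ℝ) 1, ∀ (g : ℝ)
      (u : ran 𝒮.P), u ∈ eigenspaceOf (bandPosition 𝒮.P) (g : ℂ) → ‖u‖ = 1 →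
      ∫⁻ x : R3, ENNReal.ofReal (Real.exp (2 * (1 - β) * αpar * |x 0 - g|) *
        Real.exp (2 * β * αperp * perpNorm x) * ‖(u : L2) x‖ ^ 2) ≤ ENNReal.ofReal M := by
  obtain ⟨C₁, hC₁0, hC₁⟩ := 𝒮.exists_parallel_decay hpar
  obtain ⟨C₂, hC₂0, hC₂⟩ := 𝒮.exists_perp_decay h0.le hE
  refine ⟨C₁ + C₂, fun β hβ g u ⟨hu, hug⟩ hu1 => ?_⟩
  have hu1' : ‖(u : L2)‖ = 1 := hu1
  have d1 := hC₁ g (𝒮.toPosition ⟨u, hu⟩) (𝒮.P_toPosition ⟨u, hu⟩) (congrArg Subtype.val hug)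
  have d2 := hC₂ u ((𝒮.mem_ran_iff _).1 u.2)
  change ∫⁻ x, ENNReal.ofReal (Real.exp (2 * αpar * |x 0 - g|) * ‖(u : L2) x‖ ^ 2)
    ≤ ENNReal.ofReal (C₁ * ‖(u : L2)‖ ^ 2) at d1
  rw [hu1', one_pow, mul_one] at d1 d2
  rw [ENNReal.ofReal_add hC₁0 hC₂0]
  refine le_trans ?_ (add_le_add d1 d2)
  have hm : AEMeasurable (fun x : R3 => ENNReal.ofReal
      (Real.exp (2 * αpar * |x 0 - g|) * ‖(u : L2) x‖ ^ 2)) := by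
    have h1 : Measurable fun x : R3 => Real.exp (2 * αpar * |x 0 - g|) :=
      Continuous.measurable (by fun_prop)
    exact (h1.aemeasurable.mul
      ((Lp.aestronglyMeasurable (u : L2)).norm.aemeasurable.pow_const 2)).ennreal_ofReal
  rw [← lintegral_add_left' hm]
  refine lintegral_mono fun x => ?_
  rw [← ENNReal.ofReal_add (by positivity) (by positivity), ← add_mul]
  refine ENNReal.ofReal_le_ofReal (mul_le_mul_of_nonneg_right ?_ (by positivity))
  set p := 2 * αpar * |x 0 - g|
  set q := 2 * αperp * perpNorm x
  have e : 2 * (1 - β) * αpar * |x 0 - g| + 2 * β * αperp * perpNorm x ≤ max p q := by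
    have e1 : 2 * (1 - β) * αpar * |x 0 - g| + 2 * β * αperp * perpNorm x
        = (1 - β) * p + β * q := by ring
    rw [e1]
    have := mul_le_mul_of_nonneg_left (le_max_left p q) (sub_nonneg.2 hβ.2)
    have := mul_le_mul_of_nonneg_left (le_max_right p q) hβ.1
    linarith
  rw [← Real.exp_add]
  refine (Real.exp_le_exp.2 e).trans ?_
  rcases max_choice p q with h | h <;> rw [h] <;> linarith [Real.exp_pos p, Real.exp_pos q]

end Setting

end BandPosition

end

/-! ### The main theorem. -/

theorem theorem2p2
    -- the potential: uniformly locally square integrable, decaying away from the first axis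
    (V : BandPosition.R3 → ℝ)
    (hVmeas : AEStronglyMeasurable V volume)
    (hVloc : BandPosition.uniformMass V < ⊤)
    (hVdecay : Tendsto (BandPosition.outerMass V) atTop (𝓝 0))
    -- the isolated part of the spectrum, with supremum `-Eplus < 0`
    (σ₀ : Set ℝ) (Eplus : ℝ)
    (hσ₀ : ∀ E ∈ σ₀, (E : ℂ) ∈ BandPosition.spec (BandPosition.hamiltonian V))
    (hisolated : ∃ δ > 0, ∀ E ∈ σ₀, ∀ w ∈ BandPosition.spec (BandPosition.hamiltonian V),
      w ∉ Complex.ofReal '' σ₀ → δ ≤ dist (E : ℂ) w)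
    (hEplus : IsLUB σ₀ (-Eplus)) (hEplus_pos : 0 < Eplus)
    -- the contour and the Riesz projection
    (Γ : BandPosition.EnclosingContour
      (BandPosition.spec (BandPosition.hamiltonian V)) (Complex.ofReal '' σ₀))
    (P₀ : BandPosition.L2 →L[ℂ] BandPosition.L2)
    (hP₀ : P₀ = BandPosition.rieszProjection (BandPosition.hamiltonian V) Γ) :
    -- (i) self-adjointness in the Hilbert space `Ran P₀`
    (∃ _ : CompleteSpace (BandPosition.ran P₀), IsSelfAdjoint (BandPosition.bandPosition P₀)) ∧
    -- (ii) purely discrete spectrum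
    BandPosition.HasPurelyDiscreteSpectrum (BandPosition.bandPosition P₀) ∧
    -- (iii) exponential localization of the eigenfunctions
    ((∃ αpar : ℝ, BandPosition.IsParallelExponent V Γ.trace αpar) ∧
      ∀ αpar : ℝ, BandPosition.IsParallelExponent V Γ.trace αpar →
      ∀ αperp : ℝ, 0 < αperp → αperp < Real.sqrt Eplus →
      ∃ M₁ : ℝ, ∀ β ∈ Icc (0 : ℝ) 1, ∀ g : ℝ,
        (g : ℂ) ∈ BandPosition.spec (BandPosition.bandPosition P₀) →
        ∀ (m : ℕ) (W : OrthonormalBasis (Fin m) ℂ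
          (BandPosition.eigenspaceOf (BandPosition.bandPosition P₀) (g : ℂ))) (j : Fin m),
          ∫⁻ x : BandPosition.R3, ENNReal.ofReal
            (Real.exp (2 * (1 - β) * αpar * |x 0 - g|) *
              Real.exp (2 * β * αperp * BandPosition.perpNorm x) *
              ‖(((W j : BandPosition.ran P₀) : BandPosition.L2) : BandPosition.R3 → ℂ) x‖ ^ 2)
            ≤ ENNReal.ofReal M₁) ∧
    -- (iv) uniformly bounded density of the eigenvalues
    (∃ M₂ : ℝ, ∀ a L : ℝ, 1 ≤ L →
      BandPosition.totalMultiplicity (BandPosition.bandPosition P₀) (a - L) (a + L)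
        ≤ ENNReal.ofReal (M₂ * L)) := by
  obtain ⟨x₀, -, hx₀⟩ := BandPosition.exists_real_not_mem_spec hisolated hEplus
  set 𝒮 : BandPosition.Setting := ⟨V, ⟨hVmeas, hVloc, hVdecay⟩, σ₀, Eplus, hEplus_pos,
    fun _ he => hEplus.1 he, x₀, hx₀, Γ⟩
  obtain rfl : P₀ = 𝒮.P := hP₀
  have hcomplete := 𝒮.completeSpace_ran
  obtain ⟨hmax, hdense⟩ := 𝒮.isMaximalSymmetric_bandPosition
  obtain ⟨M, hM⟩ := 𝒮.exists_separates
  refine ⟨⟨hcomplete, hmax.isSelfAdjoint hdense⟩,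
    BandPosition.hasPurelyDiscreteSpectrum_of_separates hmax fun a => ?_,
    ⟨𝒮.exists_isParallelExponent, fun αpar hpar αperp h0 hE => ?_⟩, M, fun a L hL => ?_⟩
  · obtain ⟨n, A, -, hA⟩ := hM a 1 le_rfl
    exact ⟨n, A, hA⟩
  · obtain ⟨M₁, hM₁⟩ := 𝒮.exists_eigenvector_decay hpar h0 hE
    exact ⟨M₁, fun β hβ g _ m W j => hM₁ β hβ g _ (W j).2 (W.norm_eq_one j)⟩
  · obtain ⟨n, A, hn, hA⟩ := hM a L hL
    refine (hA.totalMultiplicity_le hmax).trans ?_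
    rw [← ENNReal.ofReal_natCast]
    exact ENNReal.ofReal_le_ofReal hn
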